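/- Let $d\ge 1$ and let $V=\{v_1,\dots,v_n\}$ be a family of not necessarily distinct nonzero vectors of $\mathbb Z^d$ (subsets of $V$ are counted with multiplicity, i.e. they are sets of indices) which spans $\mathbb R^d$ and is unimodular: $|\det W|\le 1$ for all $W\subset V$ with $\#W=d$. Let $B_V$ be the box spline, the function with $\int_{\mathbb R^d} f B_V=\int_{[0,1]^n} f(u_1v_1+\dots+u_nv_n)\,du$ for all continuous $f$. Let $$\varrho=\varrho_V=\max\{r:\ \operatorname{span}(V\setminus W)=\mathbb R^d\ \text{for all } W\subset V,\ \#W=r\},$$ $$\Lambda=\{U\subset V:\ \#U=\varrho+1,\ \operatorname{span}(V\setminus U)\ne\mathbb R^d\},$$ and for $U\in\Lambda$ define the Bernoulli spline (sum by partial sums over $\alpha\in\{-N,\dots,N\}^d$) $$B(V,U)(x)=\sum_{\alpha\in\mathbb Z^d\setminus\{0\},\ \alpha\perp V\setminus U}\ \prod_{v\in U}\frac1{2\pi i\,\alpha\cdot v}\ e^{2\pi i\alpha\cdot x},\qquad D_U=\prod_{v\in U}D_v ,$$ where $D_v$ is the (weak) directional derivative. For $h>0$ let $P_h$ be the orthogonal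 projection of $L^2(\mathbb R^d)$ onto the closed span of $\{B_V(\cdot/h-\alpha):\alpha\in\mathbb Z^d\}$, and $P=P_1$. Extend $P$ to locally integrable $g$ whose integrals $\int_{\alpha+[0,1]^d}|g|$ grow at most polynomially in $\alpha\in\mathbb Z^d$: $Pg=\sum_\alpha c_\alpha B_V(\cdot-\alpha)$, where $(c_\alpha)$ has polynomial growth and $g-Pg$ is orthogonal to all $B_V(\cdot-\alpha)$, $\alpha\in\mathbb Z^d$; put $P_hf(x)=\big(P(f(h\,\cdot))\big)(x/h)$. Let $L_\beta(x)=P([\,]^\beta)(x)-x^\beta$, where $[\,]^\beta(x)=x^\beta$. Then: 0. For each such $g$ the coefficients $(c_\alpha)$ exist and are unique, and the extended $P_h$ agrees with the orthogonal projection on $L^2(\mathbb R^d)$. For every $U\in\Lambda$ the series defining $B(V,U)$ converges at every $x\in\mathbb R^d$, and $B(V,U)$ is (essentially) bounded on $[0,1]^d$. 1. The functions $B(V,U)$, $U\in\Lambda$, are mutually orthogonal in $L^2([0,1]^d)$. 2. Let $1\le p<\infty$. For every $f\in W_p^{\varrho+1}(\mathbb R^d)$ the weak derivatives $D_Uf$,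 $U\in\Lambda$, exist and lie in $L^p(\mathbb R^d)$, and the asymptotic error integral $$E_p(f)=\int_{\mathbb R^d}\int_{[0,1]^d}\Big|\sum_{|\beta|=\varrho+1}\frac1{\beta!}D^\beta f(t)L_\beta(x)\Big|^p dx\,dt$$ is finite and satisfies $$\lim_{h\to0^+}\Big\|\frac{f-P_hf}{h^{\varrho+1}}\Big\|_p^p=E_p(f)=\int_{\mathbb R^d}\int_{[0,1]^d}\Big|\sum_{U\in\Lambda}D_Uf(t)B(V,U)(x)\Big|^p dx\,dt .$$ Moreover there are constants $0<c\le C<\infty$, depending only on $V$ and $p$, such that for all $f\in W_p^{\varrho+1}(\mathbb R^d)$ $$c\sum_{U\in\Lambda}\|D_Uf\|_p^p\int_{[0,1]^d}|B(V,U)|^p\ \le\ E_p(f)\ \le\ C\sum_{U\in\Lambda}\|D_Uf\|_p^p\int_{[0,1]^d}|B(V,U)|^p ,$$ and for $p=2$ one has $E_2(f)=\sum_{U\in\Lambda}\|D_Uf\|_2^2\int_{[0,1]^d}|B(V,U)|^2$. 3. For $1\le p<\infty$ the functional $f\mapsto E_p(f)^{1/p}$, the limit of $\|(f-P_hf)/h^{\varrho+1}\|_p$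 as $h\to0^+$, is a seminorm on $W_p^{\varrho+1}(\mathbb R^d)$. -/

import Mathlib

open MeasureTheory Filter Topology
open scoped ENNReal NNReal ContDiff

noncomputable section

namespace BoxSpline

/-! ### Admissible and unimodular families of integer vectors

A family `V = {v_1, …, v_n}` of not necessarily distinct vectors of `ℤ^d` is indexed by `Fin n`;
a subset of `V` is a set of indices. -/

/-- An integer vector viewed in `ℝ^d`. -/
def toReal {d : ℕ} (a : Fin d → ℤ) : Fin d → ℝ := fun j => (a j : ℝ)

/-- The real span of the vectors of `V` whose indices lie in `W`. -/
def spanOf {d n : ℕ} (V : Fin n → Fin d → ℤ) (W : Finset (Fin n)) :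
    Submodule ℝ (Fin d → ℝ) :=
  Submodule.span ℝ ((fun i => toReal (V i)) '' (W : Set (Fin n)))

/-- Nonzero integer vectors that span `ℝ^d`. -/
def Admissible {d n : ℕ} (V : Fin n → Fin d → ℤ) : Prop :=
  (∀ i, V i ≠ 0) ∧ spanOf V Finset.univ = ⊤

/-- Every `d × d` determinant formed from `d` members of the family is `-1`, `0` or `1`. -/
def Unimodular {d n : ℕ} (V : Fin n → Fin d → ℤ) : Prop :=
  ∀ w : Fin d → Fin n, Function.Injective w →
    |Matrix.det (Matrix.of fun i j => V (w i) j)| ≤ 1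

/-- `ϱ_V`: the largest `r` such that `V` still spans after the removal of any `r` members. -/
def rho {d n : ℕ} (V : Fin n → Fin d → ℤ) : ℕ :=
  sSup {r : ℕ | r ≤ n ∧ ∀ W : Finset (Fin n), W.card = r → spanOf V Wᶜ = ⊤}

open Classical in
/-- `Λ`: the subsets `U` of `V` with `ϱ_V + 1` members such that `V \ U` does not span. -/
def Lam {d n : ℕ} (V : Fin n → Fin d → ℤ) : Finset (Finset (Fin n)) :=
  Finset.univ.filter fun U => U.card = rho V + 1 ∧ spanOf V Uᶜ ≠ ⊤

/-! ### Bernoulli splines -/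

/-- The part over `α ∈ {-N, …, N}^d` of the series
`∑_{α ≠ 0, α ⊥ V \ U} ∏_{v ∈ U} (2πi α·v)⁻¹ e^{2πi α·x}`. -/
def bernoulliPartial {d n : ℕ} (V : Fin n → Fin d → ℤ) (U : Finset (Fin n)) (N : ℕ)
    (x : Fin d → ℝ) : ℂ :=
  ∑ α ∈ (Finset.Icc (fun _ => -(N : ℤ)) (fun _ => (N : ℤ)) : Finset (Fin d → ℤ)).filter
      (fun α => α ≠ 0 ∧ ∀ i ∈ Uᶜ, V i ⬝ᵥ α = 0),
    (∏ i ∈ U, 1 / (2 * (Real.pi : ℂ) * Complex.I * ((α ⬝ᵥ V i : ℤ) : ℂ))) *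
      Complex.exp (2 * (Real.pi : ℂ) * Complex.I * ((toReal α ⬝ᵥ x : ℝ) : ℂ))

/-- The Bernoulli spline `B(V,U)`: the pointwise sum of the series, by symmetric partial sums
(the series need not converge absolutely when `ϱ_V = 0`). -/
def bernoulliSpline {d n : ℕ} (V : Fin n → Fin d → ℤ) (U : Finset (Fin n))
    (x : Fin d → ℝ) : ℂ :=
  limUnder atTop (fun N : ℕ => bernoulliPartial V U N x)

/-- The unit cube `[0,1]^d`. -/
def cube (d : ℕ) : Set (Fin d → ℝ) := Set.Icc 0 1

/-! ### The box spline and the orthogonal projection -/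

/-- The box spline `B_V`: the Lebesgue density of the image of Lebesgue measure on `[0,1]^n` under
`u ↦ u_1 v_1 + ⋯ + u_n v_n`, so that `∫ f B_V = ∫_{[0,1]^n} f(Vu) du` for continuous `f`. -/
def boxSpline {d n : ℕ} (V : Fin n → Fin d → ℤ) (x : Fin d → ℝ) : ℝ :=
  (((volume.restrict (cube n)).map
    (fun u : Fin n → ℝ => ∑ i, u i • toReal (V i))).rnDeriv volume x).toReal

/-- `S_{L²}(hV)`: the closed linear span in `L²(ℝ^d)` of the functions `B_V(·/h - α)`,
`α ∈ ℤ^d`. -/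
def splineSpace {d n : ℕ} (V : Fin n → Fin d → ℤ) (h : ℝ) :
    Submodule ℂ (Lp ℂ 2 (volume : Measure (Fin d → ℝ))) :=
  (Submodule.span ℂ {g : Lp ℂ 2 (volume : Measure (Fin d → ℝ)) | ∃ α : Fin d → ℤ,
    g =ᵐ[volume] fun x => ((boxSpline V (h⁻¹ • x - toReal α) : ℝ) : ℂ)}).topologicalClosure

/-- The orthogonal projection of `L²(ℝ^d)` onto `S_{L²}(hV)`. -/
def projL2 {d n : ℕ} (V : Fin n → Fin d → ℤ) (h : ℝ) :
    Lp ℂ 2 (volume : Measure (Fin d → ℝ)) →L[ℂ] Lp ℂ 2 (volume : Measure (Fin d → ℝ)) :=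
  haveI : CompleteSpace (splineSpace V h) :=
    (Submodule.isClosed_topologicalClosure _).completeSpace_coe
  (splineSpace V h).starProjection

/-- Polynomial growth of a family of coefficients. -/
def PolyGrowth {d : ℕ} {F : Type*} [Norm F] (c : (Fin d → ℤ) → F) : Prop :=
  ∃ (C : ℝ) (N : ℕ), ∀ α, ‖c α‖ ≤ C * (1 + ‖α‖) ^ N

/-- Locally integrable functions whose integrals over the cubes `α + [0,1]^d` grow at most
polynomially in `α`; this class contains the polynomials and all the spaces `L^p(ℝ^d)`. -/
def SlowGrowth {d : ℕ} (g : (Fin d → ℝ) → ℂ) : Prop :=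
  LocallyIntegrable g volume ∧
    PolyGrowth fun α : Fin d → ℤ => ∫ x in Set.Icc (toReal α) (toReal α + 1), ‖g x‖

/-- The spline `∑_α c_α B_V(x - α)`. -/
def splineSum {d n : ℕ} (V : Fin n → Fin d → ℤ) (c : (Fin d → ℤ) → ℂ)
    (x : Fin d → ℝ) : ℂ :=
  ∑' α : Fin d → ℤ, c α * ((boxSpline V (x - toReal α) : ℝ) : ℂ)

/-- `c` has polynomial growth, and `g - ∑_α c_α B_V(· - α)` is orthogonal to every integer
translate of `B_V`. -/
def IsProjCoeff {d n : ℕ} (V : Fin n → Fin d → ℤ) (g : (Fin d → ℝ) → ℂ)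
    (c : (Fin d → ℤ) → ℂ) : Prop :=
  PolyGrowth c ∧ ∀ α : Fin d → ℤ,
    ∫ x, (g x - splineSum V c x) * ((boxSpline V (x - toReal α) : ℝ) : ℂ) = 0

open Classical in
/-- The extension of the orthogonal projection `P = P_1` to functions of slow growth. -/
def proj {d n : ℕ} (V : Fin n → Fin d → ℤ) (g : (Fin d → ℝ) → ℂ) : (Fin d → ℝ) → ℂ :=
  if h : ∃ c, IsProjCoeff V g c then splineSum V h.choose else 0

/-- `P_h = σ_h ∘ P ∘ σ_{1/h}`, where `σ_h f(x) = f(x/h)`. -/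
def projScaled {d n : ℕ} (V : Fin n → Fin d → ℤ) (h : ℝ) (f : (Fin d → ℝ) → ℂ) :
    (Fin d → ℝ) → ℂ :=
  fun x => proj V (fun y => f (h • y)) (h⁻¹ • x)

/-- The monomial `x^β`. -/
def mono {d : ℕ} (β : Fin d → ℕ) (x : Fin d → ℝ) : ℂ := ∏ j, (x j : ℂ) ^ β j

/-- `L_β = P([ ]^β) - [ ]^β`. -/
def Lfun {d n : ℕ} (V : Fin n → Fin d → ℤ) (β : Fin d → ℕ) (x : Fin d → ℝ) : ℂ :=
  proj V (mono β) x - mono β x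

/-! ### Weak derivatives and Sobolev spaces -/

/-- The iterated directional derivative `D_{v_1} ⋯ D_{v_m} φ` along a list of vectors. -/
def iterDeriv {d : ℕ} : List (Fin d → ℝ) → ((Fin d → ℝ) → ℝ) → (Fin d → ℝ) → ℝ
  | [], φ => φ
  | v :: l, φ => fun x => fderiv ℝ (iterDeriv l φ) x v

/-- `g` is the weak derivative of `f` along the vectors of the list `l`. -/
def IsWeakDeriv {d : ℕ} (l : List (Fin d → ℝ)) (f g : (Fin d → ℝ) → ℂ) : Prop :=
  LocallyIntegrable f volume ∧ LocallyIntegrable g volume ∧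
    ∀ φ : (Fin d → ℝ) → ℝ, ContDiff ℝ ∞ φ → HasCompactSupport φ →
      ∫ x, ((iterDeriv l φ x : ℝ) : ℂ) * f x = (-1) ^ l.length * ∫ x, ((φ x : ℝ) : ℂ) * g x

open Classical in
/-- The weak derivative (unique up to a null set), or `0` if there is none. -/
def weakDeriv {d : ℕ} (l : List (Fin d → ℝ)) (f : (Fin d → ℝ) → ℂ) : (Fin d → ℝ) → ℂ :=
  if h : ∃ g, IsWeakDeriv l f g then h.choose else 0

/-- The directions of `D^β`: the unit vector `e_j` occurs `β_j` times. -/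
def multiDirs {d : ℕ} (β : Fin d → ℕ) : List (Fin d → ℝ) :=
  (List.finRange d).flatMap fun j => List.replicate (β j) (Pi.single j 1)

/-- The directions of `D_U = ∏_{v ∈ U} D_v`. -/
def setDirs {d n : ℕ} (V : Fin n → Fin d → ℤ) (U : Finset (Fin n)) : List (Fin d → ℝ) :=
  (U.sort (· ≤ ·)).map fun i => toReal (V i)

/-- The Sobolev space `W_p^k(ℝ^d)`. -/
def MemSobolev {d : ℕ} (k : ℕ) (p : ℝ) (f : (Fin d → ℝ) → ℂ) : Prop :=
  MemLp f (ENNReal.ofReal p) volume ∧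
    ∀ β : Fin d → ℕ, ∑ j, β j ≤ k →
      ∃ g, IsWeakDeriv (multiDirs β) f g ∧ MemLp g (ENNReal.ofReal p) volume

/-! ### The integrals that are compared -/

/-- The asymptotic error integral
`∫_{ℝ^d} ∫_{[0,1]^d} |∑_{|β| = ϱ_V + 1} (1/β!) D^β f(t) L_β(x)|^p dx dt`. -/
def errorIntegral {d n : ℕ} (V : Fin n → Fin d → ℤ) (p : ℝ) (f : (Fin d → ℝ) → ℂ) : ℝ≥0∞ :=
  ∫⁻ t, ∫⁻ x in cube d,
    ‖∑ β ∈ Finset.piAntidiag (Finset.univ : Finset (Fin d)) (rho V + 1),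
      1 / ((∏ j, (β j).factorial : ℕ) : ℂ) * weakDeriv (multiDirs β) f t * Lfun V β x‖ₑ ^ p

/-- `∫_{ℝ^d} ∫_{[0,1]^d} |∑_{U ∈ Λ} D_U f(t) B(V,U)(x)|^p dx dt`. -/
def bernoulliIntegral {d n : ℕ} (V : Fin n → Fin d → ℤ) (p : ℝ) (f : (Fin d → ℝ) → ℂ) :
    ℝ≥0∞ :=
  ∫⁻ t, ∫⁻ x in cube d,
    ‖∑ U ∈ Lam V, weakDeriv (setDirs V U) f t * bernoulliSpline V U x‖ₑ ^ p

/-- `∑_{U ∈ Λ} ∫_{ℝ^d} |D_U f|^p · ∫_{[0,1]^d} |B(V,U)|^p`. -/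
def sobolevSum {d n : ℕ} (V : Fin n → Fin d → ℤ) (p : ℝ) (f : (Fin d → ℝ) → ℂ) : ℝ≥0∞ :=
  ∑ U ∈ Lam V, (∫⁻ t, ‖weakDeriv (setDirs V U) f t‖ₑ ^ p) *
    ∫⁻ x in cube d, ‖bernoulliSpline V U x‖ₑ ^ p

end BoxSpline

end

open BoxSpline

noncomputable section

namespace BoxSpline

section

/-! ### Linear algebra of unimodular families -/

variable {d n : ℕ} {V : Fin n → Fin d → ℤ}

/-! The argument rests on one fact about frequencies. A nonzero `β ∈ ℤ^d` annihilates every vector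
outside its active set `{v : β·v ≠ 0}`, so by the definition of `ϱ` that set has at least `ϱ + 1`
members (`rho_lt_card_activeSet`); if it has exactly `ϱ + 1`, it belongs to `Λ`. These minimal
frequencies fall into classes, one for each `U ∈ Λ`, and `B(V,U)` is the series over the class of
`U`. Unimodularity makes each class the set of nonzero multiples of one integer normal `a` with `a·v
= ±1` on `U` (`exists_normal`). Hence `B(V,U)` is, up to sign, the one-variable Bernoulli series of
order `ϱ + 1` in `a·x`. Convergence and boundedness follow, also in the conditionally convergent
case `ϱ = 0`, and disjoint spectra give orthogonality.

The projection is explicit. Its coefficients solve a convolution equation with the Gram sequence of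
the translates of `B_V`, which is finitely supported. Its symbol is nonnegative (`symbol_eq`) and,
by unimodularity, has no zero (`symbol_ne_zero`), so the inverse sequence decays rapidly
(`exists_gramInv_decay`). This yields existence and uniqueness for data of slow growth, and
domination of `P` by a convolution with a rapidly decaying kernel (`exists_kernel_bound`).

On polynomials the error is computed by Fourier series. The periodic function `∑_α (w·(x-α))^k
B_V(x-α)` has `β`-th coefficient `∫ (∑ (w·v_i) u_i)^k ∏ e(-(β·v_i) u_i) du` over `[0,1]^n`, and this
vanishes unless every variable active for `β` occurs in a monomial of the power. So for `k ≤ ϱ` the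
function is constant, and for `k = ϱ + 1` it is a constant plus `(-1)^k k! ∑_U ∏_{v∈U} (w·v) B(V,U)`
(`perMoment_ae_eq`). The functions `B(V,U)` are annihilated by `P` (`projFun_bernoulliSpline`).
Expanding the spline with coefficients `(w·α)^k` binomially and applying `P` gives, by induction,
reproduction of `(w·x)^k` for `k ≤ ϱ` and the error `k! ∑_U ∏_{v∈U} (w·v) B(V,U)` for `k = ϱ + 1`
(`projFun_ridge`). Comparing coefficients in `w` gives `L_β/β!` as the combination of the `B(V,U)`
with the coefficients of `X^β` in `∏_{v∈U} v·X`. The same numbers express `D_U` through the `D^β`,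
so `∑ D^βf L_β/β! = ∑_U D_Uf B(V,U)` (`leading_eq_sum`).

For general `f`, Taylor's formula at `x` splits `P_h f(x) - f(x)` into `h^(ϱ+1)` times the leading
term at `(x, x/h)` and the projection of the Taylor remainder (`projFun_sub_ae_eq`). The remainder
is governed by the `L^p` modulus of continuity of the top derivatives, so the kernel bound makes it
`o(h^(ϱ+1))` (`exists_remainder_bound`). Averaging over translations by `hτ`, with `τ` in the unit
cube, separates the slow variable from the periodic one and turns the norm of the leading term into
the double integral in the limit (`tendsto_leading`).

The comparison with `∑ ‖D_Uf‖^p ∫|B(V,U)|^p` is made pointwise in `t`: it concerns the finitely many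
orthogonal bounded functions `B(V,U)`, whose coefficients are recovered by testing against them
(`exists_le_lintegral_bernComb`). The seminorm property is Minkowski's inequality, since
`E_p(f)^(1/p)` is an `L^p` norm of an expression linear in `f`. -/

lemma toReal_add (a b : Fin d → ℤ) : toReal (a + b) = toReal a + toReal b := by
  ext j; simp [toReal]

lemma toReal_sub (a b : Fin d → ℤ) : toReal (a - b) = toReal a - toReal b := by
  ext j; simp [toReal]

lemma toReal_neg (a : Fin d → ℤ) : toReal (-a) = -toReal a := by
  ext j; simp [toReal]

@[simp] lemma toReal_zero : toReal (0 : Fin d → ℤ) = 0 := by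
  ext j; simp [toReal]

lemma toReal_injective : Function.Injective (toReal (d := d)) := by
  intro a b h
  ext j
  have := congrFun h j
  simpa [toReal] using this

lemma toReal_dotProduct (a b : Fin d → ℤ) : toReal a ⬝ᵥ toReal b = ((a ⬝ᵥ b : ℤ) : ℝ) := by
  simp [dotProduct, toReal]

lemma spanOf_mono {S T : Finset (Fin n)} (h : S ⊆ T) : spanOf V S ≤ spanOf V T :=
  Submodule.span_mono (Set.image_mono (by exact_mod_cast h))

lemma mem_spanOf {S : Finset (Fin n)} {i : Fin n} (hi : i ∈ S) : toReal (V i) ∈ spanOf V S :=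
  Submodule.subset_span ⟨i, by exact_mod_cast hi, rfl⟩

/-- A linear functional that vanishes on the generators vanishes on the span. -/
lemma dotProduct_eq_zero_of_mem_spanOf {S : Finset (Fin n)} {x y : Fin d → ℝ}
    (hy : ∀ i ∈ S, toReal (V i) ⬝ᵥ y = 0) (hx : x ∈ spanOf V S) : x ⬝ᵥ y = 0 := by
  unfold spanOf at hx
  induction hx using Submodule.span_induction with
  | mem x h => obtain ⟨i, hi, rfl⟩ := h; exact hy i (by exact_mod_cast hi)
  | zero => simp
  | add x z _ _ h1 h2 => rw [add_dotProduct, h1, h2, add_zero]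
  | smul a x _ h => rw [smul_dotProduct, h, smul_zero]

lemma eq_of_dotProduct_eq {S : Finset (Fin n)} (hS : spanOf V S = ⊤) {x y : Fin d → ℝ}
    (h : ∀ i ∈ S, toReal (V i) ⬝ᵥ x = toReal (V i) ⬝ᵥ y) : x = y := by
  have h0 : ∀ z : Fin d → ℝ, z ⬝ᵥ (x - y) = 0 := fun z =>
    dotProduct_eq_zero_of_mem_spanOf (S := S) (V := V)
      (fun i hi => by rw [dotProduct_sub, h i hi, sub_self]) (hS ▸ Submodule.mem_top)
  have := dotProduct_self_eq_zero.1 (h0 (x - y))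
  exact sub_eq_zero.1 this

/-- A nonspanning subfamily is annihilated by a nonzero vector. -/
lemma exists_annihilator {S : Finset (Fin n)} (hS : spanOf V S ≠ ⊤) :
    ∃ x : Fin d → ℝ, x ≠ 0 ∧ ∀ i ∈ S, toReal (V i) ⬝ᵥ x = 0 := by
  obtain ⟨f, hf, hle⟩ := Submodule.exists_le_ker_of_lt_top _ (lt_top_iff_ne_top.2 hS)
  have hx : ∀ z : Fin d → ℝ, f z = z ⬝ᵥ (fun j => f (Pi.single j 1)) := by
    intro z
    conv_lhs => rw [← Finset.univ_sum_single z, map_sum]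
    refine Finset.sum_congr rfl fun j _ => ?_
    have : (Pi.single j (z j) : Fin d → ℝ) = z j • Pi.single j 1 := by
      ext k; by_cases h : k = j
      · subst h; simp
      · simp [h]
    rw [this, map_smul, smul_eq_mul]
  refine ⟨fun j => f (Pi.single j 1), ?_, fun i hi => ?_⟩
  · intro h0
    apply hf
    refine LinearMap.ext fun z => ?_
    rw [hx, h0]; simp
  · rw [← hx]
    exact hle (mem_spanOf hi)

lemma not_spans_of_annihilator {S : Finset (Fin n)} {x : Fin d → ℝ} (hx : x ≠ 0)
    (h : ∀ i ∈ S, toReal (V i) ⬝ᵥ x = 0) : spanOf V S ≠ ⊤ := by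
  intro hS
  exact hx (eq_of_dotProduct_eq hS (y := 0) (by simpa using h))

/-- A basis of `ℝ^d` chosen from the family, extending a maximal independent subset of `S`. -/
lemma exists_basis_extending (hV : Admissible V) (S : Finset (Fin n)) :
    ∃ w : Fin d → Fin n, Function.Injective w ∧
      LinearIndependent ℝ (fun j => toReal (V (w j))) ∧
      ∀ i ∈ S, toReal (V i) ∈
        Submodule.span ℝ {y | ∃ j, w j ∈ S ∧ y = toReal (V (w j))} := by
  classical
  -- Two extensions in succession: a maximal independent subset `b0` of `S`, then an enlargement of
  -- `b0` inside the whole family. The basis vectors indexed by `S` therefore already span all of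
  -- `S`.
  obtain ⟨b0, hb0S, -, hspan0, hli0⟩ := exists_linearIndepOn_extension
    (K := ℝ) (v := fun i => toReal (V i)) (s := ∅) (t := (S : Set (Fin n)))
    (linearIndepOn_empty _ _) (Set.empty_subset _)
  obtain ⟨b, -, hb0b, hspan, hli⟩ := exists_linearIndepOn_extension
    (K := ℝ) (v := fun i => toReal (V i)) (s := b0) (t := Set.univ) hli0 (Set.subset_univ _)
  have htop : (⊤ : Submodule ℝ (Fin d → ℝ)) ≤
      Submodule.span ℝ (Set.range fun i : b => toReal (V i)) := by
    rw [← hV.2, spanOf, Submodule.span_le]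
    have : (Set.range fun i : b => toReal (V i)) = (fun i => toReal (V i)) '' b := by
      ext y; simp
    rw [this]
    simpa using hspan
  let B : Module.Basis b ℝ (Fin d → ℝ) := Module.Basis.mk hli htop
  have hcard : Fintype.card b = d := by
    have h1 := Module.finrank_eq_card_basis B
    rw [Module.finrank_fin_fun] at h1
    exact h1.symm
  let e : Fin d ≃ b := (Fintype.equivFinOfCardEq hcard).symm
  refine ⟨fun j => (e j : Fin n), Subtype.val_injective.comp e.injective,
    hli.comp e e.injective, fun i hi => ?_⟩
  have h1 := hspan0 ⟨i, by exact_mod_cast hi, rfl⟩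
  refine Submodule.span_mono ?_ h1
  rintro y ⟨k, hk, rfl⟩
  refine ⟨e.symm ⟨k, hb0b hk⟩, ?_, ?_⟩
  · simpa using hb0S hk
  · simp

/-- A nonzero integer of absolute value at most one is a unit, so a basis of `ℝ^d` taken from the
family is also a basis of `ℤ^d`. Unimodularity enters the proof only through this fact. -/
lemma isUnit_det_of_linearIndependent (hU : Unimodular V) {w : Fin d → Fin n}
    (hw : Function.Injective w) (hli : LinearIndependent ℝ (fun j => toReal (V (w j)))) :
    IsUnit (Matrix.det (Matrix.of fun i j => V (w i) j)) := by
  have h1 := hU w hw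
  have h2 : Matrix.det (Matrix.of fun i j => V (w i) j) ≠ 0 := by
    have h3 := hli
    intro h0
    have h4 : IsUnit (Matrix.of fun j => toReal (V (w j))) :=
      Matrix.linearIndependent_rows_iff_isUnit.1 hli
    rw [Matrix.isUnit_iff_isUnit_det] at h4
    have h5 : (Matrix.of fun j => toReal (V (w j))) =
        (Matrix.of fun i j => V (w i) j).map (Int.castRingHom ℝ) := by
      ext i j; simp [toReal]
    rw [h5, ← RingHom.mapMatrix_apply, ← RingHom.map_det, h0] at h4
    simp at h4
  rw [Int.isUnit_iff_abs_eq]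
  have := Int.one_le_abs h2
  omega

/-- In a unimodular family, a point with integral pairings against `S` may be replaced by an
integer vector with the same pairings. -/
lemma exists_int_vector (hV : Admissible V) (hU : Unimodular V) (S : Finset (Fin n))
    (x : Fin d → ℝ) (r : Fin n → ℤ) (hr : ∀ i ∈ S, toReal (V i) ⬝ᵥ x = r i) :
    ∃ α : Fin d → ℤ, ∀ i ∈ S, V i ⬝ᵥ α = r i := by
  classical
  obtain ⟨w, hw, hli, hspan⟩ := exists_basis_extending hV S
  set A : Matrix (Fin d) (Fin d) ℤ := Matrix.of fun i j => V (w i) j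
  have hA : IsUnit A.det := isUnit_det_of_linearIndependent hU hw hli
  -- The pairings are prescribed on the basis vectors from `S` and put equal to zero on the others;
  -- the inverse matrix is integral. Since the former span `S`, the pairings of `α` and of `x` agree
  -- on all of `S`.
  set α : Fin d → ℤ := A⁻¹.mulVec fun j => if w j ∈ S then r (w j) else 0
  have hα : ∀ j, w j ∈ S → V (w j) ⬝ᵥ α = r (w j) := by
    intro j hj
    have h1 : A.mulVec α = fun j => if w j ∈ S then r (w j) else 0 := by
      rw [Matrix.mulVec_mulVec, Matrix.mul_nonsing_inv _ hA, Matrix.one_mulVec]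
    have h2 := congrFun h1 j
    simp only [hj, if_true] at h2
    exact h2
  refine ⟨α, fun i hi => ?_⟩
  have key : ∀ y ∈ Submodule.span ℝ {y | ∃ j, w j ∈ S ∧ y = toReal (V (w j))},
      y ⬝ᵥ toReal α = y ⬝ᵥ x := by
    intro y hy
    induction hy using Submodule.span_induction with
    | mem y h =>
      obtain ⟨j, hj, rfl⟩ := h
      rw [hr _ hj, toReal_dotProduct, hα j hj]
    | zero => simp
    | add x z _ _ h1 h2 => rw [add_dotProduct, h1, h2, add_dotProduct]
    | smul a x _ h => rw [smul_dotProduct, h, smul_dotProduct]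
  have h := key _ (hspan i hi)
  rw [hr i hi, toReal_dotProduct] at h
  exact_mod_cast h

/-! ### The number `ϱ` and the critical sets -/

/-- The supremum is attained because `0` is admissible and `n` is an upper bound. The bound `r ≤ n`
cannot be dropped: for `r > n` the spanning condition is vacuous. -/
lemma rho_mem (hV : Admissible V) :
    rho V ≤ n ∧ ∀ W : Finset (Fin n), W.card = rho V → spanOf V Wᶜ = ⊤ := by
  have h := Nat.sSup_mem (s := {r : ℕ | r ≤ n ∧ ∀ W : Finset (Fin n), W.card = r →
    spanOf V Wᶜ = ⊤}) ⟨0, Nat.zero_le _, fun W hW => by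
      rw [Finset.card_eq_zero.1 hW, Finset.compl_empty]; exact hV.2⟩
    ⟨n, fun r hr => hr.1⟩
  exact h

lemma spanOf_compl_of_card_le (hV : Admissible V) {U : Finset (Fin n)} (hU : U.card ≤ rho V) :
    spanOf V Uᶜ = ⊤ := by
  obtain ⟨W, hUW, -, hW⟩ := Finset.exists_subsuperset_card_eq (Finset.subset_univ U) hU
    (by simpa using (rho_mem hV).1)
  have h := (rho_mem hV).2 W hW
  exact top_le_iff.1 (h ▸ spanOf_mono (Finset.compl_subset_compl.2 hUW))

/-- The indices of the vectors that are not orthogonal to `β`. -/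
def activeSet (V : Fin n → Fin d → ℤ) (β : Fin d → ℤ) : Finset (Fin n) :=
  Finset.univ.filter fun i => β ⬝ᵥ V i ≠ 0

lemma mem_activeSet {β : Fin d → ℤ} {i : Fin n} : i ∈ activeSet V β ↔ β ⬝ᵥ V i ≠ 0 := by
  simp [activeSet]

lemma spanOf_activeSet_compl {β : Fin d → ℤ} (hβ : β ≠ 0) :
    spanOf V (activeSet V β)ᶜ ≠ ⊤ := by
  refine not_spans_of_annihilator (x := toReal β) ?_ fun i hi => ?_
  · intro h; exact hβ (toReal_injective (by simpa using h))
  · rw [toReal_dotProduct, dotProduct_comm]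
    simp only [Finset.mem_compl, mem_activeSet, not_not] at hi
    exact_mod_cast hi

/-- The vectors outside the active set are all orthogonal to `β`, hence do not span, whereas
removing at most `ϱ` vectors would leave a spanning family. This is the inequality that kills the
Fourier coefficients of the moments of low degree. -/
lemma rho_lt_card_activeSet (hV : Admissible V) {β : Fin d → ℤ} (hβ : β ≠ 0) :
    rho V + 1 ≤ (activeSet V β).card := by
  by_contra! h
  exact spanOf_activeSet_compl hβ (spanOf_compl_of_card_le hV (by omega))

lemma mem_Lam {U : Finset (Fin n)} : U ∈ Lam V ↔ U.card = rho V + 1 ∧ spanOf V Uᶜ ≠ ⊤ := by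
  simp [Lam]

/-- A critical set is cut out by a primitive integer vector whose pairings with it are `±1`. -/
lemma exists_normal (hV : Admissible V) (hU : Unimodular V) {U : Finset (Fin n)}
    (hUL : U ∈ Lam V) :
    ∃ a : Fin d → ℤ, a ≠ 0 ∧ (∀ i ∈ U, |a ⬝ᵥ V i| = 1) ∧ (∀ i ∉ U, a ⬝ᵥ V i = 0) ∧
      ∀ β : Fin d → ℤ, (∀ i ∉ U, β ⬝ᵥ V i = 0) → ∃ k : ℤ, β = k • a := by
  classical
  obtain ⟨hcard, hspan⟩ := mem_Lam.1 hUL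
  -- `U` without `v` has only `ϱ` members. Hence the complement of `U` together with any single `v ∈
  -- U` spans, and the vectors orthogonal to the complement form a line on which no `v ∈ U`
  -- vanishes.
  have hspan' : ∀ v ∈ U, spanOf V (insert v Uᶜ) = ⊤ := by
    intro v hv
    have : insert v Uᶜ = (U.erase v)ᶜ := by
      ext i; simp only [Finset.mem_insert, Finset.mem_compl, Finset.mem_erase]; tauto
    rw [this]
    exact spanOf_compl_of_card_le hV (by rw [Finset.card_erase_of_mem hv]; omega)
  obtain ⟨x, hx0, hx⟩ := exists_annihilator hspan
  have hne : ∀ v ∈ U, ∀ y : Fin d → ℝ, y ≠ 0 → (∀ i ∈ Uᶜ, toReal (V i) ⬝ᵥ y = 0) →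
      toReal (V v) ⬝ᵥ y ≠ 0 := by
    intro v hv y hy0 hy h
    refine hy0 (eq_of_dotProduct_eq (hspan' v hv) (y := 0) fun i hi => ?_)
    rw [dotProduct_zero]
    rcases Finset.mem_insert.1 hi with rfl | hi
    · exact h
    · exact hy i hi
  -- The annihilator is scaled to pair to `1` with `v`; all its pairings with the complement and `v`
  -- are then integers, so it may be taken integral.
  have hexists : ∀ v ∈ U, ∃ a : Fin d → ℤ, V v ⬝ᵥ a = 1 ∧ ∀ i ∈ Uᶜ, V i ⬝ᵥ a = 0 := by
    intro v hv
    have hv0 := hne v hv x hx0 hx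
    obtain ⟨a, ha⟩ := exists_int_vector hV hU (insert v Uᶜ) ((toReal (V v) ⬝ᵥ x)⁻¹ • x)
      (fun i => if i = v then 1 else 0) (by
        intro i hi
        rw [dotProduct_smul, smul_eq_mul]
        rcases Finset.mem_insert.1 hi with rfl | hi
        · simp [inv_mul_cancel₀ hv0]
        · rw [hx i hi, if_neg]
          · simp
          · exact fun h => Finset.mem_compl.1 hi (h ▸ hv))
    refine ⟨a, by simpa using ha v (Finset.mem_insert_self _ _), fun i hi => ?_⟩
    rw [ha i (Finset.mem_insert_of_mem hi), if_neg]
    exact fun h => Finset.mem_compl.1 hi (h ▸ hv)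
  obtain ⟨v₀, hv₀⟩ : U.Nonempty := Finset.card_pos.1 (by omega)
  obtain ⟨a, ha1, ha0⟩ := hexists v₀ hv₀
  -- Both sides have the same pairings with a spanning set. The multiplier is an integer because `β`
  -- and `v` are, so `b` generates all integer vectors on the line.
  have hmul : ∀ v ∈ U, ∀ b : Fin d → ℤ, V v ⬝ᵥ b = 1 → (∀ i ∈ Uᶜ, V i ⬝ᵥ b = 0) →
      ∀ β : Fin d → ℤ, (∀ i ∈ Uᶜ, V i ⬝ᵥ β = 0) → β = (V v ⬝ᵥ β) • b := by
    intro v hv b hb1 hb0 β hβ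
    apply toReal_injective
    refine eq_of_dotProduct_eq (hspan' v hv) fun i hi => ?_
    rw [toReal_dotProduct, toReal_dotProduct, dotProduct_smul, smul_eq_mul]
    rcases Finset.mem_insert.1 hi with rfl | hi
    · rw [hb1, mul_one]
    · rw [hβ i hi, hb0 i hi, mul_zero]
  refine ⟨a, ?_, fun v hv => ?_, fun i hi => ?_, fun β hβ => ?_⟩
  · rintro rfl; simp at ha1
  -- The generator built from another `v ∈ U` gives `a = (v·a) b`. Pairing with `v₀` yields `1 =
  -- (v·a)(v₀·b)` in `ℤ`, so `v·a` is a unit.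
  · obtain ⟨b, hb1, hb0⟩ := hexists v hv
    have h1 := hmul v hv b hb1 hb0 a ha0
    have h2 : V v₀ ⬝ᵥ a = (V v ⬝ᵥ a) * (V v₀ ⬝ᵥ b) := by
      conv_lhs => rw [h1]
      rw [dotProduct_smul, smul_eq_mul]
    rw [ha1] at h2
    rw [dotProduct_comm]
    exact Int.isUnit_iff_abs_eq.1 (IsUnit.of_mul_eq_one _ h2.symm)
  · rw [dotProduct_comm]; exact ha0 i (by simpa using hi)
  · exact ⟨_, hmul v₀ hv₀ a ha1 ha0 β fun i hi => by
      rw [dotProduct_comm]; exact hβ i (by simpa using hi)⟩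

lemma activeSet_mem_Lam {β : Fin d → ℤ} (hβ : β ≠ 0) (hcard : (activeSet V β).card = rho V + 1) :
    activeSet V β ∈ Lam V :=
  mem_Lam.2 ⟨hcard, spanOf_activeSet_compl hβ⟩

/-- For a critical set `U`, the nonzero frequencies orthogonal to the complement of `U` are those
with active set `U`. -/
lemma activeSet_eq_iff (hV : Admissible V) (hU : Unimodular V) {U : Finset (Fin n)}
    (hUL : U ∈ Lam V) {β : Fin d → ℤ} (hβ : β ≠ 0) :
    activeSet V β = U ↔ ∀ i ∉ U, β ⬝ᵥ V i = 0 := by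
  constructor
  · rintro rfl i hi
    simpa [mem_activeSet] using hi
  · intro h
    obtain ⟨a, ha, ha1, -, hk⟩ := exists_normal hV hU hUL
    obtain ⟨k, rfl⟩ := hk β h
    have hk0 : k ≠ 0 := by rintro rfl; simp at hβ
    ext i
    rw [mem_activeSet]
    constructor
    · intro hi; by_contra hiU; exact hi (h i hiU)
    · intro hi
      rw [smul_dotProduct, smul_eq_mul]
      refine mul_ne_zero hk0 fun h0 => ?_
      have := ha1 i hi
      rw [h0] at this; simp at this

end

section

/-! ### The box spline as a bounded density with compact support -/

variable {d n : ℕ} {V : Fin n → Fin d → ℤ}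

/-- The map `u ↦ u_1 v_1 + ⋯ + u_n v_n`. -/
def boxMap (V : Fin n → Fin d → ℤ) (u : Fin n → ℝ) : Fin d → ℝ := ∑ i, u i • toReal (V i)

lemma continuous_boxMap : Continuous (boxMap V) := by
  unfold boxMap; fun_prop

/-- The image of Lebesgue measure on the unit cube. -/
def boxMeasure (V : Fin n → Fin d → ℤ) : Measure (Fin d → ℝ) :=
  (volume.restrict (cube n)).map (boxMap V)

lemma measurableSet_cube : MeasurableSet (cube d) := measurableSet_Icc

lemma volume_cube : volume (cube d) = 1 := by
  simp [cube, Real.volume_Icc_pi]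

instance : IsProbabilityMeasure (volume.restrict (cube d)) :=
  ⟨by simp [volume_cube]⟩

instance : IsProbabilityMeasure (boxMeasure V) :=
  Measure.isProbabilityMeasure_map continuous_boxMap.aemeasurable

lemma mem_cube {x : Fin d → ℝ} : x ∈ cube d ↔ ∀ j, 0 ≤ x j ∧ x j ≤ 1 := by
  simp only [cube, Set.mem_Icc, Pi.le_def, Pi.zero_apply, Pi.one_apply, forall_and]

lemma volume_preimage_basis {w : Fin d → Fin n}
    (hdet : IsUnit (Matrix.det (Matrix.of fun i j => V (w i) j))) (c : Fin d → ℝ)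
    (A : Set (Fin d → ℝ)) :
    volume {y : Fin d → ℝ | (∑ j, y j • toReal (V (w j))) + c ∈ A} = volume A := by
  set M : Matrix (Fin d) (Fin d) ℝ := (Matrix.of fun i j => V (w i) j).map (Int.castRingHom ℝ)
  set L : (Fin d → ℝ) →ₗ[ℝ] (Fin d → ℝ) := Matrix.toLin' M.transpose
  have hdetM : |M.det| = 1 := by
    have h1 : M.det = ((Matrix.det (Matrix.of fun i j => V (w i) j) : ℤ) : ℝ) := by
      have := RingHom.map_det (Int.castRingHom ℝ) (Matrix.of fun i j => V (w i) j)
      rw [RingHom.mapMatrix_apply] at this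
      exact this.symm
    rw [h1, ← Int.cast_abs, Int.isUnit_iff_abs_eq.1 hdet, Int.cast_one]
  have hL : LinearMap.det L = M.det := by
    rw [LinearMap.det_toLin', Matrix.det_transpose]
  have hLy : ∀ y, L y = ∑ j, y j • toReal (V (w j)) := by
    intro y
    ext k
    simp [L, M, Matrix.mulVec, dotProduct, toReal, Finset.sum_apply, mul_comm]
  have hne : LinearMap.det L ≠ 0 := by
    rw [hL]; intro h; rw [h] at hdetM; simp at hdetM
  have hset : {y : Fin d → ℝ | (∑ j, y j • toReal (V (w j))) + c ∈ A} =
      L ⁻¹' ((fun x => x + c) ⁻¹' A) := by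
    ext y; simp [hLy]
  rw [hset, Measure.addHaar_preimage_linearMap _ hne, hL, abs_inv, hdetM]
  simp [measure_preimage_add_right]

/-- Freeze the coordinates outside a basis chosen from the family. In the remaining `d` coordinates
the map is affine with determinant `±1`, so each slice of the preimage of `A`, even without the
constraint to the unit cube, has the volume of `A`. Integrating over the frozen coordinates, which
range over a cube of volume one, gives the bound; hence the density exists and is at most one. -/
lemma boxMeasure_le (hV : Admissible V) (hU : Unimodular V) : boxMeasure V ≤ volume := by
  classical
  obtain ⟨w, hw, hli, -⟩ := exists_basis_extending hV ∅
  have hdet := isUnit_det_of_linearIndependent hU hw hli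
  refine Measure.le_iff.2 fun A hA => ?_
  rw [boxMeasure, Measure.map_apply continuous_boxMap.measurable hA,
    Measure.restrict_apply (continuous_boxMap.measurable hA)]
  obtain ⟨p, hp⟩ : ∃ p : Fin n → Prop, ∀ i, i ∈ Set.range w ↔ p i :=
    ⟨fun i => i ∈ Set.range w, fun _ => Iff.rfl⟩
  let E := MeasurableEquiv.piEquivPiSubtypeProd (fun _ : Fin n => ℝ) p
  have hE : MeasurePreserving E := volume_preserving_piEquivPiSubtypeProd (fun _ : Fin n => ℝ) p
  let T : ({i // p i} → ℝ) × ({i // ¬ p i} → ℝ) → (Fin d → ℝ) :=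
    fun q => (∑ i : {i // p i}, q.1 i • toReal (V i)) + ∑ i : {i // ¬ p i}, q.2 i • toReal (V i)
  have hT : Continuous T := by fun_prop
  let s : Set (({i // p i} → ℝ) × ({i // ¬ p i} → ℝ)) := {q | q.2 ∈ Set.Icc 0 1 ∧ T q ∈ A}
  have hs : MeasurableSet s :=
    (measurableSet_Icc.preimage measurable_snd).inter (hT.measurable hA)
  have hsub : boxMap V ⁻¹' A ∩ cube n ⊆ E ⁻¹' s := by
    rintro u ⟨hu1, hu2⟩
    refine ⟨⟨fun i => (mem_cube.1 hu2 i).1, fun i => (mem_cube.1 hu2 i).2⟩, ?_⟩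
    have : T (E u) = boxMap V u := by
      simp only [T, boxMap]
      exact (Fintype.sum_subtype_add_sum_subtype p (fun i => u i • toReal (V i)))
    rw [this]; exact hu1
  let e : Fin d ≃ {i // p i} := (Equiv.ofInjective w hw).trans (Equiv.subtypeEquivRight hp)
  have he : ∀ j, (e j : Fin n) = w j := fun _ => rfl
  have hfib : ∀ b, volume ((fun a => (a, b)) ⁻¹' s) ≤
      Set.indicator (Set.Icc (0 : {i // ¬ p i} → ℝ) 1) (fun _ => volume A) b := by
    intro b
    by_cases hb : b ∈ Set.Icc (0 : {i // ¬ p i} → ℝ) 1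
    · rw [Set.indicator_of_mem hb]
      have hF := volume_measurePreserving_piCongrLeft (fun _ : {i // p i} => ℝ) e
      have hm : MeasurableSet ((fun a => (a, b)) ⁻¹' s) := hs.preimage (by fun_prop)
      rw [← hF.measure_preimage hm.nullMeasurableSet,
        ← volume_preimage_basis hdet (∑ i : {i // ¬ p i}, b i • toReal (V i)) A]
      refine measure_mono fun y hy => ?_
      have h2 := hy.2
      simp only [T] at h2
      rw [← e.sum_comp] at h2
      simp only [Set.mem_ofPred_eq]
      convert h2 using 5 with j
      · exact (Equiv.piCongrLeft_apply_apply (fun _ : {i // p i} => ℝ) e y j).symm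
      · exact congrArg V (he j).symm
    · rw [Set.indicator_of_notMem hb]
      have : (fun a => (a, b)) ⁻¹' s = (∅ : Set ({i // p i} → ℝ)) := by
        ext a; simp only [s, Set.mem_preimage, Set.mem_ofPred_eq, Set.mem_empty_iff_false, iff_false]
        exact fun h => hb h.1
      rw [this, measure_empty]
  calc volume (boxMap V ⁻¹' A ∩ cube n) ≤ volume (E ⁻¹' s) := measure_mono hsub
    _ = volume s := hE.measure_preimage hs.nullMeasurableSet
    _ = ∫⁻ b, volume ((fun a => (a, b)) ⁻¹' s) := Measure.prod_apply_symm hs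
    _ ≤ ∫⁻ b, Set.indicator (Set.Icc (0 : {i // ¬ p i} → ℝ) 1) (fun _ => volume A) b :=
      lintegral_mono hfib
    _ = volume A := by
      rw [lintegral_indicator measurableSet_Icc, setLIntegral_const, Real.volume_Icc_pi]
      simp

/-- A bound for the support of the box spline. -/
def boxRadius (V : Fin n → Fin d → ℤ) : ℝ := ∑ i, ‖toReal (V i)‖

lemma boxRadius_nonneg : 0 ≤ boxRadius V := Finset.sum_nonneg fun _ _ => norm_nonneg _

lemma norm_boxMap_le {u : Fin n → ℝ} (hu : u ∈ cube n) : ‖boxMap V u‖ ≤ boxRadius V := by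
  refine (norm_sum_le _ _).trans (Finset.sum_le_sum fun i _ => ?_)
  rw [norm_smul, Real.norm_of_nonneg (mem_cube.1 hu i).1]
  exact mul_le_of_le_one_left (norm_nonneg _) (mem_cube.1 hu i).2

/-- A Borel version of the box spline, with values in `[0, 1]` and with bounded support. -/
def bs (V : Fin n → Fin d → ℤ) : (Fin d → ℝ) → ℝ :=
  Set.indicator ({x | boxSpline V x ≤ 1} ∩ {x | ‖x‖ ≤ boxRadius V}) (boxSpline V)

lemma measurable_boxSpline : Measurable (boxSpline V) :=
  (Measure.measurable_rnDeriv _ _).ennreal_toReal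

@[fun_prop]
lemma measurable_bs : Measurable (bs V) :=
  measurable_boxSpline.indicator
    ((measurableSet_le measurable_boxSpline measurable_const).inter
      (measurableSet_le measurable_norm measurable_const))

lemma boxSpline_nonneg (x : Fin d → ℝ) : 0 ≤ boxSpline V x := ENNReal.toReal_nonneg

lemma bs_nonneg (x : Fin d → ℝ) : 0 ≤ bs V x :=
  Set.indicator_nonneg (fun _ _ => boxSpline_nonneg _) _

lemma bs_le_one (x : Fin d → ℝ) : bs V x ≤ 1 := by
  unfold bs
  by_cases h : x ∈ {x | boxSpline V x ≤ 1} ∩ {x | ‖x‖ ≤ boxRadius V}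
  · rw [Set.indicator_of_mem h]; exact h.1
  · rw [Set.indicator_of_notMem h]; exact zero_le_one

lemma bs_eq_zero {x : Fin d → ℝ} (hx : boxRadius V < ‖x‖) : bs V x = 0 :=
  Set.indicator_of_notMem (fun h => absurd h.2 (not_le.2 hx)) _

lemma boxSpline_eq (x : Fin d → ℝ) :
    boxSpline V x = ((boxMeasure V).rnDeriv volume x).toReal := rfl

lemma boxSpline_ae_eq (hV : Admissible V) (hU : Unimodular V) : boxSpline V =ᵐ[volume] bs V := by
  have h1 : ∀ᵐ x, (boxMeasure V).rnDeriv volume x ≤ 1 :=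
    Measure.rnDeriv_le_one_of_le (boxMeasure_le hV hU)
  have h2 : ∀ᵐ x, boxRadius V < ‖x‖ → (boxMeasure V).rnDeriv volume x = 0 := by
    have hm : MeasurableSet {x : Fin d → ℝ | boxRadius V < ‖x‖} :=
      measurableSet_lt measurable_const measurable_norm
    have h3 : boxMeasure V {x : Fin d → ℝ | boxRadius V < ‖x‖} = 0 := by
      rw [boxMeasure, Measure.map_apply continuous_boxMap.measurable hm,
        Measure.restrict_apply (continuous_boxMap.measurable hm)]
      convert measure_empty (μ := volume)
      ext u
      simp only [Set.mem_inter_iff, Set.mem_preimage, Set.mem_ofPred_eq, Set.mem_empty_iff_false,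
        iff_false, not_and]
      exact fun h hu => absurd (norm_boxMap_le hu) (not_le.2 h)
    have h4 : ∫⁻ x in {x : Fin d → ℝ | boxRadius V < ‖x‖},
        (boxMeasure V).rnDeriv volume x = 0 :=
      le_antisymm ((Measure.setLIntegral_rnDeriv_le _).trans h3.le) zero_le
    rw [lintegral_eq_zero_iff (Measure.measurable_rnDeriv _ _), Filter.EventuallyEq,
      ae_restrict_iff' hm] at h4
    exact h4
  filter_upwards [h1, h2] with x hx1 hx2
  unfold bs
  by_cases h : ‖x‖ ≤ boxRadius V
  · rw [Set.indicator_of_mem]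
    refine ⟨?_, h⟩
    rw [Set.mem_ofPred_eq, boxSpline_eq]
    exact ENNReal.toReal_le_of_le_ofReal zero_le_one (by simpa using hx1)
  · rw [Set.indicator_of_notMem (fun h' => h h'.2), boxSpline_eq, hx2 (not_le.1 h)]
    rfl

/-- There are countably many translates, so a single null set serves them all. Off it, `splineSum`
and the everywhere locally finite `bsSum` agree for every coefficient sequence at once. -/
lemma boxSpline_translates_ae_eq (hV : Admissible V) (hU : Unimodular V) :
    ∀ᵐ x : Fin d → ℝ, ∀ α : Fin d → ℤ, boxSpline V (x - toReal α) = bs V (x - toReal α) := by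
  rw [ae_all_iff]
  intro α
  exact (measurePreserving_sub_right volume (toReal α)).quasiMeasurePreserving.ae
    (boxSpline_ae_eq hV hU)

/-- The defining property of the box spline. -/
lemma integral_mul_bs (hV : Admissible V) (hU : Unimodular V) {F : (Fin d → ℝ) → ℂ}
    (hF : AEStronglyMeasurable F volume) :
    ∫ x, F x * ((bs V x : ℝ) : ℂ) = ∫ u in cube n, F (boxMap V u) := by
  have hac : boxMeasure V ≪ volume := Measure.absolutelyContinuous_of_le (boxMeasure_le hV hU)
  have h1 : ∫ x, F x * ((bs V x : ℝ) : ℂ) =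
      ∫ x, ((boxMeasure V).rnDeriv volume x).toReal • F x := by
    refine integral_congr_ae ?_
    filter_upwards [boxSpline_ae_eq hV hU] with x hx
    rw [← hx, boxSpline_eq, Complex.real_smul, mul_comm]
  rw [h1, integral_rnDeriv_smul hac]
  exact integral_map continuous_boxMap.aemeasurable (hF.mono_ac hac)

lemma integrable_bs : Integrable (bs V) := by
  have h : Integrable (Set.indicator (Metric.closedBall (0 : Fin d → ℝ) (boxRadius V))
      (fun _ => (1 : ℝ))) :=
    (integrable_indicator_iff measurableSet_closedBall).2
      (integrableOn_const (isCompact_closedBall _ _).measure_lt_top.ne)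
  refine h.mono' measurable_bs.aestronglyMeasurable (ae_of_all _ fun x => ?_)
  rw [Real.norm_of_nonneg (bs_nonneg x)]
  by_cases hx : ‖x‖ ≤ boxRadius V
  · rw [Set.indicator_of_mem (by simpa using hx)]; exact bs_le_one x
  · rw [bs_eq_zero (not_le.1 hx)]; exact Set.indicator_nonneg (fun _ _ => zero_le_one) _

/-- Locally integrable functions are integrable against the box spline. -/
lemma LocallyIntegrable.mul_bs {g : (Fin d → ℝ) → ℂ} (hg : LocallyIntegrable g volume)
    (α : Fin d → ℤ) : Integrable fun x => g x * ((bs V (x - toReal α) : ℝ) : ℂ) := by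
  have h1 : IntegrableOn g (Metric.closedBall (toReal α) (boxRadius V)) :=
    hg.integrableOn_isCompact (isCompact_closedBall _ _)
  have h2 := (integrable_indicator_iff measurableSet_closedBall).2 h1
  refine h2.norm.mono' (hg.aestronglyMeasurable.mul
    (by fun_prop : Measurable fun x => ((bs V (x - toReal α) : ℝ) : ℂ)).aestronglyMeasurable)
    (ae_of_all _ fun x => ?_)
  rw [norm_mul, Complex.norm_real, Real.norm_of_nonneg (bs_nonneg _)]
  by_cases hx : ‖x - toReal α‖ ≤ boxRadius V
  · rw [Set.indicator_of_mem (by simpa [dist_eq_norm] using hx)]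
    exact mul_le_of_le_one_right (norm_nonneg _) (bs_le_one _)
  · rw [bs_eq_zero (not_le.1 hx), mul_zero]; exact norm_nonneg _

/-! ### Periodization -/

/-- The half-open unit cube with corner `α`. -/
def cell (α : Fin d → ℤ) : Set (Fin d → ℝ) := {x | ∀ j, ⌊x j⌋ = α j}

lemma measurableSet_cell (α : Fin d → ℤ) : MeasurableSet (cell α) := by
  have : cell α = ⋂ j, {x : Fin d → ℝ | ⌊x j⌋ = α j} := by ext; simp [cell]
  rw [this]
  exact MeasurableSet.iInter fun j =>
    (Int.measurable_floor.comp (measurable_pi_apply j)) (measurableSet_singleton _)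

lemma pairwise_disjoint_cell : Pairwise (Function.onFun Disjoint (cell (d := d))) := by
  intro α β h
  refine Set.disjoint_left.2 fun x hx hy => h ?_
  ext j; rw [← hx j, hy j]

lemma iUnion_cell : ⋃ α, cell (d := d) α = Set.univ :=
  Set.eq_univ_of_forall fun x => Set.mem_iUnion.2 ⟨fun j => ⌊x j⌋, fun _ => rfl⟩

lemma cell_zero_ae_eq : (cell (0 : Fin d → ℤ) : Set (Fin d → ℝ)) =ᵐ[volume] cube d := by
  have : cell (0 : Fin d → ℤ) = Set.pi Set.univ fun _ => Set.Ico (0 : ℝ) 1 := by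
    ext x
    simp only [cell, Pi.zero_apply, Set.mem_ofPred_eq, Set.mem_pi, Set.mem_univ, true_imp_iff,
      Int.floor_eq_zero_iff]
  rw [this]
  exact Measure.univ_pi_Ico_ae_eq_Icc (f := fun _ : Fin d => (0 : ℝ)) (g := fun _ => 1)

lemma preimage_cell (α : Fin d → ℤ) : (fun x => x + toReal α) ⁻¹' cell α = cell 0 := by
  ext x; simp [cell, toReal, Int.floor_add_intCast]

lemma setIntegral_cell {E : Type*} [NormedAddCommGroup E] [NormedSpace ℝ E]
    (F : (Fin d → ℝ) → E) (α : Fin d → ℤ) :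
    ∫ x in cell α, F x = ∫ x in cube d, F (x + toReal α) := by
  rw [← (measurePreserving_add_right volume (toReal α)).setIntegral_preimage_emb
    (measurableEmbedding_addRight _), preimage_cell]
  exact setIntegral_congr_set cell_zero_ae_eq

lemma setLIntegral_cell (F : (Fin d → ℝ) → ℝ≥0∞) (α : Fin d → ℤ) :
    ∫⁻ x in cell α, F x = ∫⁻ x in cube d, F (x + toReal α) := by
  rw [← (measurePreserving_add_right volume (toReal α)).setLIntegral_comp_preimage_emb
    (measurableEmbedding_addRight _), preimage_cell]
  exact setLIntegral_congr cell_zero_ae_eq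

lemma lintegral_eq_tsum_cube (F : (Fin d → ℝ) → ℝ≥0∞) :
    ∫⁻ x, F x = ∑' α : Fin d → ℤ, ∫⁻ x in cube d, F (x + toReal α) := by
  rw [← setLIntegral_univ, ← iUnion_cell,
    lintegral_iUnion measurableSet_cell pairwise_disjoint_cell]
  exact tsum_congr fun α => setLIntegral_cell F α

lemma hasSum_integral_cube {E : Type*} [NormedAddCommGroup E] [NormedSpace ℝ E]
    {F : (Fin d → ℝ) → E} (hF : Integrable F) :
    HasSum (fun α : Fin d → ℤ => ∫ x in cube d, F (x + toReal α)) (∫ x, F x) := by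
  have h := hasSum_integral_iUnion measurableSet_cell pairwise_disjoint_cell
    (f := F) (μ := volume) (hF.integrableOn)
  rw [iUnion_cell, setIntegral_univ] at h
  simpa only [setIntegral_cell] using h

/-- Unfolding: the integral of the periodization over the unit cube. -/
lemma integral_cube_tsum {F : (Fin d → ℝ) → ℂ} (hF : Integrable F) :
    ∫ x in cube d, ∑' α : Fin d → ℤ, F (x - toReal α) = ∫ x, F x := by
  have h1 : ∀ α : Fin d → ℤ, Integrable (fun x => F (x - toReal α)) (volume.restrict (cube d)) :=
    fun α => (hF.comp_sub_right (toReal α)).integrableOn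
  have h2 := ((Equiv.neg (Fin d → ℤ)).hasSum_iff.2 (hasSum_integral_cube hF.norm)).summable
  have h3 := ((Equiv.neg (Fin d → ℤ)).hasSum_iff.2 (hasSum_integral_cube hF))
  rw [← integral_tsum_of_summable_integral_norm h1 (by
    simpa [Function.comp_def, toReal_neg, sub_eq_add_neg] using h2)]
  simpa [Function.comp_def, toReal_neg, sub_eq_add_neg] using h3.tsum_eq

end

section

/-! ### Exponentials on the unit cube -/

variable {d n : ℕ} {V : Fin n → Fin d → ℤ}

/-- `e(t) = exp(2πit)`. -/
def ee (t : ℝ) : ℂ := Complex.exp (2 * (Real.pi : ℂ) * Complex.I * (t : ℂ))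

lemma ee_add (s t : ℝ) : ee (s + t) = ee s * ee t := by
  rw [ee, ee, ee, ← Complex.exp_add]; push_cast; ring_nf

@[simp] lemma ee_zero : ee 0 = 1 := by simp [ee]

lemma ee_ne_zero (t : ℝ) : ee t ≠ 0 := Complex.exp_ne_zero _

lemma ee_neg (t : ℝ) : ee (-t) = (ee t)⁻¹ := by
  rw [ee, ee, ← Complex.exp_neg]; push_cast; ring_nf

lemma ee_sub (s t : ℝ) : ee (s - t) = ee s * ee (-t) := by rw [sub_eq_add_neg, ee_add]

lemma ee_eq_exp (t : ℝ) : ee t = Complex.exp (((2 * Real.pi * t : ℝ) : ℂ) * Complex.I) := by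
  rw [ee]; push_cast; ring_nf

@[simp] lemma norm_ee (t : ℝ) : ‖ee t‖ = 1 := by
  rw [ee_eq_exp]; exact Complex.norm_exp_ofReal_mul_I _

lemma conj_ee (t : ℝ) : (starRingEnd ℂ) (ee t) = ee (-t) := by
  rw [ee, ee, ← Complex.exp_conj]; simp [show (starRingEnd ℂ) 2 = 2 from map_ofNat _ 2]

@[simp] lemma ee_int (k : ℤ) : ee k = 1 := by
  rw [ee, Complex.exp_eq_one_iff]
  exact ⟨k, by push_cast; ring⟩

lemma ee_sum {ι : Type*} (s : Finset ι) (f : ι → ℝ) : ee (∑ i ∈ s, f i) = ∏ i ∈ s, ee (f i) := by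
  classical
  induction s using Finset.induction_on with
  | empty => simp
  | insert a s ha ih => rw [Finset.sum_insert ha, Finset.prod_insert ha, ee_add, ih]

@[fun_prop]
lemma continuous_ee : Continuous ee := by unfold ee; fun_prop

@[fun_prop]
lemma measurable_ee : Measurable ee := continuous_ee.measurable

lemma ee_ne_one {t : ℝ} (ht : ∀ k : ℤ, t ≠ k) : ee t ≠ 1 := by
  rw [ee, Ne, Complex.exp_eq_one_iff]
  rintro ⟨k, hk⟩
  have h2 : (2 * (Real.pi : ℂ) * Complex.I) ≠ 0 := Complex.two_pi_I_ne_zero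
  have : (t : ℂ) = k := by
    apply mul_left_cancel₀ h2; rw [hk]; ring
  exact ht k (by exact_mod_cast this)

@[fun_prop]
lemma continuous_dotProduct_left (a : Fin d → ℝ) : Continuous fun x : Fin d → ℝ => a ⬝ᵥ x := by
  unfold dotProduct; fun_prop

lemma volume_restrict_cube :
    (volume : Measure (Fin n → ℝ)).restrict (cube n) =
      Measure.pi fun _ => volume.restrict (Set.Icc (0 : ℝ) 1) := by
  have : cube n = Set.pi Set.univ fun _ => Set.Icc (0 : ℝ) 1 := by
    rw [Set.pi_univ_Icc]; rfl
  rw [this, volume_pi, Measure.restrict_pi_pi]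

lemma integral_cube_prod (f : Fin n → ℝ → ℂ) :
    ∫ u in cube n, ∏ i, f i (u i) = ∏ i, ∫ t in (0 : ℝ)..1, f i t := by
  rw [volume_restrict_cube, integral_fintype_prod_eq_prod]
  refine Finset.prod_congr rfl fun i _ => ?_
  rw [intervalIntegral.integral_of_le zero_le_one, integral_Icc_eq_integral_Ioc]

lemma hasDerivAt_ee (c t : ℝ) :
    HasDerivAt (fun t : ℝ => ee (c * t)) (2 * (Real.pi : ℂ) * Complex.I * c * ee (c * t)) t := by
  have h1 : HasDerivAt (fun t : ℝ => 2 * (Real.pi : ℂ) * Complex.I * (c * (t : ℂ)))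
      (2 * (Real.pi : ℂ) * Complex.I * (c * 1)) t :=
    ((Complex.ofRealCLM.hasDerivAt (x := t)).const_mul (c : ℂ)).const_mul _
  have h2 := h1.cexp
  unfold ee
  convert h2 using 1
  · ext t; push_cast; ring_nf
  · push_cast; ring_nf

lemma two_pi_I_mul_ne_zero {c : ℝ} (hc : c ≠ 0) : 2 * (Real.pi : ℂ) * Complex.I * c ≠ 0 :=
  mul_ne_zero Complex.two_pi_I_ne_zero (by exact_mod_cast hc)

lemma integral_ee {c : ℝ} (hc : c ≠ 0) :
    ∫ t in (0 : ℝ)..1, ee (c * t) = (ee c - 1) / (2 * (Real.pi : ℂ) * Complex.I * c) := by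
  have h := intervalIntegral.integral_eq_sub_of_hasDerivAt (a := 0) (b := 1)
    (f := fun t : ℝ => ee (c * t)) (fun t _ => hasDerivAt_ee c t)
    (Continuous.intervalIntegrable (by fun_prop) _ _)
  rw [intervalIntegral.integral_const_mul] at h
  rw [eq_div_iff (two_pi_I_mul_ne_zero hc), mul_comm, h]
  simp

lemma integral_ee_int (k : ℤ) : ∫ t in (0 : ℝ)..1, ee (k * t) = if k = 0 then 1 else 0 := by
  split_ifs with h
  · simp [h]
  · rw [integral_ee (by exact_mod_cast h)]; simp

lemma integral_cube_ee (β : Fin d → ℤ) :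
    ∫ x in cube d, ee (toReal β ⬝ᵥ x) = if β = 0 then 1 else 0 := by
  have h : ∀ x : Fin d → ℝ, ee (toReal β ⬝ᵥ x) = ∏ j, ee (β j * x j) := by
    intro x; rw [dotProduct, ee_sum]; rfl
  simp_rw [h, integral_cube_prod (fun j t => ee (β j * t)), integral_ee_int]
  rw [Finset.prod_ite_zero]
  simp only [Finset.mem_univ, true_imp_iff, Finset.prod_const_one, funext_iff, Pi.zero_apply]

/-- The transform of the unit interval vanishes only at the nonzero integers, which are excluded
here. -/
lemma integral_ee_ne_zero {c : ℝ} (hc : ∀ k : ℤ, c = k → k = 0) :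
    ∫ t in (0 : ℝ)..1, ee (c * t) ≠ 0 := by
  by_cases h0 : c = 0
  · simp [h0]
  · rw [integral_ee h0]
    refine div_ne_zero (sub_ne_zero.2 (ee_ne_one fun k hk => h0 ?_)) (two_pi_I_mul_ne_zero h0)
    rw [hk, hc k hk, Int.cast_zero]

lemma dotProduct_boxMap (ξ : Fin d → ℝ) (u : Fin n → ℝ) :
    ξ ⬝ᵥ boxMap V u = ∑ i, (toReal (V i) ⬝ᵥ ξ) * u i := by
  rw [boxMap, dotProduct_sum]
  refine Finset.sum_congr rfl fun i _ => ?_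
  rw [dotProduct_smul, smul_eq_mul, mul_comm, dotProduct_comm]

/-- The Fourier transform of the box spline. -/
lemma integral_ee_mul_bs (hV : Admissible V) (hU : Unimodular V) (ξ : Fin d → ℝ) :
    ∫ x, ee (ξ ⬝ᵥ x) * ((bs V x : ℝ) : ℂ) =
      ∏ i, ∫ t in (0 : ℝ)..1, ee ((toReal (V i) ⬝ᵥ ξ) * t) := by
  rw [integral_mul_bs hV hU (F := fun x => ee (ξ ⬝ᵥ x))
    (by fun_prop : Continuous fun x => ee (ξ ⬝ᵥ x)).aestronglyMeasurable]
  rw [← integral_cube_prod (fun i t => ee ((toReal (V i) ⬝ᵥ ξ) * t))]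
  simp_rw [dotProduct_boxMap, ee_sum]

/-! ### Local finiteness of the translates -/

/-- A finite set that contains the `α` with `B_V(x - α) ≠ 0`. -/
def near (V : Fin n → Fin d → ℤ) (x : Fin d → ℝ) : Finset (Fin d → ℤ) :=
  Finset.Icc (fun j => ⌈x j - boxRadius V⌉) (fun j => ⌊x j + boxRadius V⌋)

lemma mem_near {x : Fin d → ℝ} {α : Fin d → ℤ} : α ∈ near V x ↔ ‖x - toReal α‖ ≤ boxRadius V := by
  rw [near, Finset.mem_Icc, pi_norm_le_iff_of_nonneg boxRadius_nonneg, Pi.le_def, Pi.le_def,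
    ← forall_and]
  refine forall_congr' fun j => ?_
  rw [Int.ceil_le, Int.le_floor, Real.norm_eq_abs, abs_le, Pi.sub_apply, toReal]
  constructor <;> rintro ⟨h1, h2⟩ <;> constructor <;> linarith

lemma bs_eq_zero_of_notMem_near {x : Fin d → ℝ} {α : Fin d → ℤ} (h : α ∉ near V x) :
    bs V (x - toReal α) = 0 :=
  bs_eq_zero (not_le.1 fun h' => h (mem_near.2 h'))

/-- A bound for the number of translates that are nonzero at a point. -/
def nearBound (V : Fin n → Fin d → ℤ) : ℕ := ⌊2 * boxRadius V + 1⌋₊ ^ d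

lemma card_near_le (x : Fin d → ℝ) : (near V x).card ≤ nearBound V := by
  rw [near, Pi.card_Icc, nearBound]
  refine (Finset.prod_le_prod' (g := fun _ => ⌊2 * boxRadius V + 1⌋₊) fun j _ => ?_).trans
    (by simp)
  rw [Int.card_Icc]
  have h0 := boxRadius_nonneg (V := V)
  refine Nat.le_floor ?_
  have h1 := Int.floor_le (x j + boxRadius V)
  have h2 := Int.le_ceil (x j - boxRadius V)
  rcases le_total 0 (⌊x j + boxRadius V⌋ + 1 - ⌈x j - boxRadius V⌉) with h | h
  · have h3 : (((⌊x j + boxRadius V⌋ + 1 - ⌈x j - boxRadius V⌉).toNat : ℤ) : ℝ) =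
        ((⌊x j + boxRadius V⌋ + 1 - ⌈x j - boxRadius V⌉ : ℤ) : ℝ) := by
      rw [Int.toNat_of_nonneg h]
    rw [Int.cast_natCast] at h3
    rw [h3]; push_cast; linarith
  · rw [Int.toNat_of_nonpos h]; push_cast; linarith

/-- The sum `∑_α c_α B_V(x - α)`, everywhere locally finite. -/
def bsSum (V : Fin n → Fin d → ℤ) (c : (Fin d → ℤ) → ℂ) (x : Fin d → ℝ) : ℂ :=
  ∑' α : Fin d → ℤ, c α * ((bs V (x - toReal α) : ℝ) : ℂ)

lemma bsSum_eq_sum (c : (Fin d → ℤ) → ℂ) {x : Fin d → ℝ} {s : Finset (Fin d → ℤ)}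
    (hs : near V x ⊆ s) :
    bsSum V c x = ∑ α ∈ s, c α * ((bs V (x - toReal α) : ℝ) : ℂ) :=
  tsum_eq_sum fun α hα => by
    rw [bs_eq_zero_of_notMem_near fun h => hα (hs h)]; simp

@[fun_prop]
lemma measurable_bsSum (c : (Fin d → ℤ) → ℂ) : Measurable (bsSum V c) := by
  refine Measurable.tsum fun α => ?_
  fun_prop

lemma splineSum_ae_eq (hV : Admissible V) (hU : Unimodular V) :
    ∀ᵐ x, ∀ c, splineSum V c x = bsSum V c x := by
  filter_upwards [boxSpline_translates_ae_eq hV hU] with x hx c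
  simp only [splineSum, bsSum, hx]

end

section

/-! ### The Gram sequence and its inverse -/

variable {d n : ℕ} {V : Fin n → Fin d → ℤ}

/-- The inner products of the integer translates of the box spline. -/
def gram (V : Fin n → Fin d → ℤ) (γ : Fin d → ℤ) : ℂ :=
  ∫ x, ((bs V (x - toReal γ) : ℝ) : ℂ) * ((bs V x : ℝ) : ℂ)

/-- A finite set outside which the Gram sequence vanishes. -/
def gramSet (V : Fin n → Fin d → ℤ) : Finset (Fin d → ℤ) :=
  Finset.Icc (fun _ => -⌈2 * boxRadius V⌉) (fun _ => ⌈2 * boxRadius V⌉)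

lemma norm_toReal (a : Fin d → ℤ) : ‖toReal a‖ = ‖a‖ := by
  simp only [Pi.norm_def]
  congr 2

lemma mem_gramSet_of_norm_le {γ : Fin d → ℤ} (h : ‖γ‖ ≤ 2 * boxRadius V) : γ ∈ gramSet V := by
  rw [gramSet, Finset.mem_Icc, Pi.le_def, Pi.le_def, ← forall_and]
  intro j
  have h1 := (norm_le_pi_norm γ j).trans h
  rw [Int.norm_eq_abs, abs_le] at h1
  have h2 := Int.le_ceil (2 * boxRadius V)
  constructor
  · have : (-⌈2 * boxRadius V⌉ : ℝ) ≤ γ j := by linarith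
    exact_mod_cast this
  · have : (γ j : ℝ) ≤ ⌈2 * boxRadius V⌉ := by linarith
    exact_mod_cast this

lemma norm_le_of_mem_gramSet {γ : Fin d → ℤ} (h : γ ∈ gramSet V) :
    ‖γ‖ ≤ 2 * boxRadius V + 1 := by
  have h0 := boxRadius_nonneg (V := V)
  rw [gramSet, Finset.mem_Icc, Pi.le_def, Pi.le_def, ← forall_and] at h
  rw [pi_norm_le_iff_of_nonneg (by linarith)]
  intro j
  have h1 := Int.ceil_lt_add_one (2 * boxRadius V)
  have h2 : (-⌈2 * boxRadius V⌉ : ℝ) ≤ γ j := by exact_mod_cast (h j).1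
  have h3 : (γ j : ℝ) ≤ ⌈2 * boxRadius V⌉ := by exact_mod_cast (h j).2
  rw [Int.norm_eq_abs, abs_le]
  constructor <;> linarith

lemma neg_mem_gramSet {γ : Fin d → ℤ} : -γ ∈ gramSet V ↔ γ ∈ gramSet V := by
  simp only [gramSet, Finset.mem_Icc, Pi.le_def, Pi.neg_apply]
  constructor <;> rintro ⟨h1, h2⟩ <;> constructor <;> intro j <;> linarith [h1 j, h2 j]

lemma sub_mem_gramSet {x : Fin d → ℝ} {α β : Fin d → ℤ} (h1 : α ∈ near V x) (h2 : β ∈ near V x) :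
    α - β ∈ gramSet V := by
  refine mem_gramSet_of_norm_le ?_
  rw [← norm_toReal, toReal_sub]
  rw [mem_near] at h1 h2
  have : toReal α - toReal β = (x - toReal β) - (x - toReal α) := by abel
  rw [this]
  exact (norm_sub_le _ _).trans (by linarith)

/-- Where `B_V(x - β)` is nonzero, every other translate alive at `x` has index differing from `β`
by an element of `gramSet`. The infinite sum thus collapses to a fixed finite convolution, with no
growth condition on `c`. -/
lemma bsSum_mul_bs (c : (Fin d → ℤ) → ℂ) (x : Fin d → ℝ) (β : Fin d → ℤ) :
    bsSum V c x * ((bs V (x - toReal β) : ℝ) : ℂ) =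
      ∑ γ ∈ gramSet V, c (β + γ) *
        (((bs V (x - toReal β - toReal γ) : ℝ) : ℂ) * ((bs V (x - toReal β) : ℝ) : ℂ)) := by
  classical
  by_cases hβ : β ∈ near V x
  · have hs : near V x ⊆ (gramSet V).image fun γ => β + γ := fun α hα =>
      Finset.mem_image.2 ⟨α - β, sub_mem_gramSet hα hβ, by abel⟩
    rw [bsSum_eq_sum c hs, Finset.sum_image (fun _ _ _ _ h => add_left_cancel h), Finset.sum_mul]
    refine Finset.sum_congr rfl fun γ _ => ?_
    rw [toReal_add, sub_sub]; ring
  · simp [bs_eq_zero_of_notMem_near hβ]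

lemma integrable_bs_mul_bs (α β : Fin d → ℤ) : Integrable fun x : Fin d → ℝ =>
    ((bs V (x - toReal β - toReal α) : ℝ) : ℂ) * ((bs V (x - toReal β) : ℝ) : ℂ) := by
  have h : Integrable fun x : Fin d → ℝ => bs V (x - toReal β) :=
    integrable_bs.comp_sub_right _
  refine h.ofReal.bdd_mul (c := 1) (by fun_prop : Measurable _).aestronglyMeasurable (ae_of_all _ fun x => ?_)
  rw [Complex.norm_real, Real.norm_of_nonneg (bs_nonneg _)]
  exact bs_le_one _

lemma integral_bs_mul_bs (γ β : Fin d → ℤ) :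
    ∫ x : Fin d → ℝ, ((bs V (x - toReal β - toReal γ) : ℝ) : ℂ) *
      ((bs V (x - toReal β) : ℝ) : ℂ) = gram V γ :=
  integral_sub_right_eq_self
    (fun x => ((bs V (x - toReal γ) : ℝ) : ℂ) * ((bs V x : ℝ) : ℂ)) (toReal β)

lemma integral_bsSum_mul_bs (c : (Fin d → ℤ) → ℂ) (β : Fin d → ℤ) :
    Integrable (fun x => bsSum V c x * ((bs V (x - toReal β) : ℝ) : ℂ)) ∧
    ∫ x, bsSum V c x * ((bs V (x - toReal β) : ℝ) : ℂ) =
      ∑ γ ∈ gramSet V, c (β + γ) * gram V γ := by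
  simp_rw [bsSum_mul_bs]
  refine ⟨integrable_finsetSum _ fun γ _ => (integrable_bs_mul_bs γ β).const_mul _, ?_⟩
  rw [integral_finsetSum _ fun γ _ => (integrable_bs_mul_bs γ β).const_mul _]
  simp_rw [integral_const_mul, integral_bs_mul_bs]

lemma gram_neg (γ : Fin d → ℤ) : gram V (-γ) = gram V γ := by
  rw [← integral_bs_mul_bs γ (-γ), gram]
  refine integral_congr_ae (ae_of_all _ fun x => ?_)
  simp only [toReal_neg, sub_neg_eq_add, add_sub_cancel_right]
  ring

/-! ### Positivity of the symbol -/

/-- The symbol of the Gram sequence. -/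
def symbol (V : Fin n → Fin d → ℤ) (θ : Fin d → ℝ) : ℂ :=
  ∑ γ ∈ gramSet V, gram V γ * ee (toReal γ ⬝ᵥ θ)

@[fun_prop]
lemma continuous_symbol : Continuous (symbol V) := by
  unfold symbol; fun_prop

/-- The exponential spline `∑_α e(α·θ) B_V(x - α)`. -/
def expSpline (V : Fin n → Fin d → ℤ) (θ x : Fin d → ℝ) : ℂ :=
  bsSum V (fun α => ee (toReal α ⬝ᵥ θ)) x

lemma norm_bsSum_le {c : (Fin d → ℤ) → ℂ} {C : ℝ} {x : Fin d → ℝ} (hC : 0 ≤ C)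
    (hc : ∀ α ∈ near V x, ‖c α‖ ≤ C) : ‖bsSum V c x‖ ≤ nearBound V * C := by
  rw [bsSum_eq_sum c le_rfl]
  refine (norm_sum_le _ _).trans ?_
  have h1 : ∀ α ∈ near V x, ‖c α * ((bs V (x - toReal α) : ℝ) : ℂ)‖ ≤ C := by
    intro α hα
    rw [norm_mul, Complex.norm_real, Real.norm_of_nonneg (bs_nonneg _)]
    exact (mul_le_of_le_one_right (norm_nonneg _) (bs_le_one _)).trans (hc α hα)
  refine (Finset.sum_le_card_nsmul _ _ _ h1).trans ?_
  rw [nsmul_eq_mul]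
  gcongr
  exact card_near_le x

lemma norm_expSpline_le (θ x : Fin d → ℝ) : ‖expSpline V θ x‖ ≤ nearBound V := by
  have := norm_bsSum_le (V := V) (c := fun α => ee (toReal α ⬝ᵥ θ)) (x := x) zero_le_one
    fun α _ => (norm_ee _).le
  simpa [expSpline] using this

lemma toReal_add_dotProduct (a b : Fin d → ℤ) (x : Fin d → ℝ) :
    toReal (a + b) ⬝ᵥ x = toReal a ⬝ᵥ x + toReal b ⬝ᵥ x := by
  rw [toReal_add, add_dotProduct]

/-- The symbol is the integral over `ℝ^d` of `∑_γ e(γ·θ) B_V(x-γ) B_V(x)`, and the periodization of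
this integrand is the squared modulus of the exponential spline. So the symbol is nonnegative, and
it vanishes only if the exponential spline vanishes almost everywhere. -/
lemma symbol_eq (θ : Fin d → ℝ) :
    symbol V θ = ((∫ x in cube d, ‖expSpline V θ x‖ ^ 2 : ℝ) : ℂ) := by
  set F : (Fin d → ℝ) → ℂ := fun x => ∑ γ ∈ gramSet V, ee (toReal γ ⬝ᵥ θ) *
    (((bs V (x - toReal γ) : ℝ) : ℂ) * ((bs V x : ℝ) : ℂ)) with hFdef
  have hint : ∀ γ ∈ gramSet V, Integrable fun x : Fin d → ℝ => ee (toReal γ ⬝ᵥ θ) *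
      (((bs V (x - toReal γ) : ℝ) : ℂ) * ((bs V x : ℝ) : ℂ)) := fun γ _ => by
    have := integrable_bs_mul_bs (V := V) γ 0
    simp only [toReal_zero, sub_zero] at this
    exact this.const_mul _
  have hF : Integrable F := integrable_finsetSum _ hint
  have h1 : ∫ x, F x = symbol V θ := by
    rw [hFdef, integral_finsetSum _ hint, symbol]
    refine Finset.sum_congr rfl fun γ _ => ?_
    rw [integral_const_mul, gram, mul_comm]
  rw [← h1, ← integral_cube_tsum hF, ← integral_complex_ofReal]
  congr 1
  ext x
  have h2 : ∀ β : Fin d → ℤ, F (x - toReal β) =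
      ee (-(toReal β ⬝ᵥ θ)) * (expSpline V θ x * ((bs V (x - toReal β) : ℝ) : ℂ)) := by
    intro β
    rw [expSpline, bsSum_mul_bs, Finset.mul_sum]
    refine Finset.sum_congr rfl fun γ _ => ?_
    rw [toReal_add_dotProduct, ee_add, ee_neg]
    field_simp [ee_ne_zero]
  simp_rw [h2, mul_left_comm _ (expSpline V θ x), ← conj_ee]
  rw [tsum_mul_left]
  have h3 : ∑' β : Fin d → ℤ, (starRingEnd ℂ) (ee (toReal β ⬝ᵥ θ)) *
      ((bs V (x - toReal β) : ℝ) : ℂ) = (starRingEnd ℂ) (expSpline V θ x) := by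
    rw [expSpline, bsSum, Complex.conj_tsum]
    simp
  rw [h3, Complex.mul_conj, Complex.normSq_eq_norm_sq]

/-- The Fourier coefficients of an exponential spline. -/
lemma integral_expSpline_mul_ee (hV : Admissible V) (hU : Unimodular V) (θ : Fin d → ℝ)
    (β : Fin d → ℤ) :
    ∫ x in cube d, expSpline V θ x * ee (-(θ + toReal β) ⬝ᵥ x) =
      ∏ i, ∫ t in (0 : ℝ)..1, ee ((toReal (V i) ⬝ᵥ (-(θ + toReal β))) * t) := by
  rw [← integral_ee_mul_bs hV hU, ← integral_cube_tsum]
  · congr 1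
    ext x
    rw [expSpline, bsSum, ← tsum_mul_right]
    refine tsum_congr fun α => ?_
    have h : -(θ + toReal β) ⬝ᵥ (x - toReal α) =
        toReal α ⬝ᵥ θ + -(θ + toReal β) ⬝ᵥ x + ((β ⬝ᵥ α : ℤ) : ℝ) := by
      rw [← toReal_dotProduct, dotProduct_sub, neg_dotProduct, neg_dotProduct, add_dotProduct,
        add_dotProduct, dotProduct_comm θ (toReal α)]
      ring
    rw [h, ee_add, ee_int, mul_one, ee_add]
    ring
  · refine (integrable_bs.ofReal (𝕜 := ℂ)).bdd_mul (c := 1)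
      (by fun_prop : Measurable _).aestronglyMeasurable (ae_of_all _ fun x => (norm_ee _).le)

/-- If the symbol vanished at `θ`, all Fourier coefficients of the exponential spline would vanish;
these are products over the family of transforms of the unit interval at the points `-v·(θ + β)`.
Unimodularity provides an integer vector `α` with `v·α = v·θ` for all `v` for which `v·θ` is an
integer. For `β = -α` each of these points is then zero or not an integer, so no factor vanishes. -/
lemma symbol_ne_zero (hV : Admissible V) (hU : Unimodular V) (θ : Fin d → ℝ) :
    symbol V θ ≠ 0 := by
  classical
  intro h0
  rw [symbol_eq, Complex.ofReal_eq_zero, integral_eq_zero_iff_of_nonneg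
    (fun x => by positivity)] at h0
  swap
  · refine Measure.integrableOn_of_bounded (M := (nearBound V : ℝ) ^ 2) (by simp [volume_cube])
      ?_ (ae_of_all _ fun x => ?_)
    · unfold expSpline; exact (by fun_prop : Measurable _).aestronglyMeasurable
    · rw [norm_pow, norm_norm]; gcongr; exact norm_expSpline_le _ _
  set r : Fin n → ℤ := fun i => ⌊toReal (V i) ⬝ᵥ θ⌋
  obtain ⟨α, hα⟩ := exists_int_vector hV hU
    (Finset.univ.filter fun i => toReal (V i) ⬝ᵥ θ = r i) θ r (by simp)
  have h1 := integral_expSpline_mul_ee hV hU θ (-α)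
  have h2 : ∫ x in cube d, expSpline V θ x * ee (-(θ + toReal (-α)) ⬝ᵥ x) = 0 := by
    rw [← integral_zero (μ := volume.restrict (cube d)) (α := Fin d → ℝ) (G := ℂ)]
    refine integral_congr_ae ?_
    filter_upwards [h0] with x hx
    have : expSpline V θ x = 0 := by simpa using hx
    rw [this, zero_mul]
  rw [h2] at h1
  symm at h1
  rw [Finset.prod_eq_zero_iff] at h1
  obtain ⟨i, -, hi⟩ := h1
  refine integral_ee_ne_zero (fun k hk => ?_) hi
  have h3 : toReal (V i) ⬝ᵥ θ = ((V i ⬝ᵥ α - k : ℤ) : ℝ) := by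
    rw [toReal_neg, ← sub_eq_add_neg, dotProduct_neg, dotProduct_sub, toReal_dotProduct] at hk
    push_cast; linarith
  have h4 : toReal (V i) ⬝ᵥ θ = r i := by
    simp only [r, h3, Int.floor_intCast]
  have h5 := hα i (by simp [h4])
  rw [h4] at h3
  have : r i = V i ⬝ᵥ α - k := by exact_mod_cast h3
  omega

/-! ### Decay of the inverse Gram sequence -/

/-- The inverse of the Gram sequence. -/
def gramInv (V : Fin n → Fin d → ℤ) (α : Fin d → ℤ) : ℂ :=
  ∫ θ in cube d, (symbol V θ)⁻¹ * ee (-(toReal α ⬝ᵥ θ))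

lemma Continuous.integrableOn_cube {f : (Fin d → ℝ) → ℂ} (hf : Continuous f) :
    IntegrableOn f (cube d) :=
  hf.continuousOn.integrableOn_compact isCompact_Icc

lemma symbol_mul_ee (θ : Fin d → ℝ) (α : Fin d → ℤ) :
    symbol V θ * ee (-(toReal α ⬝ᵥ θ)) =
      ∑ γ ∈ gramSet V, gram V γ * ee (-(toReal (α - γ) ⬝ᵥ θ)) := by
  rw [symbol, Finset.sum_mul]
  refine Finset.sum_congr rfl fun γ _ => ?_
  rw [mul_assoc, ← ee_add, toReal_sub, sub_dotProduct]
  congr 2; ring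

lemma sum_gram_mul_gramInv (hV : Admissible V) (hU : Unimodular V) (α : Fin d → ℤ) :
    ∑ γ ∈ gramSet V, gram V γ * gramInv V (α - γ) = if α = 0 then 1 else 0 := by
  have hc : Continuous fun θ => (symbol V θ)⁻¹ :=
    continuous_symbol.inv₀ (symbol_ne_zero hV hU)
  have h1 := integral_cube_ee (-α)
  simp only [neg_eq_zero] at h1
  rw [← h1]
  simp_rw [gramInv, ← integral_const_mul]
  rw [← integral_finsetSum _ fun γ _ => Continuous.integrableOn_cube (by fun_prop)]
  congr 1
  ext θ
  have h2 := symbol_mul_ee (V := V) θ α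
  simp_rw [mul_left_comm _ (symbol V θ)⁻¹]
  rw [← Finset.mul_sum, ← h2, toReal_neg, neg_dotProduct, inv_mul_cancel_left₀
    (symbol_ne_zero hV hU θ)]

/-- The inverse of the Gram sequence decays rapidly. -/
lemma exists_gramInv_decay (hV : Admissible V) (hU : Unimodular V) (N : ℕ) :
    ∃ C : ℝ, 0 ≤ C ∧ ∀ α, ‖gramInv V α‖ * (1 + ‖α‖) ^ N ≤ C := by
  have hne := symbol_ne_zero hV hU
  set φ : (Fin d → ℝ) → ℝ := fun θ => ‖symbol V θ‖ with hφ
  have hφc : Continuous φ := by fun_prop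
  have hsym : ∀ θ, symbol V θ = (φ θ : ℂ) := by
    intro θ
    have h1 := symbol_eq (V := V) θ
    rw [hφ]
    simp only
    rw [h1, Complex.norm_real, Real.norm_of_nonneg (integral_nonneg fun x => by positivity)]
  have hne' : (cube d).Nonempty := ⟨0, by simp [cube]⟩
  obtain ⟨θ₀, -, hmin⟩ := (isCompact_Icc : IsCompact (cube d)).exists_isMinOn hne' hφc.continuousOn
  obtain ⟨θ₁, -, hmax⟩ := (isCompact_Icc : IsCompact (cube d)).exists_isMaxOn hne' hφc.continuousOn
  set A := φ θ₀
  set M := φ θ₁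
  have hA : 0 < A := norm_pos_iff.2 (hne θ₀)
  have hM : 0 < M := norm_pos_iff.2 (hne θ₁)
  -- On the cube the symbol is real with values in `[A, M]`, so `t` takes values in `[0, q]` with `q
  -- < 1`, and the reciprocal of the symbol is `M⁻¹` times the geometric series of `t`.
  set t : (Fin d → ℝ) → ℂ := fun θ => 1 - (M : ℂ)⁻¹ * symbol V θ with ht
  have htc : Continuous t := by fun_prop
  set q : ℝ := 1 - M⁻¹ * A with hq
  have htq : ∀ θ ∈ cube d, ‖t θ‖ ≤ q := by
    intro θ hθ
    have h1 : A ≤ φ θ := hmin hθ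
    have h2 : φ θ ≤ M := hmax hθ
    have h3 : t θ = ((1 - M⁻¹ * φ θ : ℝ) : ℂ) := by
      simp only [ht, hsym θ]; push_cast; ring
    have h4 : M⁻¹ * φ θ ≤ 1 := by
      rw [inv_mul_le_iff₀ hM]; linarith
    rw [h3, Complex.norm_real, Real.norm_of_nonneg (by linarith)]
    have : M⁻¹ * A ≤ M⁻¹ * φ θ := by gcongr
    linarith
  have hq0 : 0 ≤ q := (norm_nonneg _).trans (htq _ hne'.some_mem)
  have hq1 : q < 1 := by
    have : 0 < M⁻¹ * A := by positivity
    linarith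
  set p : ℕ → (Fin d → ℤ) → ℂ := fun k α => ∫ θ in cube d, t θ ^ k * ee (-(toReal α ⬝ᵥ θ)) with hp
  set K : ℝ := 2 * boxRadius V + 1 with hK
  have hK0 : 0 < K := by have := boxRadius_nonneg (V := V); linarith
  -- `t ^ k` is a trigonometric polynomial: each factor `t` enlarges the range of its frequencies by
  -- at most `K`.
  have hsupp : ∀ (k : ℕ) α, (k : ℝ) * K < ‖α‖ → p k α = 0 := by
    intro k
    induction k with
    | zero =>
      intro α hα
      have h1 := integral_cube_ee (-α)
      have h2 : α ≠ 0 := by rintro rfl; simp at hα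
      rw [if_neg (by simpa using h2)] at h1
      simpa [hp, toReal_neg] using h1
    | succ k ih =>
      intro α hα
      have h1 : p (k + 1) α = p k α - (M : ℂ)⁻¹ * ∑ γ ∈ gramSet V, gram V γ * p k (α - γ) := by
        simp_rw [hp, ← integral_const_mul]
        rw [← integral_finsetSum _ fun γ _ => Continuous.integrableOn_cube (by fun_prop),
          ← integral_const_mul, ← integral_sub (Continuous.integrableOn_cube (by fun_prop))
            (Continuous.integrableOn_cube (by fun_prop))]
        congr 1
        ext θ
        simp_rw [mul_left_comm _ (t θ ^ k)]
        rw [← Finset.mul_sum, ← symbol_mul_ee, pow_succ]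
        simp only [ht]
        ring
      push_cast at hα
      rw [h1, ih α (by linarith), Finset.sum_eq_zero, mul_zero, sub_zero]
      intro γ hγ
      rw [ih, mul_zero]
      have h2 := norm_le_of_mem_gramSet hγ
      have h3 := norm_sub_norm_le α γ
      linarith
  -- The geometric series is stopped at `k₀` with its exact remainder, so that `k₀` can be adapted
  -- to `α`.
  have hexp : ∀ k₀ α, gramInv V α = (∑ k ∈ Finset.range k₀, (M : ℂ)⁻¹ * p k α) +
      ∫ θ in cube d, t θ ^ k₀ * (symbol V θ)⁻¹ * ee (-(toReal α ⬝ᵥ θ)) := by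
    intro k₀ α
    have hc : Continuous fun θ => (symbol V θ)⁻¹ := continuous_symbol.inv₀ hne
    simp_rw [hp, ← integral_const_mul]
    rw [← integral_finsetSum _ fun k _ => Continuous.integrableOn_cube (by fun_prop),
      ← integral_add (Continuous.integrableOn_cube (by fun_prop))
        (Continuous.integrableOn_cube (by fun_prop)), gramInv]
    congr 1
    ext θ
    have h1 := mul_neg_geom_sum (t θ) k₀
    have h2 : 1 - t θ = (M : ℂ)⁻¹ * symbol V θ := by simp [ht]
    rw [h2] at h1
    have h3 := hne θ
    have hM' : (M : ℂ) ≠ 0 := by exact_mod_cast hM.ne'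
    simp_rw [← mul_assoc]
    rw [← Finset.sum_mul, ← add_mul, ← Finset.mul_sum]
    congr 1
    have h4 : (M : ℂ)⁻¹ * ∑ i ∈ Finset.range k₀, t θ ^ i = (1 - t θ ^ k₀) * (symbol V θ)⁻¹ := by
      rw [← h1]; field_simp
    rw [h4]; ring
  obtain ⟨C, hC⟩ : ∃ C : ℝ, ∀ k : ℕ, ((1 + K * k) ^ N) * q ^ k ≤ C := by
    have h1 : Tendsto (fun k : ℕ => (k : ℝ) ^ N * q ^ k) atTop (𝓝 0) :=
      tendsto_pow_const_mul_const_pow_of_abs_lt_one N (by rwa [abs_of_nonneg hq0])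
    obtain ⟨C, hC⟩ := h1.bddAbove_range
    refine ⟨max 1 ((1 + K) ^ N * C), fun k => ?_⟩
    rcases Nat.eq_zero_or_pos k with rfl | hk
    · simp
    · refine le_trans ?_ (le_max_right _ _)
      have hk1 : (1 : ℝ) ≤ k := by exact_mod_cast hk
      calc (1 + K * k) ^ N * q ^ k ≤ ((1 + K) * k) ^ N * q ^ k := by
            gcongr; nlinarith
        _ = (1 + K) ^ N * ((k : ℝ) ^ N * q ^ k) := by rw [mul_pow]; ring
        _ ≤ (1 + K) ^ N * C := by gcongr; exact hC ⟨k, rfl⟩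
  have hC0 : 0 ≤ C := le_trans (by positivity) (hC 0)
  refine ⟨A⁻¹ * C, by positivity, fun α => ?_⟩
  -- For `k < k₀` the frequency `α` is out of the range of `t ^ k`, so only the remainder
  -- contributes. It is at most `A⁻¹ q ^ k₀`, which is exponentially small in `‖α‖`.
  set k₀ := ⌈‖α‖ / K⌉₊
  have hk₀ : ‖α‖ ≤ K * k₀ := by
    have := Nat.le_ceil (‖α‖ / K)
    rw [div_le_iff₀ hK0] at this; linarith
  have hlt : ∀ k < k₀, p k α = 0 := by
    intro k hk
    apply hsupp
    have := Nat.lt_ceil.1 hk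
    rwa [lt_div_iff₀ hK0] at this
  have hG : ‖gramInv V α‖ ≤ A⁻¹ * q ^ k₀ := by
    rw [hexp k₀ α, Finset.sum_eq_zero fun k hk => by
      rw [hlt k (Finset.mem_range.1 hk), mul_zero], zero_add]
    refine (norm_setIntegral_le_of_norm_le_const (C := A⁻¹ * q ^ k₀)
      (by simp [volume_cube]) fun θ hθ => ?_).trans (by simp [Measure.real, volume_cube])
    rw [norm_mul, norm_mul, norm_ee, mul_one, norm_pow, norm_inv, mul_comm]
    gcongr
    · exact hmin hθ
    · exact htq θ hθ
  calc ‖gramInv V α‖ * (1 + ‖α‖) ^ N ≤ (A⁻¹ * q ^ k₀) * (1 + K * k₀) ^ N := by gcongr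
    _ = A⁻¹ * ((1 + K * k₀) ^ N * q ^ k₀) := by ring
    _ ≤ A⁻¹ * C := by gcongr; exact hC k₀

end

section

/-! ### Convolution with the inverse Gram sequence -/

variable {d n : ℕ} {V : Fin n → Fin d → ℤ}

lemma lintegral_one_add_norm_lt_top :
    ∫⁻ x : Fin d → ℝ, ENNReal.ofReal (((1 + ‖x‖) ^ (d + 1))⁻¹) < ⊤ := by
  have h := integrable_one_add_norm (E := Fin d → ℝ) (μ := volume) (r := (d + 1 : ℕ))
    (by rw [Module.finrank_fin_fun]; push_cast; linarith)
  have h2 := h.lintegral_lt_top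
  refine lt_of_eq_of_lt ?_ h2
  congr 1
  ext x
  rw [Real.rpow_neg (by positivity), Real.rpow_natCast]

lemma summable_one_add_norm :
    Summable fun γ : Fin d → ℤ => ((1 + ‖γ‖) ^ (d + 1))⁻¹ := by
  have h := lintegral_one_add_norm_lt_top (d := d)
  rw [lintegral_eq_tsum_cube] at h
  -- Comparison with the integral over the unit cell at `γ`, on which `1 + ‖x + γ‖ ≤ 2 (1 + ‖γ‖)`.
  have h1 : ∀ γ : Fin d → ℤ, ENNReal.ofReal (((2 : ℝ) ^ (d + 1))⁻¹ * ((1 + ‖γ‖) ^ (d + 1))⁻¹) ≤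
      ∫⁻ x in cube d, ENNReal.ofReal (((1 + ‖x + toReal γ‖) ^ (d + 1))⁻¹) := by
    intro γ
    calc ENNReal.ofReal (((2 : ℝ) ^ (d + 1))⁻¹ * ((1 + ‖γ‖) ^ (d + 1))⁻¹)
        = ∫⁻ x in cube d, ENNReal.ofReal (((2 : ℝ) ^ (d + 1))⁻¹ * ((1 + ‖γ‖) ^ (d + 1))⁻¹) := by
          simp
      _ ≤ _ := by
          refine setLIntegral_mono' measurableSet_cube fun x hx => ?_
          refine ENNReal.ofReal_le_ofReal ?_
          rw [← mul_inv, ← mul_pow]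
          have hx1 : ‖x‖ ≤ 1 := (pi_norm_le_iff_of_nonneg zero_le_one).2 fun j => by
            rw [Real.norm_of_nonneg (mem_cube.1 hx j).1]; exact (mem_cube.1 hx j).2
          have h2 := norm_add_le x (toReal γ)
          rw [norm_toReal] at h2
          have h3 := norm_nonneg γ
          gcongr
          linarith
  have h2 : ∑' γ : Fin d → ℤ, ENNReal.ofReal (((2 : ℝ) ^ (d + 1))⁻¹ * ((1 + ‖γ‖) ^ (d + 1))⁻¹) ≠ ⊤ :=
    ((ENNReal.tsum_le_tsum h1).trans_lt h).ne
  have h3 := ENNReal.summable_toReal h2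
  have h4 : Summable fun γ : Fin d → ℤ => ((2 : ℝ) ^ (d + 1))⁻¹ * ((1 + ‖γ‖) ^ (d + 1))⁻¹ := by
    refine h3.congr fun γ => ?_
    rw [ENNReal.toReal_ofReal (by positivity)]
  exact (summable_mul_left_iff (by positivity)).1 h4

lemma summable_gramInv (hV : Admissible V) (hU : Unimodular V) (N : ℕ) :
    Summable fun γ => ‖gramInv V γ‖ * (1 + ‖γ‖) ^ N := by
  obtain ⟨C, hC0, hC⟩ := exists_gramInv_decay hV hU (N + (d + 1))
  refine Summable.of_nonneg_of_le (fun γ => by positivity) (fun γ => ?_)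
    (summable_one_add_norm.mul_left C)
  rw [← div_eq_mul_inv, le_div_iff₀ (by positivity), mul_assoc, ← pow_add]
  exact hC γ

/-- Submultiplicativity of the weight: polynomial growth in `β` is paid for by growth in `α` and by
the decay of `gramInv` at `α - β`. -/
lemma one_add_norm_add_le (α γ : Fin d → ℤ) : 1 + ‖α + γ‖ ≤ (1 + ‖α‖) * (1 + ‖γ‖) := by
  have := norm_add_le α γ
  nlinarith [norm_nonneg α, norm_nonneg γ]

lemma summable_conv (hV : Admissible V) (hU : Unimodular V) {b : (Fin d → ℤ) → ℂ}
    (hb : PolyGrowth b) (α : Fin d → ℤ) :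
    Summable fun β => gramInv V (α - β) * b β := by
  obtain ⟨C, N, hC⟩ := hb
  have h1 := ((summable_gramInv hV hU N).mul_left (C * (1 + ‖α‖) ^ N))
  have h2 := ((Equiv.subLeft α).summable_iff).2 h1
  have hC0 : 0 ≤ C := by simpa using (norm_nonneg _).trans (hC 0)
  refine Summable.of_norm_bounded h2 fun β => ?_
  simp only [Function.comp_apply, Equiv.subLeft_apply]
  rw [norm_mul]
  have h3 : 1 + ‖β‖ ≤ (1 + ‖α‖) * (1 + ‖α - β‖) := by
    have := one_add_norm_add_le α (-(α - β))
    rwa [norm_neg, show α + -(α - β) = β by abel] at this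
  calc ‖gramInv V (α - β)‖ * ‖b β‖
      ≤ ‖gramInv V (α - β)‖ * (C * ((1 + ‖α‖) * (1 + ‖α - β‖)) ^ N) := by
        gcongr
        exact (hC β).trans (by gcongr)
    _ = _ := by rw [mul_pow]; ring

/-- Convolution with the inverse Gram sequence. -/
def conv (V : Fin n → Fin d → ℤ) (b : (Fin d → ℤ) → ℂ) (α : Fin d → ℤ) : ℂ :=
  ∑' β, gramInv V (α - β) * b β

lemma polyGrowth_conv (hV : Admissible V) (hU : Unimodular V) {b : (Fin d → ℤ) → ℂ}
    (hb : PolyGrowth b) : PolyGrowth (conv V b) := by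
  obtain ⟨C, N, hC⟩ := hb
  have hC0 : 0 ≤ C := by simpa using (norm_nonneg _).trans (hC 0)
  refine ⟨C * ∑' γ, ‖gramInv V γ‖ * (1 + ‖γ‖) ^ N, N, fun α => ?_⟩
  have h1 := ((summable_gramInv hV hU N).mul_left (C * (1 + ‖α‖) ^ N))
  have h2 := ((Equiv.subLeft α).hasSum_iff).2 h1.hasSum
  rw [tsum_mul_left] at h2
  refine (tsum_of_norm_bounded h2 fun β => ?_).trans (le_of_eq (by ring))
  simp only [Function.comp_apply, Equiv.subLeft_apply]
  rw [norm_mul]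
  have h3 : 1 + ‖β‖ ≤ (1 + ‖α‖) * (1 + ‖α - β‖) := by
    have := one_add_norm_add_le α (-(α - β))
    rwa [norm_neg, show α + -(α - β) = β by abel] at this
  calc ‖gramInv V (α - β)‖ * ‖b β‖
      ≤ ‖gramInv V (α - β)‖ * (C * ((1 + ‖α‖) * (1 + ‖α - β‖)) ^ N) := by
        gcongr
        exact (hC β).trans (by gcongr)
    _ = _ := by rw [mul_pow]; ring

/-- Exchanging the two sums leaves the Gram sequence convolved with its inverse, a unit mass at the
origin. The sum here runs over `α + γ` instead of `α - γ`, which is harmless because the Gram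
sequence is even. -/
lemma sum_gram_mul_conv (hV : Admissible V) (hU : Unimodular V) {b : (Fin d → ℤ) → ℂ}
    (hb : PolyGrowth b) (α : Fin d → ℤ) :
    ∑ γ ∈ gramSet V, conv V b (α + γ) * gram V γ = b α := by
  have h1 : ∀ γ ∈ gramSet V, HasSum (fun β => gramInv V (α + γ - β) * b β * gram V γ)
      (conv V b (α + γ) * gram V γ) := fun γ _ =>
    ((summable_conv hV hU hb (α + γ)).hasSum.mul_right _)
  have h2 := hasSum_sum h1
  have h3 : ∀ β, ∑ γ ∈ gramSet V, gramInv V (α + γ - β) * b β * gram V γ =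
      if β = α then b α else 0 := by
    intro β
    have h4 := sum_gram_mul_gramInv hV hU (α - β)
    have h5 : ∑ γ ∈ gramSet V, gram V γ * gramInv V (α - β - γ) =
        ∑ γ ∈ gramSet V, gram V γ * gramInv V (α + γ - β) := by
      refine Finset.sum_nbij' (fun γ => -γ) (fun γ => -γ) (fun γ h => neg_mem_gramSet.2 h)
        (fun γ h => neg_mem_gramSet.2 h) (fun _ _ => neg_neg _) (fun _ _ => neg_neg _)
        fun γ _ => ?_
      rw [gram_neg]; congr 2; abel
    rw [h5] at h4
    calc _ = (∑ γ ∈ gramSet V, gram V γ * gramInv V (α + γ - β)) * b β := by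
          rw [Finset.sum_mul]; exact Finset.sum_congr rfl fun γ _ => by ring
      _ = _ := by
          rw [h4]
          by_cases h : β = α
          · simp [h]
          · rw [if_neg h, if_neg fun h' => h (sub_eq_zero.1 h').symm, zero_mul]
  simp_rw [h3] at h2
  exact h2.unique (hasSum_ite_eq α (b α))

/-- The companion of `sum_gram_mul_conv`: the two convolutions are inverse to each other on
sequences of polynomial growth. One order gives existence of the coefficients of the projection,
this one gives uniqueness and the reproduction of splines. -/
lemma conv_gram (hV : Admissible V) (hU : Unimodular V) {c : (Fin d → ℤ) → ℂ}
    (hc : PolyGrowth c) (α : Fin d → ℤ) :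
    conv V (fun β => ∑ γ ∈ gramSet V, c (β + γ) * gram V γ) α = c α := by
  rw [← sum_gram_mul_conv hV hU hc α]
  have h1 : ∀ γ ∈ gramSet V, HasSum (fun β => gramInv V (α - β) * (c (β + γ) * gram V γ))
      (conv V c (α + γ) * gram V γ) := by
    intro γ _
    have h := (summable_conv hV hU hc (α + γ)).hasSum.mul_right (gram V γ)
    have h2 := ((Equiv.addRight γ).hasSum_iff).2 h
    refine h2.congr_fun fun β => ?_
    simp only [Function.comp_apply, Equiv.coe_addRight]
    rw [add_sub_add_right_eq_sub]; ring
  have h2 := hasSum_sum h1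
  simp_rw [← Finset.mul_sum] at h2
  exact h2.tsum_eq

/-! ### The projection on functions of slow growth -/

/-- The moments of `g` against the translates of the box spline. -/
def moment (V : Fin n → Fin d → ℤ) (g : (Fin d → ℝ) → ℂ) (α : Fin d → ℤ) : ℂ :=
  ∫ x, g x * ((bs V (x - toReal α) : ℝ) : ℂ)

/-- The coefficients of the projection. -/
def coef (V : Fin n → Fin d → ℤ) (g : (Fin d → ℝ) → ℂ) : (Fin d → ℤ) → ℂ := conv V (moment V g)

/-- The projection, evaluated at every point. -/
def projFun (V : Fin n → Fin d → ℤ) (g : (Fin d → ℝ) → ℂ) : (Fin d → ℝ) → ℂ := bsSum V (coef V g)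

lemma mem_Icc_cell {x : Fin d → ℝ} {α : Fin d → ℤ} (hx : ‖x - toReal α‖ ≤ boxRadius V) :
    ∃ γ ∈ Finset.Icc (fun _ : Fin d => -⌈boxRadius V⌉ - 1) (fun _ => ⌈boxRadius V⌉),
      x ∈ Set.Icc (toReal (α + γ)) (toReal (α + γ) + 1) := by
  refine ⟨fun j => ⌊x j⌋ - α j, ?_, ?_, ?_⟩
  · rw [Finset.mem_Icc, Pi.le_def, Pi.le_def, ← forall_and]
    intro j
    have h1 := (norm_le_pi_norm (x - toReal α) j).trans hx
    rw [Real.norm_eq_abs, Pi.sub_apply, toReal, abs_le] at h1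
    have h2 := Int.le_ceil (boxRadius V)
    have h3 := Int.floor_le (x j)
    have h4 := Int.lt_floor_add_one (x j)
    constructor
    · have : (-⌈boxRadius V⌉ - 1 : ℝ) ≤ ⌊x j⌋ - α j := by linarith
      exact_mod_cast this
    · have : (⌊x j⌋ - α j : ℝ) ≤ ⌈boxRadius V⌉ := by linarith
      exact_mod_cast this
  · intro j
    simp only [toReal, Pi.add_apply, add_sub_cancel]
    exact Int.floor_le _
  · intro j
    simp only [toReal, Pi.add_apply, add_sub_cancel, Pi.one_apply]
    exact (Int.lt_floor_add_one _).le

lemma polyGrowth_moment {g : (Fin d → ℝ) → ℂ} (hg : SlowGrowth g) : PolyGrowth (moment V g) := by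
  obtain ⟨hgi, C, N, hC⟩ := hg
  have hC0 : 0 ≤ C := by simpa using (norm_nonneg _).trans (hC 0)
  set S := Finset.Icc (fun _ : Fin d => -⌈boxRadius V⌉ - 1) (fun _ => ⌈boxRadius V⌉)
  refine ⟨∑ γ ∈ S, C * (1 + ‖γ‖) ^ N, N, fun α => ?_⟩
  have hI : ∀ γ : Fin d → ℤ, IntegrableOn (fun x => ‖g x‖)
      (Set.Icc (toReal γ) (toReal γ + 1)) := fun γ =>
    (hgi.integrableOn_isCompact isCompact_Icc).norm
  have hI' : ∀ γ : Fin d → ℤ, Integrable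
      (Set.indicator (Set.Icc (toReal γ) (toReal γ + 1)) fun x => ‖g x‖) := fun γ =>
    (integrable_indicator_iff measurableSet_Icc).2 (hI γ)
  calc ‖moment V g α‖ ≤ ∫ x, ‖g x * ((bs V (x - toReal α) : ℝ) : ℂ)‖ :=
        norm_integral_le_integral_norm _
    _ ≤ ∫ x, ∑ γ ∈ S, Set.indicator (Set.Icc (toReal (α + γ)) (toReal (α + γ) + 1))
          (fun x => ‖g x‖) x := by
        refine integral_mono (LocallyIntegrable.mul_bs hgi α).norm
          (integrable_finsetSum _ fun γ _ => hI' _) fun x => ?_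
        have hnn : ∀ γ, 0 ≤ Set.indicator (Set.Icc (toReal (α + γ)) (toReal (α + γ) + 1))
          (fun x => ‖g x‖) x := fun γ => Set.indicator_nonneg (fun _ _ => norm_nonneg _) _
        simp only
        rw [norm_mul, Complex.norm_real, Real.norm_of_nonneg (bs_nonneg _)]
        by_cases hx : ‖x - toReal α‖ ≤ boxRadius V
        · obtain ⟨γ, hγ, hxγ⟩ := mem_Icc_cell hx
          refine le_trans ?_ (Finset.single_le_sum (fun γ _ => hnn γ) hγ)
          rw [Set.indicator_of_mem hxγ]
          exact mul_le_of_le_one_right (norm_nonneg _) (bs_le_one _)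
        · rw [bs_eq_zero (not_le.1 hx), mul_zero]
          exact Finset.sum_nonneg fun γ _ => hnn γ
    _ = ∑ γ ∈ S, ∫ x in Set.Icc (toReal (α + γ)) (toReal (α + γ) + 1), ‖g x‖ := by
        rw [integral_finsetSum _ fun γ _ => hI' _]
        simp_rw [integral_indicator measurableSet_Icc]
    _ ≤ ∑ γ ∈ S, C * (1 + ‖α + γ‖) ^ N :=
        Finset.sum_le_sum fun γ _ => (le_abs_self _).trans (hC _)
    _ ≤ ∑ γ ∈ S, C * (1 + ‖γ‖) ^ N * (1 + ‖α‖) ^ N := by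
        refine Finset.sum_le_sum fun γ _ => ?_
        rw [mul_assoc, ← mul_pow, mul_comm (1 + ‖γ‖)]
        gcongr
        exact one_add_norm_add_le _ _
    _ = _ := by rw [Finset.sum_mul]

/-- Orthogonality of the error to the translates is the system of normal equations, a finite
convolution equation with the Gram sequence. -/
lemma isProjCoeff_iff (hV : Admissible V) (hU : Unimodular V) {g : (Fin d → ℝ) → ℂ}
    (hg : LocallyIntegrable g volume) (c : (Fin d → ℤ) → ℂ) :
    IsProjCoeff V g c ↔ PolyGrowth c ∧
      ∀ α, ∑ γ ∈ gramSet V, c (α + γ) * gram V γ = moment V g α := by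
  refine and_congr_right fun _ => forall_congr' fun α => ?_
  have h1 : ∫ x, (g x - splineSum V c x) * ((boxSpline V (x - toReal α) : ℝ) : ℂ) =
      ∫ x, (g x * ((bs V (x - toReal α) : ℝ) : ℂ) -
        bsSum V c x * ((bs V (x - toReal α) : ℝ) : ℂ)) := by
    refine integral_congr_ae ?_
    filter_upwards [splineSum_ae_eq hV hU, boxSpline_translates_ae_eq hV hU] with x h1 h2
    rw [h1, h2, sub_mul]
  rw [h1, integral_sub (LocallyIntegrable.mul_bs hg α) (integral_bsSum_mul_bs c α).1,
    (integral_bsSum_mul_bs c α).2, sub_eq_zero]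
  exact eq_comm

lemma isProjCoeff_coef (hV : Admissible V) (hU : Unimodular V) {g : (Fin d → ℝ) → ℂ}
    (hg : SlowGrowth g) : IsProjCoeff V g (coef V g) :=
  (isProjCoeff_iff hV hU hg.1 _).2
    ⟨polyGrowth_conv hV hU (polyGrowth_moment hg),
      sum_gram_mul_conv hV hU (polyGrowth_moment hg)⟩

lemma IsProjCoeff.eq_coef (hV : Admissible V) (hU : Unimodular V) {g : (Fin d → ℝ) → ℂ}
    (hg : LocallyIntegrable g volume) {c : (Fin d → ℤ) → ℂ} (hc : IsProjCoeff V g c) :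
    c = coef V g := by
  obtain ⟨h1, h2⟩ := (isProjCoeff_iff hV hU hg c).1 hc
  ext α
  rw [← conv_gram hV hU h1 α, coef]
  congr 1
  ext β
  exact h2 β

lemma existsUnique_isProjCoeff (hV : Admissible V) (hU : Unimodular V) {g : (Fin d → ℝ) → ℂ}
    (hg : SlowGrowth g) : ∃! c, IsProjCoeff V g c :=
  ⟨coef V g, isProjCoeff_coef hV hU hg, fun _ hc => hc.eq_coef hV hU hg.1⟩

lemma proj_eq (hV : Admissible V) (hU : Unimodular V) {g : (Fin d → ℝ) → ℂ}
    (hg : SlowGrowth g) : proj V g = splineSum V (coef V g) := by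
  have h : ∃ c, IsProjCoeff V g c := ⟨_, isProjCoeff_coef hV hU hg⟩
  rw [proj, dif_pos h, h.choose_spec.eq_coef hV hU hg.1]

/-- One null set serves every `g`. Since `projFun` is defined at every point, it may later be
applied to a function that depends on `x` and evaluated at that same `x`. -/
lemma proj_ae_eq (hV : Admissible V) (hU : Unimodular V) :
    ∀ᵐ x, ∀ g : (Fin d → ℝ) → ℂ, SlowGrowth g → proj V g x = projFun V g x := by
  filter_upwards [splineSum_ae_eq hV hU] with x hx g hg
  rw [proj_eq hV hU hg, hx]; rfl

/-- The projection reproduces splines with coefficients of polynomial growth. -/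
lemma projFun_bsSum (hV : Admissible V) (hU : Unimodular V) {c : (Fin d → ℤ) → ℂ}
    (hc : PolyGrowth c) : projFun V (bsSum V c) = bsSum V c := by
  have : coef V (bsSum V c) = c := by
    ext α
    rw [← conv_gram hV hU hc α, coef]
    congr 1
    ext β
    exact (integral_bsSum_mul_bs c β).2
  rw [projFun, this]

lemma projFun_congr {g g' : (Fin d → ℝ) → ℂ} (h : g =ᵐ[volume] g') :
    projFun V g = projFun V g' := by
  have : moment V g = moment V g' := by
    ext α
    refine integral_congr_ae ?_
    filter_upwards [h] with x hx
    rw [hx]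
  rw [projFun, projFun, coef, coef, this]

lemma bsSum_add (c c' : (Fin d → ℤ) → ℂ) (x : Fin d → ℝ) :
    bsSum V (fun α => c α + c' α) x = bsSum V c x + bsSum V c' x := by
  simp_rw [bsSum_eq_sum _ (le_refl (near V x)), add_mul, Finset.sum_add_distrib]

lemma bsSum_smul (a : ℂ) (c : (Fin d → ℤ) → ℂ) (x : Fin d → ℝ) :
    bsSum V (fun α => a * c α) x = a * bsSum V c x := by
  simp_rw [bsSum_eq_sum _ (le_refl (near V x)), mul_assoc, Finset.mul_sum]

lemma projFun_add (hV : Admissible V) (hU : Unimodular V) {g g' : (Fin d → ℝ) → ℂ}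
    (hg : SlowGrowth g) (hg' : SlowGrowth g') (x : Fin d → ℝ) :
    projFun V (fun y => g y + g' y) x = projFun V g x + projFun V g' x := by
  rw [projFun, projFun, projFun, ← bsSum_add]
  congr 1
  ext α
  rw [coef, coef, coef, conv, conv, conv, ← (summable_conv hV hU (polyGrowth_moment hg) α).tsum_add
    (summable_conv hV hU (polyGrowth_moment hg') α)]
  refine tsum_congr fun β => ?_
  rw [← mul_add, moment, moment, moment, ← integral_add (LocallyIntegrable.mul_bs hg.1 β)
    (LocallyIntegrable.mul_bs hg'.1 β)]
  simp_rw [add_mul]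

lemma projFun_const_mul (a : ℂ) (g : (Fin d → ℝ) → ℂ) (x : Fin d → ℝ) :
    projFun V (fun y => a * g y) x = a * projFun V g x := by
  rw [projFun, projFun, ← bsSum_smul]
  congr 1
  ext α
  rw [coef, coef, conv, conv, ← tsum_mul_left]
  refine tsum_congr fun β => ?_
  have h : moment V (fun y => a * g y) β = a * moment V g β := by
    simp_rw [moment, mul_assoc, integral_const_mul]
  rw [h]; ring

end

section

/-! ### The kernel bound -/

variable {d n : ℕ} {V : Fin n → Fin d → ℤ}

lemma enorm_tsum_le {ι : Type*} (f : ι → ℂ) : ‖∑' i, f i‖ₑ ≤ ∑' i, ‖f i‖ₑ := by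
  by_cases h : ∑' i, ‖f i‖ₑ = ⊤
  · rw [h]; exact le_top
  · have h1 : Summable fun i => ‖f i‖ := by
      have := ENNReal.summable_toReal h
      simpa using this
    rw [← ofReal_norm]
    simp_rw [← ofReal_norm]
    rw [← ENNReal.ofReal_tsum_of_nonneg (fun i => norm_nonneg _) h1]
    exact ENNReal.ofReal_le_ofReal (norm_tsum_le_tsum_norm h1)

/-- A rapidly decaying function on `ℝ^d`. -/
def decay (d N : ℕ) (z : Fin d → ℝ) : ℝ≥0∞ := ENNReal.ofReal (((1 + ‖z‖) ^ N)⁻¹)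

@[fun_prop]
lemma measurable_decay (N : ℕ) : Measurable (decay d N) := by
  unfold decay; fun_prop

lemma tsum_enorm_bs_le (x : Fin d → ℝ) :
    ∑' α : Fin d → ℤ, ENNReal.ofReal (bs V (x - toReal α)) ≤ nearBound V := by
  rw [tsum_eq_sum (s := near V x) fun α hα => by
    rw [bs_eq_zero_of_notMem_near hα, ENNReal.ofReal_zero]]
  refine (Finset.sum_le_card_nsmul _ _ 1 fun α _ => ?_).trans ?_
  · exact ENNReal.ofReal_le_one.2 (bs_le_one _)
  · rw [nsmul_eq_mul, mul_one]
    exact_mod_cast card_near_le x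

/-- The coefficients and values of the projection are controlled by a rapidly decaying kernel. -/
lemma exists_kernel_bound (hV : Admissible V) (hU : Unimodular V) (N : ℕ) :
    ∃ C : ℝ≥0, ∀ g : (Fin d → ℝ) → ℂ, AEMeasurable g volume → ∀ x,
      ∑' α, ‖coef V g α‖ₑ * ENNReal.ofReal (bs V (x - toReal α)) ≤
        C * ∫⁻ z, decay d N z * ‖g (x + z)‖ₑ := by
  obtain ⟨C, hC0, hC⟩ := exists_gramInv_decay hV hU N
  set R := boxRadius V with hR
  have hR0 : 0 ≤ R := boxRadius_nonneg
  set B : ℝ≥0 := ⟨C * (1 + 2 * R) ^ N, by positivity⟩ with hB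
  refine ⟨nearBound V * nearBound V * B, fun g hg x => ?_⟩
  -- The product of the two box splines vanishes unless `α` is near `x` and `β` is near `y`. Then `α
  -- - β` and `x - y` differ by at most `2R`, so decay in `α - β` becomes decay in `y - x`. What
  -- remains are two sums of translates of the box spline, each bounded by `nearBound`.
  have hterm : ∀ (y : Fin d → ℝ) (α β : Fin d → ℤ),
      ‖gramInv V (α - β)‖ₑ * ENNReal.ofReal (bs V (y - toReal β)) *
        ENNReal.ofReal (bs V (x - toReal α)) ≤
      B * decay d N (y - x) * (ENNReal.ofReal (bs V (y - toReal β)) *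
        ENNReal.ofReal (bs V (x - toReal α))) := by
    intro y α β
    by_cases hα : α ∈ near V x
    swap; · simp [bs_eq_zero_of_notMem_near hα]
    by_cases hβ : β ∈ near V y
    swap; · simp [bs_eq_zero_of_notMem_near hβ]
    rw [mul_assoc]
    refine mul_le_mul_left ?_ _
    rw [mem_near] at hα hβ
    have h1 : 1 + ‖y - x‖ ≤ (1 + 2 * R) * (1 + ‖α - β‖) := by
      have h2 : y - x = (y - toReal β) - (x - toReal α) - toReal (α - β) := by
        rw [toReal_sub]; abel
      have h3 : ‖y - x‖ ≤ R + R + ‖α - β‖ := by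
        rw [h2, ← norm_toReal]
        exact (norm_sub_le _ _).trans (add_le_add_left ((norm_sub_le _ _).trans
          (add_le_add hβ hα)) _)
      nlinarith [norm_nonneg (α - β), mul_nonneg hR0 (norm_nonneg (α - β))]
    have h4 : ‖gramInv V (α - β)‖ ≤ C * (1 + 2 * R) ^ N * ((1 + ‖y - x‖) ^ N)⁻¹ := by
      rw [← div_eq_mul_inv, le_div_iff₀ (by positivity)]
      calc ‖gramInv V (α - β)‖ * (1 + ‖y - x‖) ^ N
          ≤ ‖gramInv V (α - β)‖ * ((1 + 2 * R) * (1 + ‖α - β‖)) ^ N := by gcongr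
        _ = (‖gramInv V (α - β)‖ * (1 + ‖α - β‖) ^ N) * (1 + 2 * R) ^ N := by
          rw [mul_pow]; ring
        _ ≤ _ := by gcongr; exact hC _
    rw [← ofReal_norm, decay]
    have h5 : (B : ℝ≥0∞) = ENNReal.ofReal (C * (1 + 2 * R) ^ N) := by
      rw [ENNReal.ofReal_eq_coe_nnreal (by positivity)]; rfl
    rw [h5, ← ENNReal.ofReal_mul (by positivity)]
    exact ENNReal.ofReal_le_ofReal h4
  have hmoment : ∀ β, ‖moment V g β‖ₑ ≤
      ∫⁻ y, ‖g y‖ₑ * ENNReal.ofReal (bs V (y - toReal β)) := by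
    intro β
    refine (enorm_integral_le_lintegral_enorm _).trans (le_of_eq ?_)
    congr 1
    ext y
    rw [enorm_mul, ← ofReal_norm ((bs V (y - toReal β) : ℝ) : ℂ), Complex.norm_real,
      Real.norm_of_nonneg (bs_nonneg _)]
  have hmeas : ∀ β : Fin d → ℤ,
      AEMeasurable fun y => ‖g y‖ₑ * ENNReal.ofReal (bs V (y - toReal β)) := fun β =>
    hg.enorm.mul (by fun_prop : Measurable fun y =>
      ENNReal.ofReal (bs V (y - toReal β))).aemeasurable
  calc ∑' α, ‖coef V g α‖ₑ * ENNReal.ofReal (bs V (x - toReal α))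
      ≤ ∑' α, (∑' β, ‖gramInv V (α - β)‖ₑ *
          ∫⁻ y, ‖g y‖ₑ * ENNReal.ofReal (bs V (y - toReal β))) *
            ENNReal.ofReal (bs V (x - toReal α)) := by
        refine ENNReal.tsum_le_tsum fun α => mul_le_mul_left ?_ _
        rw [coef, conv]
        refine (enorm_tsum_le _).trans (ENNReal.tsum_le_tsum fun β => ?_)
        rw [enorm_mul]
        exact mul_le_mul_right (hmoment β) _
    _ = ∑' α, ∑' β, ∫⁻ y, ‖g y‖ₑ * (‖gramInv V (α - β)‖ₑ *
          ENNReal.ofReal (bs V (y - toReal β)) * ENNReal.ofReal (bs V (x - toReal α))) := by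
        refine tsum_congr fun α => ?_
        rw [← ENNReal.tsum_mul_right]
        refine tsum_congr fun β => ?_
        rw [← lintegral_const_mul'' _ (hmeas β), ← lintegral_mul_const'' _
          ((hmeas β).const_mul _)]
        congr 1
        ext y; ring
    _ = ∫⁻ y, ∑' α, ∑' β, ‖g y‖ₑ * (‖gramInv V (α - β)‖ₑ *
          ENNReal.ofReal (bs V (y - toReal β)) * ENNReal.ofReal (bs V (x - toReal α))) := by
        have hm : ∀ α β : Fin d → ℤ, AEMeasurable fun y => ‖g y‖ₑ * (‖gramInv V (α - β)‖ₑ *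
          ENNReal.ofReal (bs V (y - toReal β)) * ENNReal.ofReal (bs V (x - toReal α))) :=
          fun α β => hg.enorm.mul (by fun_prop : Measurable fun y => (‖gramInv V (α - β)‖ₑ *
            ENNReal.ofReal (bs V (y - toReal β)) *
              ENNReal.ofReal (bs V (x - toReal α)))).aemeasurable
        rw [lintegral_tsum fun α => AEMeasurable.tsum fun β => hm α β]
        refine tsum_congr fun α => ?_
        rw [lintegral_tsum fun β => hm α β]
    _ ≤ ∫⁻ y, (nearBound V * nearBound V * B : ℝ≥0) * (decay d N (y - x) * ‖g y‖ₑ) := by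
        refine lintegral_mono fun y => ?_
        calc ∑' α, ∑' β, ‖g y‖ₑ * (‖gramInv V (α - β)‖ₑ *
              ENNReal.ofReal (bs V (y - toReal β)) * ENNReal.ofReal (bs V (x - toReal α)))
            ≤ ∑' α, ∑' β, ‖g y‖ₑ * (B * decay d N (y - x) *
              (ENNReal.ofReal (bs V (y - toReal β)) * ENNReal.ofReal (bs V (x - toReal α)))) :=
              ENNReal.tsum_le_tsum fun α => ENNReal.tsum_le_tsum fun β =>
                mul_le_mul_right (hterm y α β) _
          _ = ‖g y‖ₑ * (B * decay d N (y - x)) *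
              ((∑' β : Fin d → ℤ, ENNReal.ofReal (bs V (y - toReal β))) *
                ∑' α : Fin d → ℤ, ENNReal.ofReal (bs V (x - toReal α))) := by
              rw [← ENNReal.tsum_mul_left, ← ENNReal.tsum_mul_left]
              refine tsum_congr fun α => ?_
              rw [← ENNReal.tsum_mul_right, ← ENNReal.tsum_mul_left]
              refine tsum_congr fun β => ?_
              ring
          _ ≤ ‖g y‖ₑ * (B * decay d N (y - x)) * (nearBound V * nearBound V) := by
              gcongr
              · exact tsum_enorm_bs_le y
              · exact tsum_enorm_bs_le x
          _ = _ := by push_cast; ring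
    _ = (nearBound V * nearBound V * B : ℝ≥0) * ∫⁻ y, decay d N (y - x) * ‖g y‖ₑ := by
        rw [lintegral_const_mul' _ _ ENNReal.coe_ne_top]
    _ = _ := by
        congr 1
        rw [← lintegral_add_left_eq_self (fun y => decay d N (y - x) * ‖g y‖ₑ) x]
        simp

lemma enorm_projFun_le (g : (Fin d → ℝ) → ℂ) (x : Fin d → ℝ) :
    ‖projFun V g x‖ₑ ≤ ∑' α, ‖coef V g α‖ₑ * ENNReal.ofReal (bs V (x - toReal α)) := by
  rw [projFun, bsSum]
  refine (enorm_tsum_le _).trans (le_of_eq (tsum_congr fun α => ?_))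
  rw [enorm_mul, ← ofReal_norm ((bs V (x - toReal α) : ℝ) : ℂ), Complex.norm_real,
    Real.norm_of_nonneg (bs_nonneg _)]

lemma lintegral_decay_lt_top {N : ℕ} (hN : d + 1 ≤ N) : ∫⁻ z, decay d N z < ⊤ := by
  refine lt_of_le_of_lt (lintegral_mono fun z => ?_) (lintegral_one_add_norm_lt_top (d := d))
  unfold decay
  refine ENNReal.ofReal_le_ofReal ?_
  have : 1 ≤ 1 + ‖z‖ := by linarith [norm_nonneg z]
  gcongr

/-- Jensen's inequality for averages with a weight of finite mass. -/
lemma lintegral_rpow_le {X : Type*} [MeasurableSpace X] {μ : Measure X} {κ F : X → ℝ≥0∞}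
    (hκ : AEMeasurable κ μ) (hF : AEMeasurable F μ)
    {p : ℝ} (hp : 1 ≤ p) :
    (∫⁻ x, κ x * F x ∂μ) ^ p ≤ (∫⁻ x, κ x ∂μ) ^ (p - 1) * ∫⁻ x, κ x * F x ^ p ∂μ := by
  rcases hp.eq_or_lt with rfl | hp1
  · simp
  have hpq := Real.HolderConjugate.conjExponent hp1
  set q := Real.conjExponent p
  have hp0 : 0 < p := by linarith
  have hq0 : 0 < q := hpq.symm.pos
  -- Hölder's inequality for the splitting `κ F = κ^(1/q) · (κ^(1/p) F)`.
  have h1 := ENNReal.lintegral_mul_le_Lp_mul_Lq μ hpq.symm (f := fun x => κ x ^ (1 / q))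
    (g := fun x => κ x ^ (1 / p) * F x) (hκ.pow_const _) ((hκ.pow_const _).mul hF)
  have hsum : 1 / q + 1 / p = 1 := by
    have := hpq.inv_add_inv_eq_one
    rw [one_div, one_div]; linarith
  have h2 : ∀ x, κ x ^ (1 / q) * (κ x ^ (1 / p) * F x) = κ x * F x := by
    intro x
    rw [← mul_assoc, ← ENNReal.rpow_add_of_nonneg _ _ (by positivity) (by positivity), hsum,
      ENNReal.rpow_one]
  have h3 : ∀ x, (κ x ^ (1 / q)) ^ q = κ x := fun x => by
    rw [← ENNReal.rpow_mul, one_div_mul_cancel hq0.ne', ENNReal.rpow_one]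
  have h4 : ∀ x, (κ x ^ (1 / p) * F x) ^ p = κ x * F x ^ p := fun x => by
    rw [ENNReal.mul_rpow_of_nonneg _ _ hp0.le, ← ENNReal.rpow_mul, one_div_mul_cancel hp0.ne',
      ENNReal.rpow_one]
  simp only [Pi.mul_apply, h2, h3, h4] at h1
  have h5 := ENNReal.rpow_le_rpow h1 hp0.le
  rw [ENNReal.mul_rpow_of_nonneg _ _ hp0.le, ← ENNReal.rpow_mul, ← ENNReal.rpow_mul,
    one_div_mul_cancel hp0.ne', ENNReal.rpow_one] at h5
  have h6 : 1 / q * p = p - 1 := by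
    have h7 : 1 / q = 1 - 1 / p := by linarith
    rw [h7]; field_simp
  rwa [h6] at h5

lemma AEMeasurable.ae_slice {X Y : Type*} [MeasurableSpace X] [MeasurableSpace Y]
    {μ : Measure X} {ν : Measure Y} [SFinite ν] {F : X × Y → ℝ≥0∞}
    (hF : AEMeasurable F (μ.prod ν)) : ∀ᵐ x ∂μ, AEMeasurable (fun y => F (x, y)) ν := by
  obtain ⟨G, hG, hFG⟩ := hF
  filter_upwards [Measure.ae_ae_of_ae_prod hFG] with x hx
  exact ⟨fun y => G (x, y), by fun_prop, hx⟩

/-- Averages of a family of `L^p` functions with a fixed weight. -/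
lemma lintegral_lintegral_rpow_le {X Y : Type*} [MeasurableSpace X] [MeasurableSpace Y]
    {μ : Measure X} {ν : Measure Y} [SFinite μ] [SFinite ν] {κ : Y → ℝ≥0∞} {F : X → Y → ℝ≥0∞}
    (hκ : Measurable κ) (hF : AEMeasurable (Function.uncurry F) (μ.prod ν))
    {p : ℝ} (hp : 1 ≤ p) :
    ∫⁻ x, (∫⁻ y, κ y * F x y ∂ν) ^ p ∂μ ≤
      (∫⁻ y, κ y ∂ν) ^ (p - 1) * ∫⁻ y, κ y * ∫⁻ x, F x y ^ p ∂μ ∂ν := by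
  have h0 : ∀ᵐ x ∂μ, AEMeasurable (F x) ν := AEMeasurable.ae_slice hF
  have hm : AEMeasurable (fun q : X × Y => κ q.2 * F q.1 q.2 ^ p) (μ.prod ν) :=
    (hκ.comp measurable_snd).aemeasurable.mul (hF.pow_const _)
  have hm' : AEMeasurable (fun q : Y × X => κ q.1 * F q.2 q.1 ^ p) (ν.prod μ) := hm.prod_swap
  calc ∫⁻ x, (∫⁻ y, κ y * F x y ∂ν) ^ p ∂μ
      ≤ ∫⁻ x, (∫⁻ y, κ y ∂ν) ^ (p - 1) * ∫⁻ y, κ y * F x y ^ p ∂ν ∂μ := by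
        refine lintegral_mono_ae ?_
        filter_upwards [h0] with x hx
        exact lintegral_rpow_le hκ.aemeasurable hx hp
    _ = (∫⁻ y, κ y ∂ν) ^ (p - 1) * ∫⁻ x, ∫⁻ y, κ y * F x y ^ p ∂ν ∂μ := by
        rw [lintegral_const_mul'' _ hm.lintegral_prod_right']
    _ = _ := by
        rw [lintegral_lintegral_swap hm]
        congr 1
        refine lintegral_congr_ae ?_
        have h1 : ∀ᵐ y ∂ν, AEMeasurable (fun x => F x y) μ := AEMeasurable.ae_slice hF.prod_swap
        filter_upwards [h1] with y hy
        rw [lintegral_const_mul'' _ (hy.pow_const _)]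

end

section

/-! ### Functions of slow growth -/

variable {d n : ℕ} {V : Fin n → Fin d → ℤ}

lemma SlowGrowth.add {g g' : (Fin d → ℝ) → ℂ} (hg : SlowGrowth g) (hg' : SlowGrowth g') :
    SlowGrowth fun x => g x + g' x := by
  obtain ⟨h1, C, N, hC⟩ := hg
  obtain ⟨h2, C', N', hC'⟩ := hg'
  have hC0 : 0 ≤ C := by simpa using (norm_nonneg _).trans (hC 0)
  have hC0' : 0 ≤ C' := by simpa using (norm_nonneg _).trans (hC' 0)
  refine ⟨h1.add h2, C + C', max N N', fun α => ?_⟩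
  have hI1 := (h1.integrableOn_isCompact (isCompact_Icc (a := toReal α) (b := toReal α + 1))).norm
  have hI2 := (h2.integrableOn_isCompact (isCompact_Icc (a := toReal α) (b := toReal α + 1))).norm
  have h12 := ((h1.add h2).integrableOn_isCompact
    (isCompact_Icc (a := toReal α) (b := toReal α + 1))).norm
  rw [Real.norm_of_nonneg (integral_nonneg fun _ => norm_nonneg _)]
  calc ∫ x in Set.Icc (toReal α) (toReal α + 1), ‖g x + g' x‖
      ≤ ∫ x in Set.Icc (toReal α) (toReal α + 1), (‖g x‖ + ‖g' x‖) :=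
        integral_mono h12 (hI1.add hI2) fun x => norm_add_le _ _
    _ = _ + _ := integral_add hI1 hI2
    _ ≤ C * (1 + ‖α‖) ^ N + C' * (1 + ‖α‖) ^ N' :=
        add_le_add ((le_abs_self _).trans (hC α)) ((le_abs_self _).trans (hC' α))
    _ ≤ C * (1 + ‖α‖) ^ max N N' + C' * (1 + ‖α‖) ^ max N N' := by
        have : 1 ≤ 1 + ‖α‖ := by linarith [norm_nonneg α]
        gcongr
        · exact le_max_left _ _
        · exact le_max_right _ _
    _ = _ := by ring

lemma SlowGrowth.const_mul {g : (Fin d → ℝ) → ℂ} (hg : SlowGrowth g) (a : ℂ) :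
    SlowGrowth fun x => a * g x := by
  obtain ⟨h1, C, N, hC⟩ := hg
  refine ⟨h1.smul a, ‖a‖ * C, N, fun α => ?_⟩
  simp_rw [norm_mul, integral_const_mul]
  rw [norm_mul, norm_norm, mul_assoc]
  exact mul_le_mul_of_nonneg_left (hC α) (norm_nonneg _)

lemma SlowGrowth.finset_sum {ι : Type*} (s : Finset ι) {g : ι → (Fin d → ℝ) → ℂ}
    (hg : ∀ i ∈ s, SlowGrowth (g i)) : SlowGrowth fun x => ∑ i ∈ s, g i x := by
  classical
  induction s using Finset.induction_on with
  | empty =>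
    refine ⟨by simpa using locallyIntegrable_zero, 0, 0, fun α => by simp⟩
  | insert a s ha ih =>
    simp_rw [Finset.sum_insert ha]
    exact (hg a (Finset.mem_insert_self _ _)).add
      (ih fun i hi => hg i (Finset.mem_insert_of_mem hi))

lemma projFun_finset_sum (hV : Admissible V) (hU : Unimodular V) {ι : Type*} (s : Finset ι)
    {g : ι → (Fin d → ℝ) → ℂ} (hg : ∀ i ∈ s, SlowGrowth (g i)) (x : Fin d → ℝ) :
    projFun V (fun y => ∑ i ∈ s, g i y) x = ∑ i ∈ s, projFun V (g i) x := by
  classical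
  induction s using Finset.induction_on with
  | empty =>
    have := projFun_const_mul (V := V) 0 (fun _ => 0) x
    simpa using this
  | insert a s ha ih =>
    simp_rw [Finset.sum_insert ha]
    rw [projFun_add hV hU (hg a (Finset.mem_insert_self _ _))
      (SlowGrowth.finset_sum s fun i hi => hg i (Finset.mem_insert_of_mem hi)),
      ih fun i hi => hg i (Finset.mem_insert_of_mem hi)]

lemma slowGrowth_of_norm_le {g : (Fin d → ℝ) → ℂ} (hm : AEStronglyMeasurable g volume) {C : ℝ}
    {N : ℕ} (hC0 : 0 ≤ C) (hC : ∀ x, ‖g x‖ ≤ C * (1 + ‖x‖) ^ N) : SlowGrowth g := by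
  have hcont : Continuous fun x : Fin d → ℝ => C * (1 + ‖x‖) ^ N := by fun_prop
  have hL : LocallyIntegrable g volume := hcont.locallyIntegrable.mono hm
    (ae_of_all _ fun x => (hC x).trans (le_abs_self _))
  refine ⟨hL, C * 2 ^ N, N, fun α => ?_⟩
  have hvol : volume (Set.Icc (toReal α) (toReal α + 1)) = 1 := by
    simp [Real.volume_Icc_pi]
  refine (norm_setIntegral_le_of_norm_le_const (C := C * (2 * (1 + ‖α‖)) ^ N)
    (by rw [hvol]; exact ENNReal.one_lt_top) fun x hx => ?_).trans ?_
  · rw [norm_norm]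
    refine (hC x).trans ?_
    have h1 : ‖x - toReal α‖ ≤ 1 := (pi_norm_le_iff_of_nonneg zero_le_one).2 fun j => by
      have ha := hx.1 j
      have hb := hx.2 j
      rw [Pi.add_apply, Pi.one_apply] at hb
      rw [Pi.sub_apply, Real.norm_of_nonneg (by linarith)]
      linarith
    have h2 := norm_le_norm_add_norm_sub' x (toReal α)
    rw [norm_toReal] at h2
    have h3 := norm_nonneg α
    gcongr
    linarith
  · rw [Measure.real, hvol, ENNReal.toReal_one, mul_one, mul_pow]
    exact le_of_eq (by ring)

lemma slowGrowth_of_memLp {g : (Fin d → ℝ) → ℂ} {p : ℝ≥0∞} (hp : 1 ≤ p) (hg : MemLp g p volume) :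
    SlowGrowth g := by
  refine ⟨hg.locallyIntegrable hp, (eLpNorm g p volume).toReal, 0, fun α => ?_⟩
  rw [pow_zero, mul_one, Real.norm_of_nonneg (integral_nonneg fun _ => norm_nonneg _)]
  have hvol : volume (Set.Icc (toReal α) (toReal α + 1)) = 1 := by
    simp [Real.volume_Icc_pi]
  have h1 := eLpNorm_le_eLpNorm_mul_rpow_measure_univ hp
    (hg.aestronglyMeasurable.restrict (s := Set.Icc (toReal α) (toReal α + 1)))
  rw [Measure.restrict_apply_univ, hvol, ENNReal.one_rpow, mul_one, eLpNorm_one_eq_lintegral_enorm]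
    at h1
  rw [integral_norm_eq_lintegral_enorm hg.aestronglyMeasurable.restrict]
  exact ENNReal.toReal_mono hg.eLpNorm_ne_top (h1.trans (eLpNorm_restrict_le _ _ _ _))

/-! ### Dilations -/

lemma lintegral_comp_smul (F : (Fin d → ℝ) → ℝ≥0∞) {h : ℝ} (hh : h ≠ 0) :
    ∫⁻ x, F (h • x) = ENNReal.ofReal |(h ^ d)⁻¹| * ∫⁻ x, F x := by
  have h1 := Measure.map_addHaar_smul (volume : Measure (Fin d → ℝ)) hh
  rw [Module.finrank_fin_fun] at h1
  rw [← smul_eq_mul, ← lintegral_smul_measure, ← h1]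
  exact (lintegral_map_equiv F (Homeomorph.smulOfNeZero h hh).toMeasurableEquiv).symm

lemma quasiMeasurePreserving_smul {h : ℝ} (hh : h ≠ 0) :
    Measure.QuasiMeasurePreserving (fun x : Fin d → ℝ => h • x) volume volume :=
  Measure.quasiMeasurePreserving_smul volume hh

lemma memLp_of_lintegral {X : Type*} [MeasurableSpace X] {μ : Measure X} {f : X → ℂ} {p : ℝ}
    (hp : 1 ≤ p) (hf : AEStronglyMeasurable f μ) (h : ∫⁻ x, ‖f x‖ₑ ^ p ∂μ < ⊤) :
    MemLp f (ENNReal.ofReal p) μ := by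
  refine ⟨hf, ?_⟩
  rw [eLpNorm_lt_top_iff_lintegral_rpow_enorm_lt_top (by simp; linarith) (by simp),
    ENNReal.toReal_ofReal (by linarith)]
  exact h

lemma lintegral_lt_top_of_memLp {X : Type*} [MeasurableSpace X] {μ : Measure X} {f : X → ℂ} {p : ℝ}
    (hp : 1 ≤ p) (hf : MemLp f (ENNReal.ofReal p) μ) : ∫⁻ x, ‖f x‖ₑ ^ p ∂μ < ⊤ := by
  have := hf.2
  rwa [eLpNorm_lt_top_iff_lintegral_rpow_enorm_lt_top (by simp; linarith) (by simp),
    ENNReal.toReal_ofReal (by linarith)] at this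

lemma eLpNorm_rpow {X : Type*} [MeasurableSpace X] {μ : Measure X} (f : X → ℂ) {p : ℝ}
    (hp : 1 ≤ p) : eLpNorm f (ENNReal.ofReal p) μ ^ p = ∫⁻ x, ‖f x‖ₑ ^ p ∂μ := by
  rw [eLpNorm_eq_lintegral_rpow_enorm_toReal (by simp; linarith) (by simp),
    ENNReal.toReal_ofReal (by linarith), ← ENNReal.rpow_mul, one_div_mul_cancel (by linarith),
    ENNReal.rpow_one]

lemma memLp_comp_smul {f : (Fin d → ℝ) → ℂ} {p : ℝ} (hp : 1 ≤ p)
    (hf : MemLp f (ENNReal.ofReal p) volume) {h : ℝ} (hh : h ≠ 0) :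
    MemLp (fun x => f (h • x)) (ENNReal.ofReal p) volume := by
  refine memLp_of_lintegral hp (hf.1.comp_quasiMeasurePreserving (quasiMeasurePreserving_smul hh)) ?_
  rw [lintegral_comp_smul (fun x => ‖f x‖ₑ ^ p) hh]
  exact ENNReal.mul_lt_top ENNReal.ofReal_lt_top (lintegral_lt_top_of_memLp hp hf)

lemma projScaled_ae_eq (hV : Admissible V) (hU : Unimodular V) {h : ℝ} (hh : h ≠ 0)
    {f : (Fin d → ℝ) → ℂ} {p : ℝ} (hp : 1 ≤ p) (hf : MemLp f (ENNReal.ofReal p) volume) :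
    projScaled V h f =ᵐ[volume] fun x => projFun V (fun y => f (h • y)) (h⁻¹ • x) := by
  filter_upwards [(quasiMeasurePreserving_smul (d := d) (inv_ne_zero hh)).ae (proj_ae_eq hV hU)]
    with x hx
  exact hx _ (slowGrowth_of_memLp (by simpa using hp) (memLp_comp_smul hp hf hh))

/-! ### The projection on `L²` -/

/-- The kernel bound and Jensen's inequality, as for a convolution with an integrable kernel. The
bound is for the sum of absolute values, so that this sum can serve as a majorant when the series of
the projection is integrated term by term. -/
lemma lintegral_coef_lt_top (hV : Admissible V) (hU : Unimodular V) {g : (Fin d → ℝ) → ℂ} {p : ℝ}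
    (hp : 1 ≤ p) (hg : MemLp g (ENNReal.ofReal p) volume) :
    ∫⁻ x, (∑' α, ‖coef V g α‖ₑ * ENNReal.ofReal (bs V (x - toReal α))) ^ p < ⊤ := by
  obtain ⟨C, hC⟩ := exists_kernel_bound hV hU (d + 1)
  have hp0 : 0 ≤ p := by linarith
  have hm : AEMeasurable (Function.uncurry fun x z : Fin d → ℝ => ‖g (x + z)‖ₑ)
      (volume.prod volume) :=
    (hg.1.comp_quasiMeasurePreserving (quasiMeasurePreserving_add volume volume)).enorm
  have hJ := lintegral_lintegral_rpow_le (measurable_decay (d := d) (d + 1)) hm hp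
  have hD := lintegral_decay_lt_top (d := d) le_rfl
  calc _ ≤ ∫⁻ x, (C : ℝ≥0∞) ^ p * (∫⁻ z, decay d (d + 1) z * ‖g (x + z)‖ₑ) ^ p := by
        refine lintegral_mono fun x => ?_
        rw [← ENNReal.mul_rpow_of_nonneg _ _ hp0]
        exact ENNReal.rpow_le_rpow (hC g hg.1.aemeasurable x) hp0
    _ = (C : ℝ≥0∞) ^ p * ∫⁻ x, (∫⁻ z, decay d (d + 1) z * ‖g (x + z)‖ₑ) ^ p :=
        lintegral_const_mul' _ _ (ENNReal.rpow_ne_top_of_nonneg hp0 ENNReal.coe_ne_top)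
    _ < ⊤ := by
        refine ENNReal.mul_lt_top (ENNReal.rpow_lt_top_of_nonneg hp0 ENNReal.coe_ne_top) ?_
        refine hJ.trans_lt (ENNReal.mul_lt_top (ENNReal.rpow_lt_top_of_nonneg (by linarith) hD.ne) ?_)
        have : ∀ z : Fin d → ℝ, ∫⁻ x, ‖g (x + z)‖ₑ ^ p = ∫⁻ x, ‖g x‖ₑ ^ p := fun z =>
          lintegral_add_right_eq_self (fun x => ‖g x‖ₑ ^ p) z
        simp_rw [this]
        rw [lintegral_mul_const _ (measurable_decay _)]
        exact ENNReal.mul_lt_top hD (lintegral_lt_top_of_memLp hp hg)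

lemma integral_sub_projFun_mul_bs (hV : Admissible V) (hU : Unimodular V) {g : (Fin d → ℝ) → ℂ}
    (hg : SlowGrowth g) (α : Fin d → ℤ) :
    ∫ x, (g x - projFun V g x) * ((bs V (x - toReal α) : ℝ) : ℂ) = 0 := by
  have h := ((isProjCoeff_iff hV hU hg.1 _).1 (isProjCoeff_coef hV hU hg)).2 α
  simp_rw [sub_mul, projFun]
  rw [integral_sub (LocallyIntegrable.mul_bs hg.1 α) (integral_bsSum_mul_bs _ α).1,
    (integral_bsSum_mul_bs (coef V g) α).2, h]
  exact sub_self _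

/-- The explicit spline `s` has the two properties that characterise the orthogonal projection: it
lies in the closed span, and `f - s` is orthogonal to the generators. -/
lemma projL2_ae_eq (hV : Admissible V) (hU : Unimodular V) {h : ℝ} (hh : 0 < h)
    (f : Lp ℂ 2 (volume : Measure (Fin d → ℝ))) :
    projL2 V h f =ᵐ[volume] projScaled V h f := by
  have h2 : (1 : ℝ) ≤ 2 := one_le_two
  have hf : MemLp f (ENNReal.ofReal 2) volume := by
    have := Lp.memLp f
    simpa using this
  set g : (Fin d → ℝ) → ℂ := fun y => f (h • y)
  have hg : MemLp g (ENNReal.ofReal 2) volume := memLp_comp_smul h2 hf hh.ne'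
  have hgs : SlowGrowth g := slowGrowth_of_memLp (by simp) hg
  set s : (Fin d → ℝ) → ℂ := fun x => projFun V g (h⁻¹ • x)
  set A : (Fin d → ℝ) → ℝ≥0∞ := fun x =>
    ∑' α, ‖coef V g α‖ₑ * ENNReal.ofReal (bs V (h⁻¹ • x - toReal α)) with hA
  have hA2 : ∫⁻ x, A x ^ (2 : ℝ) < ⊤ := by
    rw [hA, lintegral_comp_smul (fun x => (∑' α, ‖coef V g α‖ₑ *
      ENNReal.ofReal (bs V (x - toReal α))) ^ (2 : ℝ)) (inv_ne_zero hh.ne')]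
    exact ENNReal.mul_lt_top ENNReal.ofReal_lt_top (lintegral_coef_lt_top hV hU h2 hg)
  have hsm : Measurable s := by
    unfold s projFun; fun_prop
  have hs : MemLp s 2 volume := by
    have : MemLp s (ENNReal.ofReal 2) volume := by
      refine memLp_of_lintegral h2 hsm.aestronglyMeasurable (lt_of_le_of_lt ?_ hA2)
      exact lintegral_mono fun x => ENNReal.rpow_le_rpow (enorm_projFun_le g _) zero_le_two
    simpa using this
  set K₀ : Submodule ℂ (Lp ℂ 2 (volume : Measure (Fin d → ℝ))) :=
    Submodule.span ℂ {g : Lp ℂ 2 (volume : Measure (Fin d → ℝ)) | ∃ α : Fin d → ℤ,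
      g =ᵐ[volume] fun x => ((boxSpline V (h⁻¹ • x - toReal α) : ℝ) : ℂ)} with hK₀
  have hgen : ∀ᵐ x : Fin d → ℝ, ∀ α : Fin d → ℤ,
      boxSpline V (h⁻¹ • x - toReal α) = bs V (h⁻¹ • x - toReal α) :=
    (quasiMeasurePreserving_smul (inv_ne_zero hh.ne')).ae (boxSpline_translates_ae_eq hV hU)
  have hmem : ∀ α : Fin d → ℤ,
      MemLp (fun x : Fin d → ℝ => ((bs V (h⁻¹ • x - toReal α) : ℝ) : ℂ)) 2 volume := by
    intro α
    have h1 : MemLp (fun x : Fin d → ℝ => ((bs V (x - toReal α) : ℝ) : ℂ)) (ENNReal.ofReal 2)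
        volume := by
      refine memLp_of_lintegral h2 (by fun_prop : Measurable _).aestronglyMeasurable ?_
      have hi : Integrable fun x : Fin d → ℝ => bs V (x - toReal α) :=
        integrable_bs.comp_sub_right _
      refine lt_of_le_of_lt (lintegral_mono fun x => ?_) hi.2
      rw [← ofReal_norm, Complex.norm_real, ← ofReal_norm (bs V (x - toReal α)),
        Real.norm_of_nonneg (bs_nonneg _)]
      have h3 : ENNReal.ofReal (bs V (x - toReal α)) ≤ 1 := ENNReal.ofReal_le_one.2 (bs_le_one _)
      calc ENNReal.ofReal (bs V (x - toReal α)) ^ (2 : ℝ)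
          ≤ ENNReal.ofReal (bs V (x - toReal α)) ^ (1 : ℝ) :=
            ENNReal.rpow_le_rpow_of_exponent_ge h3 one_le_two
        _ = _ := ENNReal.rpow_one _
    have h3 := memLp_comp_smul h2 h1 (inv_ne_zero hh.ne')
    simpa using h3
  have hcl : K₀.topologicalClosure = splineSpace V h := rfl
  have : CompleteSpace (splineSpace V h) :=
    (Submodule.isClosed_topologicalClosure _).completeSpace_coe
  have hproj : projL2 V h f = hs.toLp s := by
    refine Submodule.eq_starProjection_of_mem_orthogonal ?_ ?_
    -- The closed span is the double orthogonal complement, so it suffices to pair `s` with an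
    -- arbitrary `u` orthogonal to all generators. The pairing is computed term by term, with the
    -- square integrable majorant `A` and the Cauchy–Schwarz inequality justifying the exchange.
    · rw [← hcl, ← Submodule.orthogonal_orthogonal_eq_closure, Submodule.mem_orthogonal]
      intro u hu
      rw [Submodule.mem_orthogonal] at hu
      have hzero : ∀ α : Fin d → ℤ,
          ∫ x, ((bs V (h⁻¹ • x - toReal α) : ℝ) : ℂ) * (starRingEnd ℂ) (u x) = 0 := by
        intro α
        have h3 := hu ((hmem α).toLp _) (Submodule.subset_span ⟨α, by
          filter_upwards [(hmem α).coeFn_toLp, hgen] with x hx hx2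
          rw [hx, hx2]⟩)
        rw [← inner_conj_symm, map_eq_zero, L2.inner_def] at h3
        rw [← h3]
        refine integral_congr_ae ?_
        filter_upwards [(hmem α).coeFn_toLp] with x hx
        rw [hx, RCLike.inner_apply]
      rw [L2.inner_def]
      have hu2 : AEStronglyMeasurable (fun x => (starRingEnd ℂ) (u x)) volume :=
        Complex.continuous_conj.comp_aestronglyMeasurable (Lp.aestronglyMeasurable u)
      calc ∫ x, inner ℂ (u x) (hs.toLp s x)
          = ∫ x, ∑' α, coef V g α * (((bs V (h⁻¹ • x - toReal α) : ℝ) : ℂ) *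
              (starRingEnd ℂ) (u x)) := by
            refine integral_congr_ae ?_
            filter_upwards [hs.coeFn_toLp] with x hx
            rw [hx, RCLike.inner_apply]
            simp only [s, projFun, bsSum]
            rw [← tsum_mul_right]
            exact tsum_congr fun α => mul_assoc _ _ _
        _ = ∑' α, ∫ x, coef V g α * (((bs V (h⁻¹ • x - toReal α) : ℝ) : ℂ) *
              (starRingEnd ℂ) (u x)) := by
            have hmeas : ∀ α, AEStronglyMeasurable (fun x => coef V g α *
              (((bs V (h⁻¹ • x - toReal α) : ℝ) : ℂ) * (starRingEnd ℂ) (u x))) volume :=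
              fun α => ((by fun_prop : Measurable fun x : Fin d → ℝ =>
                ((bs V (h⁻¹ • x - toReal α) : ℝ) : ℂ)).aestronglyMeasurable.mul hu2).const_mul _
            refine integral_tsum hmeas ?_
            rw [← lintegral_tsum fun α => (hmeas α).enorm]
            have h4 : ∀ x, ∑' α, ‖coef V g α * (((bs V (h⁻¹ • x - toReal α) : ℝ) : ℂ) *
                (starRingEnd ℂ) (u x))‖ₑ = (A * fun x => ‖u x‖ₑ) x := by
              intro x
              rw [hA, Pi.mul_apply, ← ENNReal.tsum_mul_right]
              refine tsum_congr fun α => ?_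
              rw [enorm_mul, enorm_mul, mul_assoc, ← ofReal_norm ((bs V _ : ℝ) : ℂ),
                Complex.norm_real, Real.norm_of_nonneg (bs_nonneg _), ← ofReal_norm ((starRingEnd ℂ) _),
                RCLike.norm_conj, ofReal_norm]
            simp_rw [h4]
            refine ((ENNReal.lintegral_mul_le_Lp_mul_Lq volume
              (Real.HolderConjugate.two_two) ?_ ?_).trans_lt ?_).ne
            · refine (Measurable.tsum fun α => ?_).aemeasurable
              fun_prop
            · exact (Lp.aestronglyMeasurable u).enorm
            · have hu3 : MemLp u (ENNReal.ofReal 2) volume := by simpa using Lp.memLp u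
              exact ENNReal.mul_lt_top (ENNReal.rpow_lt_top_of_nonneg (by norm_num) hA2.ne)
                (ENNReal.rpow_lt_top_of_nonneg (by norm_num) (lintegral_lt_top_of_memLp h2 hu3).ne)
        _ = 0 := by
            simp_rw [integral_const_mul, hzero, mul_zero, tsum_zero]
    -- On a generator this is the normal equation of the unscaled problem after the dilation by `h`.
    · rw [← hcl, Submodule.orthogonal_closure, Submodule.mem_orthogonal]
      intro u hu
      induction hu using Submodule.span_induction with
      | zero => simp
      | add a b _ _ ha hb => rw [inner_add_left, ha, hb, add_zero]
      | smul a b _ hb => rw [inner_smul_left, hb, mul_zero]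
      | mem u hu =>
        obtain ⟨α, hα⟩ := hu
        rw [L2.inner_def]
        have h3 := integral_sub_projFun_mul_bs hV hU hgs α
        have h4 := Measure.integral_comp_smul volume
          (fun x => (g x - projFun V g x) * ((bs V (x - toReal α) : ℝ) : ℂ)) h⁻¹
        rw [h3, smul_zero] at h4
        rw [← h4]
        refine integral_congr_ae ?_
        filter_upwards [hα, hgen, hs.coeFn_toLp, Lp.coeFn_sub f (hs.toLp s)] with x h5 h6 h7 h8
        rw [h5, h6, h8, Pi.sub_apply, h7, RCLike.inner_apply]
        simp only [g, s, smul_smul, mul_inv_cancel₀ hh.ne', one_smul]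
        simp
  rw [hproj]
  refine hs.coeFn_toLp.trans ?_
  exact (projScaled_ae_eq hV hU hh.ne' h2 hf).symm

end

section

/-! ### Bernoulli splines -/

variable {d n : ℕ} {V : Fin n → Fin d → ℤ}

/-- Abel's inequality. -/
lemma norm_sum_mul_le_of_antitone {f : ℕ → ℝ} (hf : Antitone f) (hf0 : ∀ i, 0 ≤ f i)
    {z : ℕ → ℂ} {B : ℝ} (hB : ∀ K, ‖∑ i ∈ Finset.range K, z i‖ ≤ B) (K : ℕ) :
    ‖∑ i ∈ Finset.range K, f i • z i‖ ≤ f 0 * B := by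
  have hB0 : 0 ≤ B := (norm_nonneg _).trans (hB 0)
  rcases Nat.eq_zero_or_pos K with rfl | hK
  · simpa using mul_nonneg (hf0 0) hB0
  rw [Finset.sum_range_by_parts]
  have h1 : ‖∑ i ∈ Finset.range (K - 1), (f (i + 1) - f i) • ∑ j ∈ Finset.range (i + 1), z j‖ ≤
      ∑ i ∈ Finset.range (K - 1), (f i - f (i + 1)) * B := by
    refine (norm_sum_le _ _).trans (Finset.sum_le_sum fun i _ => ?_)
    have h2 := hf (Nat.le_succ i)
    rw [norm_smul, Real.norm_eq_abs, abs_sub_comm, abs_of_nonneg (sub_nonneg.2 h2)]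
    exact mul_le_mul_of_nonneg_left (hB _) (sub_nonneg.2 h2)
  rw [← Finset.sum_mul, Finset.sum_range_sub'] at h1
  refine (norm_sub_le _ _).trans ?_
  rw [norm_smul, Real.norm_of_nonneg (hf0 _)]
  have h3 : f (K - 1) * ‖∑ i ∈ Finset.range K, z i‖ ≤ f (K - 1) * B :=
    mul_le_mul_of_nonneg_left (hB _) (hf0 _)
  linarith

lemma norm_geom_le {z : ℂ} (hz : ‖z‖ = 1) (hz1 : z ≠ 1) (a K : ℕ) :
    ‖∑ i ∈ Finset.range K, z ^ (a + i + 1)‖ ≤ 2 / ‖z - 1‖ := by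
  have h1 : ∑ i ∈ Finset.range K, z ^ (a + i + 1) = z ^ (a + 1) * ((z ^ K - 1) / (z - 1)) := by
    rw [← geom_sum_eq hz1, Finset.mul_sum]
    exact Finset.sum_congr rfl fun i _ => by rw [← pow_add]; congr 1; ring
  rw [h1, norm_mul, norm_pow, hz, one_pow, one_mul, norm_div]
  gcongr
  refine (norm_sub_le _ _).trans ?_
  rw [norm_pow, hz]; norm_num

/-- Subtracting `1` does not change the imaginary part, and `z^k - 1` is `z - 1` times a sum of `k`
unimodular numbers. This controls the terms of small index in the sine series. -/
lemma abs_im_pow_le {z : ℂ} (hz : ‖z‖ = 1) (k : ℕ) : |(z ^ k).im| ≤ k * ‖z - 1‖ := by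
  have h1 : ‖z ^ k - 1‖ ≤ k * ‖z - 1‖ := by
    rw [← geom_sum_mul, norm_mul]
    gcongr
    refine (norm_sum_le _ _).trans ?_
    simp [hz]
  have h2 : (z ^ k).im = (z ^ k - 1).im := by simp
  rw [h2]
  exact (Complex.abs_im_le_norm _).trans h1

/-- The partial sums of `∑ Im(z^k)/k` are uniformly bounded on the unit circle. -/
lemma abs_sum_im_pow_div_le {z : ℂ} (hz : ‖z‖ = 1) (K : ℕ) :
    |∑ i ∈ Finset.range K, (1 / ((i : ℝ) + 1)) * (z ^ (i + 1)).im| ≤ 5 := by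
  by_cases hz1 : z = 1
  · simp [hz1]
  set δ := ‖z - 1‖ with hδ
  have hδ0 : 0 < δ := norm_pos_iff.2 (sub_ne_zero.2 hz1)
  have hδ2 : δ ≤ 2 := by
    refine (norm_sub_le _ _).trans ?_
    rw [hz]; norm_num
  have hhead : ∀ L : ℕ, |∑ i ∈ Finset.range L, (1 / ((i : ℝ) + 1)) * (z ^ (i + 1)).im| ≤ L * δ := by
    intro L
    refine (Finset.abs_sum_le_sum_abs _ _).trans ?_
    have : ∀ i ∈ Finset.range L, |(1 / ((i : ℝ) + 1)) * (z ^ (i + 1)).im| ≤ δ := by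
      intro i _
      have h0 : (0 : ℝ) < (i : ℝ) + 1 := by positivity
      have h1 := abs_im_pow_le hz (i + 1)
      rw [abs_mul, abs_of_pos (by positivity), one_div, inv_mul_le_iff₀ h0]
      push_cast at h1
      exact h1
    refine (Finset.sum_le_card_nsmul _ _ _ this).trans ?_
    rw [Finset.card_range, nsmul_eq_mul]
  -- The sum is split at an index of size `1/δ`. Each term of the head is at most `δ`, so the head
  -- is at most `Lδ ≤ 1 + δ ≤ 3`. By Abel's inequality the tail is at most `δ · (2/δ) = 2`. Together
  -- these give the constant `5`.
  set L := ⌈1 / δ⌉₊ with hL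
  have hL1 : (L : ℝ) * δ ≤ 3 := by
    have h1 := Nat.ceil_lt_add_one (a := 1 / δ) (by positivity)
    have h2 : (L : ℝ) * δ ≤ (1 / δ + 1) * δ := by gcongr
    have h3 : (1 / δ + 1) * δ = 1 + δ := by field_simp
    linarith
  rcases le_total K L with hKL | hKL
  · refine (hhead K).trans ?_
    have : (K : ℝ) * δ ≤ L * δ := by gcongr
    linarith
  · obtain ⟨M, rfl⟩ := Nat.exists_eq_add_of_le hKL
    rw [Finset.sum_range_add]
    have htail : |∑ i ∈ Finset.range M, (1 / (((L + i : ℕ) : ℝ) + 1)) * (z ^ (L + i + 1)).im| ≤ 2 := by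
      have h1 := norm_sum_mul_le_of_antitone (f := fun i : ℕ => 1 / (((L + i : ℕ) : ℝ) + 1))
        (fun i j hij => by
          have : ((L + i : ℕ) : ℝ) ≤ ((L + j : ℕ) : ℝ) := by exact_mod_cast (by omega)
          simp only
          gcongr) (fun i => by positivity) (norm_geom_le hz hz1 L) M
      have h2 : ∑ i ∈ Finset.range M, (1 / (((L + i : ℕ) : ℝ) + 1)) * (z ^ (L + i + 1)).im =
          (∑ i ∈ Finset.range M, (1 / (((L + i : ℕ) : ℝ) + 1)) • z ^ (L + i + 1)).im := by
        rw [Complex.im_sum]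
        exact Finset.sum_congr rfl fun i _ => by rw [Complex.smul_im, smul_eq_mul]
      rw [h2]
      refine (Complex.abs_im_le_norm _).trans (h1.trans ?_)
      have h3 : 1 / δ ≤ L := Nat.le_ceil _
      have h4 : (1 / (((L + 0 : ℕ) : ℝ) + 1)) ≤ δ := by
        rw [one_div, inv_le_comm₀ (by positivity) hδ0]
        rw [one_div] at h3
        push_cast
        linarith
      calc _ ≤ δ * (2 / δ) := by gcongr
        _ = 2 := by field_simp
    refine (abs_add_le _ _).trans ?_
    have := hhead L
    linarith

lemma exists_tendsto_sum_im_pow_div {z : ℂ} (hz : ‖z‖ = 1) :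
    ∃ l, Tendsto (fun K : ℕ => ∑ i ∈ Finset.range K, (1 / ((i : ℝ) + 1)) * (z ^ (i + 1)).im)
      atTop (𝓝 l) := by
  by_cases hz1 : z = 1
  · exact ⟨0, by simp [hz1]⟩
  have h1 : CauchySeq fun K : ℕ => ∑ i ∈ Finset.range K, (1 / ((i : ℝ) + 1)) • z ^ (i + 1) := by
    refine Antitone.cauchySeq_series_mul_of_tendsto_zero_of_bounded (b := 2 / ‖z - 1‖) ?_ ?_ ?_
    · intro i j hij
      have : (i : ℝ) ≤ j := by exact_mod_cast hij
      simp only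
      gcongr
    · exact tendsto_one_div_add_atTop_nhds_zero_nat
    · intro K
      simpa using norm_geom_le hz hz1 0 K
  obtain ⟨l, hl⟩ := cauchySeq_tendsto_of_complete h1
  refine ⟨l.im, ((Complex.continuous_im.tendsto l).comp hl).congr fun K => ?_⟩
  simp only [Function.comp_apply]
  rw [Complex.im_sum]
  exact Finset.sum_congr rfl fun i _ => by rw [Complex.smul_im, smul_eq_mul]

/-! ### The one-variable Bernoulli series -/

/-- Symmetric partial sums of `∑_{k ≠ 0} (2πik)^{-m} e(kt)`. -/
def bernPartial (m K : ℕ) (t : ℝ) : ℂ :=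
  ∑ k ∈ (Finset.Icc (-(K : ℤ)) K).erase 0,
    (1 / (2 * (Real.pi : ℂ) * Complex.I * (k : ℂ))) ^ m * ee (k * t)

lemma bernPartial_eq (m K : ℕ) (t : ℝ) :
    bernPartial m K t = ∑ i ∈ Finset.range K,
      (1 / (2 * (Real.pi : ℂ) * Complex.I * ((i : ℂ) + 1))) ^ m *
        (ee ((i + 1) * t) + (-1) ^ m * ee (-((i + 1) * t))) := by
  induction K with
  | zero => simp [bernPartial]
  | succ K ih =>
    have hset : (Finset.Icc (-((K + 1 : ℕ) : ℤ)) ((K + 1 : ℕ) : ℤ)).erase 0 =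
        insert ((K : ℤ) + 1) (insert (-((K : ℤ) + 1)) ((Finset.Icc (-(K : ℤ)) K).erase 0)) := by
      ext k
      simp only [Finset.mem_erase, Finset.mem_Icc, Finset.mem_insert]
      omega
    rw [bernPartial, hset, Finset.sum_insert, Finset.sum_insert, ← bernPartial, ih,
      Finset.sum_range_succ]
    · have h1 : (1 / (2 * (Real.pi : ℂ) * Complex.I * ((-((K : ℤ) + 1) : ℤ) : ℂ))) =
          (-1) * (1 / (2 * (Real.pi : ℂ) * Complex.I * ((K : ℂ) + 1))) := by
        push_cast
        rw [mul_neg, div_neg, neg_one_mul]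
      rw [h1, mul_pow]
      push_cast
      rw [neg_mul]
      ring
    · simp only [Finset.mem_erase, Finset.mem_Icc]; omega
    · simp only [Finset.mem_erase, Finset.mem_Icc, Finset.mem_insert]; omega

lemma ee_sub_ee_neg (t : ℝ) : ee t - ee (-t) = 2 * Complex.I * ((ee t).im : ℂ) := by
  rw [← conj_ee, Complex.sub_conj]; push_cast; ring

lemma ee_pow (t : ℝ) (k : ℕ) : ee (k * t) = ee t ^ k := by
  induction k with
  | zero => simp
  | succ k ih => rw [pow_succ, ← ih, ← ee_add]; congr 1; push_cast; ring

/-- For `m = 1` the terms `k` and `-k` have coefficients of opposite sign: the cosines cancel and a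
sine series remains. This is why symmetric partial sums converge although the series does not
converge absolutely. -/
lemma bernPartial_one (K : ℕ) (t : ℝ) :
    bernPartial 1 K t = ((Real.pi⁻¹ * ∑ i ∈ Finset.range K,
      (1 / ((i : ℝ) + 1)) * ((ee t) ^ (i + 1)).im : ℝ) : ℂ) := by
  rw [bernPartial_eq]
  push_cast
  rw [Finset.mul_sum]
  refine Finset.sum_congr rfl fun i _ => ?_
  have h0 : ((i : ℂ) + 1) ≠ 0 := by exact_mod_cast i.succ_ne_zero
  have hpi : (Real.pi : ℂ) ≠ 0 := by exact_mod_cast Real.pi_ne_zero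
  have h1 := ee_pow t (i + 1)
  push_cast at h1
  rw [pow_one, pow_one, neg_one_mul, ← sub_eq_add_neg, ee_sub_ee_neg, h1]
  field_simp

lemma norm_bernTerm_le {m : ℕ} (hm : 2 ≤ m) (i : ℕ) (t : ℝ) :
    ‖(1 / (2 * (Real.pi : ℂ) * Complex.I * ((i : ℂ) + 1))) ^ m *
        (ee ((i + 1) * t) + (-1) ^ m * ee (-((i + 1) * t)))‖ ≤ 2 * (1 / ((i : ℝ) + 1) ^ 2) := by
  have h0 : (1 : ℝ) ≤ (i : ℝ) + 1 := by linarith [(Nat.cast_nonneg i : (0 : ℝ) ≤ i)]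
  have h1 : ‖(2 * (Real.pi : ℂ) * Complex.I * ((i : ℂ) + 1))‖ = 2 * Real.pi * ((i : ℝ) + 1) := by
    have : ((i : ℂ) + 1) = (((i : ℝ) + 1 : ℝ) : ℂ) := by push_cast; rfl
    rw [this]
    simp only [norm_mul, Complex.norm_real, Complex.norm_I, Complex.norm_ofNat, mul_one]
    rw [Real.norm_of_nonneg Real.pi_pos.le, Real.norm_of_nonneg (by linarith)]
  have h2 : (i : ℝ) + 1 ≤ 2 * Real.pi * ((i : ℝ) + 1) := by
    nlinarith [Real.pi_gt_three]
  rw [norm_mul, norm_pow, norm_div, norm_one, h1, mul_comm]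
  have h3 : ‖ee ((i + 1) * t) + (-1) ^ m * ee (-((i + 1) * t))‖ ≤ 2 := by
    refine (norm_add_le _ _).trans ?_
    rw [norm_mul, norm_pow, norm_neg, norm_one, one_pow, norm_ee, norm_ee]; norm_num
  have h4 : (1 / (2 * Real.pi * ((i : ℝ) + 1))) ^ m ≤ 1 / ((i : ℝ) + 1) ^ 2 := by
    calc (1 / (2 * Real.pi * ((i : ℝ) + 1))) ^ m ≤ (1 / ((i : ℝ) + 1)) ^ m := by
          gcongr
      _ ≤ (1 / ((i : ℝ) + 1)) ^ 2 := by
          refine pow_le_pow_of_le_one (by positivity) ?_ hm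
          rw [div_le_one (by linarith)]; exact h0
      _ = _ := by rw [div_pow, one_pow]
  gcongr

lemma summable_one_div_succ_sq : Summable fun i : ℕ => 2 * (1 / ((i : ℝ) + 1) ^ 2) := by
  have h := (summable_nat_add_iff 1).2 (Real.summable_one_div_nat_pow.2 (one_lt_two))
  refine (h.mul_left 2).congr fun i => ?_
  push_cast; ring

/-- For `m ≥ 2` absolute convergence suffices. For `m = 1` the bound is that of the sine series,
uniform in `t` although the convergence is not. Uniformity is what later allows dominated
convergence for the partial sums. -/
lemma exists_norm_bernPartial_le {m : ℕ} (hm : 1 ≤ m) :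
    ∃ C, ∀ K t, ‖bernPartial m K t‖ ≤ C := by
  rcases hm.eq_or_lt with rfl | hm
  · refine ⟨Real.pi⁻¹ * 5, fun K t => ?_⟩
    rw [bernPartial_one, Complex.norm_real, norm_mul, Real.norm_of_nonneg (by positivity)]
    gcongr
    exact abs_sum_im_pow_div_le (norm_ee t) K
  · refine ⟨∑' i : ℕ, 2 * (1 / ((i : ℝ) + 1) ^ 2), fun K t => ?_⟩
    rw [bernPartial_eq]
    refine (norm_sum_le _ _).trans ((Finset.sum_le_sum fun i _ => norm_bernTerm_le hm i t).trans ?_)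
    exact summable_one_div_succ_sq.sum_le_tsum _ fun i _ => by positivity

lemma exists_tendsto_bernPartial {m : ℕ} (hm : 1 ≤ m) (t : ℝ) :
    ∃ l, Tendsto (fun K => bernPartial m K t) atTop (𝓝 l) := by
  rcases hm.eq_or_lt with rfl | hm
  · obtain ⟨l, hl⟩ := exists_tendsto_sum_im_pow_div (norm_ee t)
    refine ⟨((Real.pi⁻¹ * l : ℝ) : ℂ), ?_⟩
    simp_rw [bernPartial_one]
    exact (Complex.continuous_ofReal.tendsto _).comp (hl.const_mul _)
  · have h : Summable fun i : ℕ => (1 / (2 * (Real.pi : ℂ) * Complex.I * ((i : ℂ) + 1))) ^ m *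
        (ee ((i + 1) * t) + (-1) ^ m * ee (-((i + 1) * t))) :=
      Summable.of_norm_bounded summable_one_div_succ_sq fun i => norm_bernTerm_le hm i t
    refine ⟨_, h.hasSum.tendsto_sum_nat.congr fun K => ?_⟩
    rw [bernPartial_eq]

/-! ### Reduction to one variable, Fourier coefficients and orthogonality -/

/-- The frequencies in the partial sums of a Bernoulli spline. -/
def bernSet (V : Fin n → Fin d → ℤ) (U : Finset (Fin n)) (N : ℕ) : Finset (Fin d → ℤ) :=
  (Finset.Icc (fun _ => -(N : ℤ)) (fun _ => (N : ℤ)) : Finset (Fin d → ℤ)).filter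
      (fun α => α ≠ 0 ∧ ∀ i ∈ Uᶜ, V i ⬝ᵥ α = 0)

/-- The Fourier coefficients of a Bernoulli spline. -/
def bernCoeff (V : Fin n → Fin d → ℤ) (U : Finset (Fin n)) (α : Fin d → ℤ) : ℂ :=
  ∏ i ∈ U, 1 / (2 * (Real.pi : ℂ) * Complex.I * ((α ⬝ᵥ V i : ℤ) : ℂ))

lemma bernoulliPartial_eq (U : Finset (Fin n)) (N : ℕ) (x : Fin d → ℝ) :
    bernoulliPartial V U N x = ∑ α ∈ bernSet V U N, bernCoeff V U α * ee (toReal α ⬝ᵥ x) := by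
  unfold bernoulliPartial bernSet bernCoeff ee
  refine Finset.sum_congr (by congr) fun _ _ => rfl

lemma activeSet_of_mem_bernSet (hV : Admissible V) (hU : Unimodular V) {U : Finset (Fin n)}
    (hUL : U ∈ Lam V) {N : ℕ} {α : Fin d → ℤ} (hα : α ∈ bernSet V U N) :
    α ≠ 0 ∧ activeSet V α = U := by
  obtain ⟨-, h0, h1⟩ := Finset.mem_filter.1 hα
  refine ⟨h0, (activeSet_eq_iff hV hU hUL h0).2 fun i hi => ?_⟩
  rw [dotProduct_comm]; exact h1 i (by simpa using hi)

lemma mem_bernSet (hV : Admissible V) (hU : Unimodular V) {U : Finset (Fin n)}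
    (hUL : U ∈ Lam V) {α : Fin d → ℤ} (h0 : α ≠ 0) (hα : activeSet V α = U) :
    ∀ᶠ N in atTop, α ∈ bernSet V U N := by
  have h1 := (activeSet_eq_iff hV hU hUL h0).1 hα
  filter_upwards [eventually_ge_atTop (∑ j, (α j).natAbs)] with N hN
  refine Finset.mem_filter.2 ⟨?_, h0, fun i hi => ?_⟩
  · rw [Finset.mem_Icc, Pi.le_def, Pi.le_def, ← forall_and]
    intro j
    have := Finset.single_le_sum (f := fun j => (α j).natAbs) (fun _ _ => Nat.zero_le _)
      (Finset.mem_univ j)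
    omega
  · rw [dotProduct_comm]; exact h1 i (by simpa using hi)

/-- A Bernoulli spline is a one-variable Bernoulli series along the normal direction. -/
lemma exists_bernoulliPartial_eq (hV : Admissible V) (hU : Unimodular V) {U : Finset (Fin n)}
    (hUL : U ∈ Lam V) : ∃ (a : Fin d → ℤ) (ε : ℂ) (A : ℕ), a ≠ 0 ∧ 0 < A ∧
      (∀ i ∈ U, a ⬝ᵥ V i ≠ 0) ∧ activeSet V a = U ∧ ∀ N x,
      bernoulliPartial V U N x = ε * bernPartial (rho V + 1) (N / A) (toReal a ⬝ᵥ x) := by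
  obtain ⟨a, ha0, ha1, haU, hk⟩ := exists_normal hV hU hUL
  -- With `A` the largest modulus of a coordinate of `a`, the multiple `k a` lies in the box of
  -- radius `N` exactly when `|k| ≤ N / A` in integer division. Box partial sums of the spline are
  -- therefore symmetric partial sums in one variable.
  set A : ℕ := Finset.univ.sup fun j => (a j).natAbs with hA
  have hA0 : 0 < A := by
    obtain ⟨j, hj⟩ := Function.ne_iff.1 ha0
    refine lt_of_lt_of_le (Int.natAbs_pos.2 hj) ?_
    exact Finset.le_sup (f := fun j => (a j).natAbs) (Finset.mem_univ j)
  -- The factor `ε` is `±1`, because `a·v = ±1` on `U`; the remaining powers of `k` come from the `ϱ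
  -- + 1` members of `U`.
  refine ⟨a, ∏ i ∈ U, 1 / ((a ⬝ᵥ V i : ℤ) : ℂ), A, ha0, hA0, fun i hi h0 => ?_,
    (activeSet_eq_iff hV hU hUL ha0).2 haU, fun N x => ?_⟩
  · have := ha1 i hi; rw [h0] at this; simp at this
  have hset : bernSet V U N =
      ((Finset.Icc (-((N / A : ℕ) : ℤ)) ((N / A : ℕ) : ℤ)).erase 0).image fun k => k • a := by
    ext α
    simp only [bernSet, Finset.mem_filter, Finset.mem_image, Finset.mem_erase, Finset.mem_Icc]
    have hbox : ∀ k : ℤ, ((fun _ => -(N : ℤ)) ≤ k • a ∧ k • a ≤ fun _ => (N : ℤ)) ↔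
        (-((N / A : ℕ) : ℤ) ≤ k ∧ k ≤ ((N / A : ℕ) : ℤ)) := by
      intro k
      have h1 : (-((N / A : ℕ) : ℤ) ≤ k ∧ k ≤ ((N / A : ℕ) : ℤ)) ↔ k.natAbs ≤ N / A := by omega
      rw [h1, Nat.le_div_iff_mul_le hA0, Pi.le_def, Pi.le_def, ← forall_and]
      have h2 : ∀ j, ((-(N : ℤ) ≤ (k • a) j ∧ (k • a) j ≤ (N : ℤ)) ↔
          k.natAbs * (a j).natAbs ≤ N) := by
        intro j
        rw [← Int.natAbs_mul, Pi.smul_apply, smul_eq_mul]; omega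
      simp_rw [h2]
      constructor
      · intro h
        obtain ⟨j, -, hj⟩ := Finset.exists_mem_eq_sup Finset.univ
          (by obtain ⟨j, -⟩ := Function.ne_iff.1 ha0; exact ⟨j, Finset.mem_univ j⟩)
          (fun j => (a j).natAbs)
        rw [hA, hj]; exact h j
      · intro h j
        exact (Nat.mul_le_mul_left _ (Finset.le_sup (f := fun j => (a j).natAbs)
          (Finset.mem_univ j))).trans h
    constructor
    · rintro ⟨hN, h0, hα⟩
      obtain ⟨k, rfl⟩ := hk α fun i hi => by
        rw [dotProduct_comm]; exact hα i (by simpa using hi)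
      exact ⟨k, ⟨by rintro rfl; simp at h0, (hbox k).1 hN⟩, rfl⟩
    · rintro ⟨k, ⟨hk0, hkN⟩, rfl⟩
      refine ⟨(hbox k).2 hkN, smul_ne_zero hk0 ha0, fun i hi => ?_⟩
      rw [dotProduct_smul, dotProduct_comm, haU i (by simpa using hi), smul_zero]
  rw [bernoulliPartial_eq, hset, Finset.sum_image
    (fun k _ l _ h => smul_left_injective ℤ ha0 h), bernPartial, Finset.mul_sum]
  refine Finset.sum_congr rfl fun k _ => ?_
  have h1 : toReal (k • a) ⬝ᵥ x = k * (toReal a ⬝ᵥ x) := by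
    have : toReal (k • a) = (k : ℝ) • toReal a := by ext j; simp [toReal]
    rw [this, smul_dotProduct, smul_eq_mul]
  rw [h1, ← mul_assoc]
  congr 1
  rw [bernCoeff, ← (mem_Lam.1 hUL).1, ← Finset.prod_const, ← Finset.prod_mul_distrib]
  refine Finset.prod_congr rfl fun i _ => ?_
  rw [smul_dotProduct, smul_eq_mul]
  push_cast
  rw [div_mul_div_comm, one_mul]
  congr 1; ring

lemma exists_norm_bernoulliPartial_le (hV : Admissible V) (hU : Unimodular V)
    {U : Finset (Fin n)} (hUL : U ∈ Lam V) : ∃ C, ∀ N x, ‖bernoulliPartial V U N x‖ ≤ C := by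
  obtain ⟨a, ε, A, -, -, -, -, h⟩ := exists_bernoulliPartial_eq hV hU hUL
  obtain ⟨C, hC⟩ := exists_norm_bernPartial_le (m := rho V + 1) (by omega)
  refine ⟨‖ε‖ * C, fun N x => ?_⟩
  rw [h, norm_mul]
  gcongr
  exact hC _ _

lemma tendsto_bernoulliPartial (hV : Admissible V) (hU : Unimodular V)
    {U : Finset (Fin n)} (hUL : U ∈ Lam V) (x : Fin d → ℝ) :
    Tendsto (fun N => bernoulliPartial V U N x) atTop (𝓝 (bernoulliSpline V U x)) := by
  obtain ⟨a, ε, A, -, hA, -, -, h⟩ := exists_bernoulliPartial_eq hV hU hUL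
  obtain ⟨l, hl⟩ := exists_tendsto_bernPartial (m := rho V + 1) (by omega) (toReal a ⬝ᵥ x)
  refine tendsto_nhds_limUnder ⟨ε * l, ?_⟩
  simp_rw [h]
  exact (hl.comp (Nat.tendsto_div_const_atTop hA.ne')).const_mul ε

@[fun_prop]
lemma continuous_bernoulliPartial (U : Finset (Fin n)) (N : ℕ) :
    Continuous (bernoulliPartial V U N) := by
  have : bernoulliPartial V U N = fun x => ∑ α ∈ bernSet V U N,
      bernCoeff V U α * ee (toReal α ⬝ᵥ x) := by
    ext x; exact bernoulliPartial_eq U N x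
  rw [this]; fun_prop

lemma measurable_bernoulliSpline (hV : Admissible V) (hU : Unimodular V)
    {U : Finset (Fin n)} (hUL : U ∈ Lam V) : Measurable (bernoulliSpline V U) :=
  measurable_of_tendsto_metrizable (fun N => (continuous_bernoulliPartial U N).measurable)
    (tendsto_pi_nhds.2 fun x => tendsto_bernoulliPartial hV hU hUL x)

lemma exists_norm_bernoulliSpline_le (hV : Admissible V) (hU : Unimodular V)
    {U : Finset (Fin n)} (hUL : U ∈ Lam V) : ∃ C, ∀ x, ‖bernoulliSpline V U x‖ ≤ C := by
  obtain ⟨C, hC⟩ := exists_norm_bernoulliPartial_le hV hU hUL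
  exact ⟨C, fun x => le_of_tendsto' (tendsto_bernoulliPartial hV hU hUL x).norm fun N => hC N x⟩

lemma bernoulliSpline_add_int (U : Finset (Fin n)) (x : Fin d → ℝ) (γ : Fin d → ℤ) :
    bernoulliSpline V U (x + toReal γ) = bernoulliSpline V U x := by
  unfold bernoulliSpline
  congr 1
  ext N
  rw [bernoulliPartial_eq, bernoulliPartial_eq]
  refine Finset.sum_congr rfl fun α _ => ?_
  rw [dotProduct_add, toReal_dotProduct, ee_add, ee_int, mul_one]

lemma memLp_bernoulliSpline (hV : Admissible V) (hU : Unimodular V)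
    {U : Finset (Fin n)} (hUL : U ∈ Lam V) (p : ℝ≥0∞) :
    MemLp (bernoulliSpline V U) p (volume.restrict (cube d)) := by
  obtain ⟨C, hC⟩ := exists_norm_bernoulliSpline_le hV hU hUL
  exact MemLp.of_bound (measurable_bernoulliSpline hV hU hUL).aestronglyMeasurable C
    (ae_of_all _ hC)

lemma integral_cube_ee_mul_ee (α β : Fin d → ℤ) :
    ∫ x in cube d, ee (toReal α ⬝ᵥ x) * ee (-(toReal β ⬝ᵥ x)) = if α = β then 1 else 0 := by
  have h := integral_cube_ee (α - β)
  simp_rw [toReal_sub, sub_dotProduct, ee_sub] at h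
  rw [h]
  simp only [sub_eq_zero]

/-- The Fourier coefficients of the Bernoulli splines. -/
lemma integral_bernoulliSpline_mul_ee (hV : Admissible V) (hU : Unimodular V)
    {U : Finset (Fin n)} (hUL : U ∈ Lam V) (β : Fin d → ℤ) :
    ∫ x in cube d, bernoulliSpline V U x * ee (-(toReal β ⬝ᵥ x)) =
      if β ≠ 0 ∧ activeSet V β = U then bernCoeff V U β else 0 := by
  obtain ⟨C, hC⟩ := exists_norm_bernoulliPartial_le hV hU hUL
  have h1 : Tendsto (fun N => ∫ x in cube d, bernoulliPartial V U N x * ee (-(toReal β ⬝ᵥ x)))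
      atTop (𝓝 (∫ x in cube d, bernoulliSpline V U x * ee (-(toReal β ⬝ᵥ x)))) := by
    refine tendsto_integral_of_dominated_convergence (fun _ => C)
      (fun N => (by fun_prop : Continuous _).aestronglyMeasurable) (integrable_const _)
      (fun N => ae_of_all _ fun x => ?_) (ae_of_all _ fun x => ?_)
    · rw [norm_mul, norm_ee, mul_one]; exact hC N x
    · exact (tendsto_bernoulliPartial hV hU hUL x).mul_const _
  refine tendsto_nhds_unique h1 ?_
  have h2 : ∀ N, ∫ x in cube d, bernoulliPartial V U N x * ee (-(toReal β ⬝ᵥ x)) =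
      if β ∈ bernSet V U N then bernCoeff V U β else 0 := by
    intro N
    simp_rw [bernoulliPartial_eq, Finset.sum_mul, mul_assoc]
    rw [integral_finsetSum _ fun α _ => Continuous.integrableOn_cube (by fun_prop)]
    simp_rw [integral_const_mul, integral_cube_ee_mul_ee]
    simp
  simp_rw [h2]
  split_ifs with h
  · refine tendsto_const_nhds.congr' ?_
    filter_upwards [mem_bernSet hV hU hUL h.1 h.2] with N hN
    rw [if_pos hN]
  · refine tendsto_const_nhds.congr fun N => ?_
    rw [if_neg fun hN => h (activeSet_of_mem_bernSet hV hU hUL hN)]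

/-- The spectra are disjoint: `B(V,U)` has Fourier coefficients only at frequencies with active set
`U`, while those in the partial sums of `B(V,U')` have active set `U'`. The uniform bound on the
partial sums permits the passage to the limit. -/
lemma integral_bernoulliSpline_mul_conj (hV : Admissible V) (hU : Unimodular V)
    {U U' : Finset (Fin n)} (hUL : U ∈ Lam V) (hUL' : U' ∈ Lam V) (hne : U ≠ U') :
    ∫ x in cube d, bernoulliSpline V U x * (starRingEnd ℂ) (bernoulliSpline V U' x) = 0 := by
  obtain ⟨C, hC⟩ := exists_norm_bernoulliPartial_le hV hU hUL'
  obtain ⟨C', hC'⟩ := exists_norm_bernoulliSpline_le hV hU hUL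
  have hm := measurable_bernoulliSpline hV hU hUL
  have h1 : Tendsto (fun N => ∫ x in cube d,
      bernoulliSpline V U x * (starRingEnd ℂ) (bernoulliPartial V U' N x)) atTop
      (𝓝 (∫ x in cube d, bernoulliSpline V U x * (starRingEnd ℂ) (bernoulliSpline V U' x))) := by
    refine tendsto_integral_of_dominated_convergence (fun _ => C' * C)
      (fun N => hm.aestronglyMeasurable.mul (Complex.continuous_conj.comp
        (continuous_bernoulliPartial U' N)).aestronglyMeasurable) (integrable_const _)
      (fun N => ae_of_all _ fun x => ?_) (ae_of_all _ fun x => ?_)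
    · rw [norm_mul, RCLike.norm_conj]
      exact mul_le_mul (hC' x) (hC N x) (norm_nonneg _) ((norm_nonneg _).trans (hC' x))
    · exact ((Complex.continuous_conj.tendsto _).comp
        (tendsto_bernoulliPartial hV hU hUL' x)).const_mul _
  refine tendsto_nhds_unique h1 (tendsto_const_nhds.congr fun N => ?_)
  have h2 : ∀ x, bernoulliSpline V U x * (starRingEnd ℂ) (bernoulliPartial V U' N x) =
      ∑ α ∈ bernSet V U' N, (starRingEnd ℂ) (bernCoeff V U' α) *
        (bernoulliSpline V U x * ee (-(toReal α ⬝ᵥ x))) := by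
    intro x
    rw [bernoulliPartial_eq, map_sum, Finset.mul_sum]
    refine Finset.sum_congr rfl fun α _ => ?_
    rw [map_mul, conj_ee]; ring
  simp_rw [h2]
  have h3 : ∀ α : Fin d → ℤ, IntegrableOn (fun x => bernoulliSpline V U x *
      ee (-(toReal α ⬝ᵥ x))) (cube d) := fun α =>
    Measure.integrableOn_of_bounded (M := C') (by simp [volume_cube])
      (hm.mul (by fun_prop)).aestronglyMeasurable
      (ae_of_all _ fun x => by rw [norm_mul, norm_ee, mul_one]; exact hC' x)
  rw [integral_finsetSum _ fun α _ => (h3 α).const_mul _]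
  symm
  refine Finset.sum_eq_zero fun α hα => ?_
  rw [integral_const_mul, integral_bernoulliSpline_mul_ee hV hU hUL, if_neg, mul_zero]
  rintro ⟨-, h⟩
  exact hne (h.symm.trans (activeSet_of_mem_bernSet hV hU hUL' hα).2)

/-- The Fourier coefficient at the normal vector of `U` is a product of nonzero factors, so `B(V,U)`
is not almost everywhere zero. -/
lemma integral_normSq_bernoulliSpline_pos (hV : Admissible V) (hU : Unimodular V)
    {U : Finset (Fin n)} (hUL : U ∈ Lam V) :
    0 < ∫ x in cube d, ‖bernoulliSpline V U x‖ ^ 2 := by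
  refine lt_of_le_of_ne (integral_nonneg fun x => by positivity) fun h0 => ?_
  symm at h0
  rw [integral_eq_zero_iff_of_nonneg (fun x => by positivity)
    ((memLp_bernoulliSpline hV hU hUL 2).integrable_norm_pow two_ne_zero)] at h0
  obtain ⟨a, ε, A, ha0, -, ha1, haU, -⟩ := exists_bernoulliPartial_eq hV hU hUL
  have h1 := integral_bernoulliSpline_mul_ee hV hU hUL a
  rw [if_pos ⟨ha0, haU⟩] at h1
  have h2 : ∫ x in cube d, bernoulliSpline V U x * ee (-(toReal a ⬝ᵥ x)) = 0 := by
    rw [← integral_zero (μ := volume.restrict (cube d)) (α := Fin d → ℝ) (G := ℂ)]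
    refine integral_congr_ae ?_
    filter_upwards [h0] with x hx
    have : bernoulliSpline V U x = 0 := by simpa using hx
    rw [this, zero_mul]
  rw [h2] at h1
  refine absurd h1.symm (Finset.prod_ne_zero_iff.2 fun i hi => ?_)
  exact one_div_ne_zero (mul_ne_zero Complex.two_pi_I_ne_zero (by exact_mod_cast ha1 i hi))

end

section

/-! ### Uniqueness of Fourier coefficients on the unit cube -/

variable {d n : ℕ} {V : Fin n → Fin d → ℤ}

lemma Ioc_cube_ae_eq :
    ({x : Fin d → ℝ | ∀ i, x i ∈ Set.Ioc ((0 : Fin d → ℝ) i) ((0 : Fin d → ℝ) i + 1)} :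
      Set (Fin d → ℝ)) =ᵐ[volume] cube d := by
  have : {x : Fin d → ℝ | ∀ i, x i ∈ Set.Ioc ((0 : Fin d → ℝ) i) ((0 : Fin d → ℝ) i + 1)} =
      Set.pi Set.univ fun _ => Set.Ioc (0 : ℝ) 1 := by
    ext x; simp
  rw [this]
  exact Measure.univ_pi_Ioc_ae_eq_Icc (f := fun _ : Fin d => (0 : ℝ)) (g := fun _ => 1)

lemma mFourier_coe (β : Fin d → ℤ) (x : Fin d → ℝ) :
    UnitAddTorus.mFourier β (fun i => (x i : UnitAddCircle)) = ee (toReal β ⬝ᵥ x) := by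
  rw [dotProduct, ee_sum]
  simp only [UnitAddTorus.mFourier, ContinuousMap.coe_mk]
  refine Finset.prod_congr rfl fun i _ => ?_
  rw [fourier_coe_apply, ee, toReal]
  congr 1
  push_cast
  ring

section

attribute [local instance] instMeasureSpaceUnitAddCircle

/-- A bounded function on the unit cube whose Fourier coefficients vanish is zero. -/
lemma ae_eq_zero_of_fourier {H : (Fin d → ℝ) → ℂ} (hm : Measurable H) {C : ℝ}
    (hC : ∀ x, ‖H x‖ ≤ C)
    (hH : ∀ β : Fin d → ℤ, ∫ x in cube d, H x * ee (-(toReal β ⬝ᵥ x)) = 0) :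
    ∀ᵐ x ∂(volume.restrict (cube d)), H x = 0 := by
  have : IsProbabilityMeasure (volume : Measure UnitAddCircle) :=
    inferInstanceAs (IsProbabilityMeasure AddCircle.haarAddCircle)
  set E := UnitAddTorus.measurableEquivPiIoc (0 : Fin d → ℝ)
  set f : UnitAddTorus (Fin d) → ℂ := fun t => H (E t).1 with hf
  have hfm : Measurable f := hm.comp (measurable_subtype_coe.comp E.measurable)
  have hfx : ∀ x : Fin d → ℝ,
      x ∈ {x : Fin d → ℝ | ∀ i, x i ∈ Set.Ioc ((0 : Fin d → ℝ) i) ((0 : Fin d → ℝ) i + 1)} →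
      f (fun i => (x i : UnitAddCircle)) = H x := by
    intro x hx
    have h1 : (fun i => (x i : UnitAddCircle)) = E.symm ⟨x, hx⟩ := rfl
    rw [hf]
    simp only
    rw [h1, MeasurableEquiv.apply_symm_apply]
  have hset : MeasurableSet
      {x : Fin d → ℝ | ∀ i, x i ∈ Set.Ioc ((0 : Fin d → ℝ) i) ((0 : Fin d → ℝ) i + 1)} :=
    MeasurableSet.univ_pi' fun i => measurableSet_Ioc
  have hfL : MemLp f 2 volume :=
    MemLp.of_bound hfm.aestronglyMeasurable C (ae_of_all _ fun t => hC _)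
  have hcoef : ∀ β, UnitAddTorus.mFourierCoeff (hfL.toLp f) β = 0 := by
    intro β
    have h1 : UnitAddTorus.mFourierCoeff (hfL.toLp f) β = UnitAddTorus.mFourierCoeff f β := by
      refine integral_congr_ae ?_
      filter_upwards [hfL.coeFn_toLp] with t ht
      rw [ht]
    rw [h1, UnitAddTorus.mFourierCoeff_eq_integral f β 0, ← hH β,
      ← setIntegral_congr_set Ioc_cube_ae_eq]
    refine setIntegral_congr_fun hset fun x hx => ?_
    rw [hfx x hx, mFourier_coe, toReal_neg, neg_dotProduct, smul_eq_mul, mul_comm]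
  -- Completeness of the exponentials in `L²` of the torus: the Fourier series converges in norm to
  -- the function, and all its terms vanish.
  have h0 : hfL.toLp f = 0 := by
    have h1 := UnitAddTorus.hasSum_mFourier_series_L2 (hfL.toLp f)
    simp_rw [hcoef, zero_smul] at h1
    exact h1.unique hasSum_zero
  have hf0 : f =ᵐ[volume] 0 := by
    have h1 := hfL.coeFn_toLp
    rw [h0] at h1
    exact h1.symm.trans (Lp.coeFn_zero _ _ _)
  have h2 := UnitAddTorus.lintegral_preimage (fun t => ‖f t‖ₑ) (0 : Fin d → ℝ)
  rw [lintegral_congr_ae (g := fun _ => 0) (by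
    filter_upwards [hf0] with t ht
    rw [ht]; simp), lintegral_zero] at h2
  have h3 : ∫⁻ x in cube d, ‖H x‖ₑ = 0 := by
    rw [← setLIntegral_congr Ioc_cube_ae_eq, h2]
    refine setLIntegral_congr_fun hset fun x hx => ?_
    rw [hfx x hx]
  rw [lintegral_eq_zero_iff hm.enorm] at h3
  filter_upwards [h3] with x hx
  simpa using hx

end

lemma ae_eq_zero_of_periodic {H : (Fin d → ℝ) → ℂ} (hm : Measurable H)
    (hper : ∀ (x : Fin d → ℝ) (γ : Fin d → ℤ), H (x + toReal γ) = H x)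
    (h0 : ∀ᵐ x ∂(volume.restrict (cube d)), H x = 0) : ∀ᵐ x, H x = 0 := by
  have h1 : ∫⁻ x, ‖H x‖ₑ = 0 := by
    rw [lintegral_eq_tsum_cube]
    simp_rw [hper]
    rw [ENNReal.tsum_eq_zero]
    intro _
    rw [lintegral_eq_zero_iff hm.enorm]
    filter_upwards [h0] with x hx
    simp [hx]
  rw [lintegral_eq_zero_iff hm.enorm] at h1
  filter_upwards [h1] with x hx
  simpa using hx

/-! ### Moments of the box spline against exponentials -/

lemma integral_mul_ee {b : ℤ} (hb : b ≠ 0) :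
    ∫ t in (0 : ℝ)..1, (t : ℂ) * ee (-(b * t)) =
      -(1 / (2 * (Real.pi : ℂ) * Complex.I * (b : ℂ))) := by
  have hbR : (-(b : ℝ)) ≠ 0 := by simpa using hb
  have hc := two_pi_I_mul_ne_zero hbR
  set c : ℂ := 2 * (Real.pi : ℂ) * Complex.I * ((-(b : ℝ) : ℝ) : ℂ) with hcdef
  have hd : ∀ t : ℝ, HasDerivAt (fun t : ℝ => (t : ℂ) * ee (-(b : ℝ) * t) / c -
      ee (-(b : ℝ) * t) / c ^ 2) ((t : ℂ) * ee (-(b : ℝ) * t)) t := by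
    intro t
    have h1 : HasDerivAt (fun t : ℝ => (t : ℂ)) 1 t := Complex.ofRealCLM.hasDerivAt (x := t)
    have h2 := hasDerivAt_ee (-(b : ℝ)) t
    rw [← hcdef] at h2
    refine (((h1.mul h2).div_const c).sub (h2.div_const (c ^ 2))).congr_deriv ?_
    field_simp
    ring
  have h := intervalIntegral.integral_eq_sub_of_hasDerivAt (a := 0) (b := 1)
    (fun t _ => hd t) (Continuous.intervalIntegrable (by fun_prop) _ _)
  simp_rw [← neg_mul]
  rw [h]
  have h3 : ee (-(b : ℝ) * 1) = 1 := by
    rw [mul_one, ← Int.cast_neg, ee_int]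
  rw [h3, mul_zero, ee_zero, hcdef]
  push_cast
  have hb' : (b : ℂ) ≠ 0 := by exact_mod_cast hb
  have hpi : (Real.pi : ℂ) ≠ 0 := by exact_mod_cast Real.pi_ne_zero
  field_simp
  simp

lemma integral_ee_neg_int {b : ℤ} (hb : b ≠ 0) : ∫ t in (0 : ℝ)..1, ee (-(b * t)) = 0 := by
  have := integral_ee_int (-b)
  rw [if_neg (by simpa using hb)] at this
  simpa using this

/-- The integrals `∫ (∑ ζ_i u_i)^k e(-∑ b_i u_i) du` over the unit cube, up to the critical
exponent. -/
lemma integral_pow_mul_ee (ζ b : Fin n → ℤ) {k : ℕ}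
    (hk : k ≤ (Finset.univ.filter fun i => b i ≠ 0).card) :
    ∫ u in cube n, (∑ i, (ζ i : ℂ) * (u i : ℂ)) ^ k * ∏ i, ee (-(b i * u i)) =
      if k = (Finset.univ.filter fun i => b i ≠ 0).card then
        k.factorial * ∏ i with b i ≠ 0, ((ζ i : ℂ) *
          -(1 / (2 * (Real.pi : ℂ) * Complex.I * (b i : ℂ)))) else 0 := by
  classical
  set U := Finset.univ.filter fun i => b i ≠ 0 with hU
  have h1 : ∀ u : Fin n → ℝ, (∑ i, (ζ i : ℂ) * (u i : ℂ)) ^ k * ∏ i, ee (-(b i * u i)) =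
      ∑ κ ∈ Finset.piAntidiag Finset.univ k, (Nat.multinomial Finset.univ κ : ℂ) *
        ∏ i, (((ζ i : ℂ) * (u i : ℂ)) ^ κ i * ee (-(b i * u i))) := by
    intro u
    rw [Finset.sum_pow_eq_sum_piAntidiag, Finset.sum_mul]
    refine Finset.sum_congr rfl fun κ _ => ?_
    rw [Finset.prod_mul_distrib, mul_assoc]
  simp_rw [h1]
  rw [integral_finsetSum _ fun κ _ => Continuous.integrableOn_cube (by fun_prop)]
  simp_rw [integral_const_mul,
    fun κ : Fin n → ℕ => integral_cube_prod (fun i t => ((ζ i : ℂ) * (t : ℂ)) ^ κ i *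
      ee (-(b i * t)))]
  -- A variable with `b i ≠ 0` that is absent from the monomial contributes the integral of an
  -- exponential over full periods, which is zero.
  have hzero : ∀ κ : Fin n → ℕ, (∃ i ∈ U, κ i = 0) →
      ∏ i, ∫ t in (0 : ℝ)..1, ((ζ i : ℂ) * (t : ℂ)) ^ κ i * ee (-(b i * t)) = 0 := by
    rintro κ ⟨i, hi, hκ⟩
    refine Finset.prod_eq_zero (Finset.mem_univ i) ?_
    simp_rw [hκ, pow_zero, one_mul]
    exact integral_ee_neg_int (Finset.mem_filter.1 hi).2
  -- A surviving monomial has exponent at least one in each active variable. Since its degree `k` is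
  -- at most their number, it must be the product of the active variables, each to the first power.
  have hone : ∀ κ ∈ Finset.piAntidiag (Finset.univ : Finset (Fin n)) k, (∀ i ∈ U, κ i ≠ 0) →
      k = U.card ∧ κ = fun i => if i ∈ U then 1 else 0 := by
    intro κ hκ hne
    have hsum : ∑ i, κ i = k := (Finset.mem_piAntidiag.1 hκ).1
    have h2 : ∀ i, (if i ∈ U then 1 else 0) ≤ κ i := by
      intro i
      split_ifs with hi
      · exact Nat.one_le_iff_ne_zero.2 (hne i hi)
      · exact Nat.zero_le _
    have h3 : ∑ i, (if i ∈ U then 1 else 0) = U.card := by simp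
    have h4 := Finset.sum_le_sum fun i (_ : i ∈ Finset.univ) => h2 i
    have hkU : k = U.card := by omega
    refine ⟨hkU, ?_⟩
    have h5 := (Finset.sum_eq_sum_iff_of_le fun i (_ : i ∈ Finset.univ) => h2 i).1 (by omega)
    ext i
    exact (h5 i (Finset.mem_univ i)).symm
  split_ifs with hkU
  · rw [Finset.sum_eq_single (fun i => if i ∈ U then 1 else 0)]
    · have h2 : Nat.multinomial Finset.univ (fun i => if i ∈ U then 1 else 0) = k.factorial := by
        rw [Nat.multinomial]
        have h3 : ∑ i, (if i ∈ U then 1 else 0) = k := by simp [hkU]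
        have h4 : ∏ i, (if i ∈ U then 1 else 0).factorial = 1 :=
          Finset.prod_eq_one fun i _ => by split_ifs <;> rfl
        rw [h3, h4, Nat.div_one]
      rw [h2]
      congr 1
      rw [← Finset.prod_subset (Finset.subset_univ U)]
      · refine Finset.prod_congr rfl fun i hi => ?_
        simp_rw [if_pos hi, pow_one, mul_assoc (ζ i : ℂ)]
        rw [intervalIntegral.integral_const_mul, integral_mul_ee (Finset.mem_filter.1 hi).2]
      · intro i _ hi
        have hb : b i = 0 := by simpa [hU] using hi
        simp [if_neg hi, hb]
    · intro κ hκ hne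
      by_cases h : ∃ i ∈ U, κ i = 0
      · rw [hzero κ h, mul_zero]
      · push Not at h
        exact absurd (hone κ hκ h).2 hne
    · intro h
      refine absurd (Finset.mem_piAntidiag.2 ⟨by simp [hkU], by simp⟩) h
  · refine Finset.sum_eq_zero fun κ hκ => ?_
    by_cases h : ∃ i ∈ U, κ i = 0
    · rw [hzero κ h, mul_zero]
    · push Not at h
      exact absurd (hone κ hκ h).1 hkU

end

section

/-! ### Periodized moments of the box spline -/

variable {d n : ℕ} {V : Fin n → Fin d → ℤ}

/-- The power `(w·x)^k` of a linear form. -/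
def ridge (w : Fin d → ℤ) (k : ℕ) (x : Fin d → ℝ) : ℂ := ((toReal w ⬝ᵥ x : ℝ) : ℂ) ^ k

@[fun_prop]
lemma continuous_ridge (w : Fin d → ℤ) (k : ℕ) : Continuous (ridge w k) := by
  unfold ridge; fun_prop

lemma norm_ridge_le (w : Fin d → ℤ) (k : ℕ) (x : Fin d → ℝ) :
    ‖ridge w k x‖ ≤ ((∑ j, ‖w j‖) * ‖x‖) ^ k := by
  rw [ridge, norm_pow, Complex.norm_real]
  gcongr
  rw [dotProduct, Finset.sum_mul]
  refine (norm_sum_le _ _).trans (Finset.sum_le_sum fun j _ => ?_)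
  rw [norm_mul]
  have h1 : ‖toReal w j‖ = ‖w j‖ := rfl
  rw [h1]
  gcongr
  exact norm_le_pi_norm x j

/-- The sum `∑_α (w·(x - α))^k B_V(x - α)`. -/
def perMoment (V : Fin n → Fin d → ℤ) (w : Fin d → ℤ) (k : ℕ) (x : Fin d → ℝ) : ℂ :=
  bsSum V (fun α => ridge w k (x - toReal α)) x

lemma measurable_perMoment (w : Fin d → ℤ) (k : ℕ) : Measurable (perMoment V w k) := by
  refine Measurable.tsum fun α => ?_
  fun_prop

lemma exists_norm_perMoment_le (w : Fin d → ℤ) (k : ℕ) : ∃ C, ∀ x, ‖perMoment V w k x‖ ≤ C := by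
  refine ⟨nearBound V * ((∑ j, ‖w j‖) * boxRadius V) ^ k, fun x => ?_⟩
  have h0 := boxRadius_nonneg (V := V)
  refine norm_bsSum_le (by positivity) fun α hα => (norm_ridge_le w k _).trans ?_
  rw [mem_near] at hα
  gcongr

lemma perMoment_add_int (w : Fin d → ℤ) (k : ℕ) (x : Fin d → ℝ) (γ : Fin d → ℤ) :
    perMoment V w k (x + toReal γ) = perMoment V w k x := by
  rw [perMoment, perMoment, bsSum, bsSum, ← (Equiv.addRight γ).tsum_eq]
  refine tsum_congr fun α => ?_
  rw [Equiv.coe_addRight, toReal_add, add_sub_add_right_eq_sub]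

/-- The mean of `(w·x)^k` with respect to the box spline. -/
def boxMoment (V : Fin n → Fin d → ℤ) (w : Fin d → ℤ) (k : ℕ) : ℂ :=
  ∫ u in cube n, (∑ i, ((w ⬝ᵥ V i : ℤ) : ℂ) * (u i : ℂ)) ^ k

lemma ridge_boxMap (w : Fin d → ℤ) (k : ℕ) (u : Fin n → ℝ) :
    ridge w k (boxMap V u) = (∑ i, ((w ⬝ᵥ V i : ℤ) : ℂ) * (u i : ℂ)) ^ k := by
  rw [ridge, dotProduct_boxMap]
  push_cast
  congr 1
  refine Finset.sum_congr rfl fun i _ => ?_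
  rw [toReal_dotProduct, dotProduct_comm, Complex.ofReal_intCast]

/-- The sum over translates unfolds to an integral over `ℝ^d` against `B_V`, where the defining
property of the box spline turns it into an integral over `[0,1]^n`. -/
lemma integral_perMoment_mul_ee (hV : Admissible V) (hU : Unimodular V) (w β : Fin d → ℤ) (k : ℕ) :
    ∫ x in cube d, perMoment V w k x * ee (-(toReal β ⬝ᵥ x)) =
      ∫ u in cube n, (∑ i, ((w ⬝ᵥ V i : ℤ) : ℂ) * (u i : ℂ)) ^ k *
        ∏ i, ee (-(((β ⬝ᵥ V i : ℤ) : ℝ) * u i)) := by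
  set G : (Fin d → ℝ) → ℂ := fun x => ridge w k x * ee (-(toReal β ⬝ᵥ x)) with hG
  have hGc : Continuous G := by fun_prop
  have hF : Integrable fun x => G x * ((bs V x : ℝ) : ℂ) := by
    have := LocallyIntegrable.mul_bs (V := V) hGc.locallyIntegrable 0
    simpa using this
  have h1 := integral_cube_tsum hF
  rw [integral_mul_bs hV hU hGc.aestronglyMeasurable] at h1
  have h2 : ∀ x, ∑' α : Fin d → ℤ, G (x - toReal α) * ((bs V (x - toReal α) : ℝ) : ℂ) =
      perMoment V w k x * ee (-(toReal β ⬝ᵥ x)) := by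
    intro x
    rw [perMoment, bsSum, ← tsum_mul_right]
    refine tsum_congr fun α => ?_
    rw [hG]
    simp only
    have h3 : -(toReal β ⬝ᵥ (x - toReal α)) = -(toReal β ⬝ᵥ x) + ((β ⬝ᵥ α : ℤ) : ℝ) := by
      rw [dotProduct_sub, toReal_dotProduct]; ring
    rw [h3, ee_add, ee_int]
    ring
  simp_rw [h2] at h1
  rw [h1]
  congr 1
  ext u
  rw [hG]
  simp only
  rw [ridge_boxMap, dotProduct_boxMap, ← Finset.sum_neg_distrib, ee_sum]
  congr 1
  refine Finset.prod_congr rfl fun i _ => ?_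
  rw [toReal_dotProduct, dotProduct_comm]

/-- The combination `∑_U ∏_{v ∈ U} (w·v) B(V,U)`. -/
def bernSum (V : Fin n → Fin d → ℤ) (w : Fin d → ℤ) (x : Fin d → ℝ) : ℂ :=
  ∑ U ∈ Lam V, (∏ i ∈ U, ((w ⬝ᵥ V i : ℤ) : ℂ)) * bernoulliSpline V U x

lemma measurable_bernSum (hV : Admissible V) (hU : Unimodular V) (w : Fin d → ℤ) :
    Measurable (bernSum V w) := by
  unfold bernSum
  exact Finset.measurable_fun_sum _ fun U hUL => (measurable_bernoulliSpline hV hU hUL).const_mul _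

lemma exists_norm_bernSum_le (hV : Admissible V) (hU : Unimodular V) (w : Fin d → ℤ) :
    ∃ C, ∀ x, ‖bernSum V w x‖ ≤ C := by
  have h : ∀ U : Finset (Fin n), ∃ C, U ∈ Lam V → ∀ x, ‖bernoulliSpline V U x‖ ≤ C := by
    intro U
    by_cases hUL : U ∈ Lam V
    · obtain ⟨C, hC⟩ := exists_norm_bernoulliSpline_le hV hU hUL
      exact ⟨C, fun _ => hC⟩
    · exact ⟨0, fun h => absurd h hUL⟩
  choose C hC using h
  refine ⟨∑ U ∈ Lam V, ‖∏ i ∈ U, ((w ⬝ᵥ V i : ℤ) : ℂ)‖ * C U, fun x => ?_⟩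
  refine (norm_sum_le _ _).trans (Finset.sum_le_sum fun U hUL => ?_)
  rw [norm_mul]
  gcongr
  exact hC U hUL x

lemma bernSum_add_int (w : Fin d → ℤ) (x : Fin d → ℝ) (γ : Fin d → ℤ) :
    bernSum V w (x + toReal γ) = bernSum V w x := by
  simp only [bernSum, bernoulliSpline_add_int]

lemma integral_bernSum_mul_ee (hV : Admissible V) (hU : Unimodular V) (w β : Fin d → ℤ) :
    ∫ x in cube d, bernSum V w x * ee (-(toReal β ⬝ᵥ x)) =
      if β ≠ 0 ∧ activeSet V β ∈ Lam V then
        (∏ i ∈ activeSet V β, ((w ⬝ᵥ V i : ℤ) : ℂ)) * bernCoeff V (activeSet V β) β else 0 := by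
  simp_rw [bernSum, Finset.sum_mul, mul_assoc]
  rw [integral_finsetSum]
  · simp_rw [integral_const_mul]
    have h1 : ∀ U ∈ Lam V, (∏ i ∈ U, ((w ⬝ᵥ V i : ℤ) : ℂ)) *
        ∫ x in cube d, bernoulliSpline V U x * ee (-(toReal β ⬝ᵥ x)) =
        if U = activeSet V β then (if β ≠ 0 then (∏ i ∈ activeSet V β, ((w ⬝ᵥ V i : ℤ) : ℂ)) *
          bernCoeff V (activeSet V β) β else 0) else 0 := by
      intro U hUL
      rw [integral_bernoulliSpline_mul_ee hV hU hUL]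
      by_cases h : U = activeSet V β
      · subst h
        by_cases hβ : β = 0 <;> simp [hβ]
      · rw [if_neg h, if_neg fun h' => h h'.2.symm, mul_zero]
    rw [Finset.sum_congr rfl h1, Finset.sum_ite_eq']
    by_cases h2 : activeSet V β ∈ Lam V <;> by_cases h3 : β = 0 <;> simp [h2, h3]
  · intro U hUL
    obtain ⟨C, hC⟩ := exists_norm_bernoulliSpline_le hV hU hUL
    refine Integrable.const_mul ?_ _
    refine Measure.integrableOn_of_bounded (M := C) (by simp [volume_cube])
      ((measurable_bernoulliSpline hV hU hUL).mul (by fun_prop)).aestronglyMeasurable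
      (ae_of_all _ fun x => by rw [norm_mul, norm_ee, mul_one]; exact hC x)

/-- The periodized moments are constant below the critical degree, and given by the Bernoulli
splines in the critical degree. -/
lemma perMoment_ae_eq (hV : Admissible V) (hU : Unimodular V) (w : Fin d → ℤ) {k : ℕ}
    (hk : k ≤ rho V + 1) :
    ∀ᵐ x, perMoment V w k x = boxMoment V w k +
      if k = rho V + 1 then (-1) ^ k * k.factorial * bernSum V w x else 0 := by
  set c : ℂ := if k = rho V + 1 then (-1) ^ k * k.factorial else 0 with hc
  set H : (Fin d → ℝ) → ℂ := fun x => perMoment V w k x - boxMoment V w k - c * bernSum V w x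
  have hm1 := measurable_perMoment (V := V) w k
  have hm2 := measurable_bernSum hV hU w
  have hHm : Measurable H := (hm1.sub measurable_const).sub (hm2.const_mul c)
  obtain ⟨C1, hC1⟩ := exists_norm_perMoment_le (V := V) w k
  obtain ⟨C2, hC2⟩ := exists_norm_bernSum_le hV hU w
  have hHb : ∀ x, ‖H x‖ ≤ C1 + ‖boxMoment V w k‖ + ‖c‖ * C2 := by
    intro x
    refine (norm_sub_le _ _).trans (add_le_add ((norm_sub_le _ _).trans
      (add_le_add_left (hC1 x) _)) ?_)
    rw [norm_mul]
    gcongr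
    exact hC2 x
  have hH0 : ∀ x, H x = 0 → perMoment V w k x = boxMoment V w k +
      if k = rho V + 1 then (-1) ^ k * k.factorial * bernSum V w x else 0 := by
    intro x hx
    have h1 : perMoment V w k x = boxMoment V w k + c * bernSum V w x := by
      linear_combination hx
    rw [h1, hc, ite_mul, zero_mul]
  -- The function is bounded and periodic, so it suffices to compare Fourier coefficients. The
  -- frequency `0` accounts for the constant `boxMoment`.
  have key : ∀ᵐ x, H x = 0 := by
    refine ae_eq_zero_of_periodic hHm (fun x γ => ?_) (ae_eq_zero_of_fourier hHm hHb fun β => ?_)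
    · simp only [H, perMoment_add_int, bernSum_add_int]
    · have hi1 : IntegrableOn (fun x => perMoment V w k x * ee (-(toReal β ⬝ᵥ x))) (cube d) :=
        Measure.integrableOn_of_bounded (M := C1) (by simp [volume_cube])
          (hm1.mul (by fun_prop)).aestronglyMeasurable
          (ae_of_all _ fun x => by rw [norm_mul, norm_ee, mul_one]; exact hC1 x)
      have hi2 : IntegrableOn (fun x => bernSum V w x * ee (-(toReal β ⬝ᵥ x))) (cube d) :=
        Measure.integrableOn_of_bounded (M := C2) (by simp [volume_cube])
          (hm2.mul (by fun_prop)).aestronglyMeasurable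
          (ae_of_all _ fun x => by rw [norm_mul, norm_ee, mul_one]; exact hC2 x)
      have hi3 : IntegrableOn (fun x : Fin d → ℝ => boxMoment V w k * ee (-(toReal β ⬝ᵥ x)))
          (cube d) := Continuous.integrableOn_cube (by fun_prop)
      have hexp : ∀ x, H x * ee (-(toReal β ⬝ᵥ x)) =
          perMoment V w k x * ee (-(toReal β ⬝ᵥ x)) - boxMoment V w k * ee (-(toReal β ⬝ᵥ x)) -
            c * (bernSum V w x * ee (-(toReal β ⬝ᵥ x))) := by
        intro x; simp only [H]; ring
      simp_rw [hexp]
      have hee := integral_cube_ee (-β)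
      simp only [toReal_neg, neg_dotProduct, neg_eq_zero] at hee
      have hi13 : IntegrableOn (fun x => perMoment V w k x * ee (-(toReal β ⬝ᵥ x)) -
          boxMoment V w k * ee (-(toReal β ⬝ᵥ x))) (cube d) := hi1.sub hi3
      rw [integral_sub hi13 (hi2.const_mul c), integral_sub hi1 hi3, integral_const_mul,
        integral_const_mul, integral_bernSum_mul_ee hV hU, hee,
        integral_perMoment_mul_ee hV hU]
      by_cases hβ : β = 0
      · subst hβ
        simp [boxMoment]
      -- For a nonzero frequency the active set has at least `ϱ + 1 ≥ k` members, which is the range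
      -- covered by `integral_pow_mul_ee`. A contribution arises only for `k = ϱ + 1` and an active
      -- set in `Λ`; the factor `(-1)^k` collects the signs of the one-variable integrals.
      · have hcard := rho_lt_card_activeSet hV hβ
        have hact : (Finset.univ.filter fun i => β ⬝ᵥ V i ≠ 0) = activeSet V β := rfl
        have h1 := integral_pow_mul_ee (fun i => w ⬝ᵥ V i) (fun i => β ⬝ᵥ V i) (k := k)
          (by rw [hact]; omega)
        rw [hact] at h1
        rw [h1, if_neg hβ, mul_zero, sub_zero]
        by_cases hk1 : k = rho V + 1
        · by_cases hcard1 : (activeSet V β).card = rho V + 1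
          · rw [if_pos (hk1.trans hcard1.symm), if_pos ⟨hβ, activeSet_mem_Lam hβ hcard1⟩, hc,
              if_pos hk1, bernCoeff, Finset.prod_mul_distrib, Finset.prod_neg, hcard1, ← hk1]
            ring
          · rw [if_neg (by omega), if_neg fun h => hcard1 (mem_Lam.1 h.2).1]
            simp
        · rw [if_neg (by omega), hc, if_neg hk1]
          simp
  filter_upwards [key] with x hx
  exact hH0 x hx

end

section

/-! ### The projection of powers of linear forms -/

variable {d n : ℕ} {V : Fin n → Fin d → ℤ}

lemma slowGrowth_ridge (w : Fin d → ℤ) (k : ℕ) : SlowGrowth (ridge w k) := by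
  refine slowGrowth_of_norm_le (continuous_ridge w k).aestronglyMeasurable
    (C := (∑ j, ‖w j‖) ^ k) (N := k) (by positivity) fun x => ?_
  refine (norm_ridge_le w k x).trans ?_
  rw [mul_pow]
  gcongr
  linarith

lemma slowGrowth_of_bounded {g : (Fin d → ℝ) → ℂ} (hm : Measurable g) {C : ℝ}
    (hC : ∀ x, ‖g x‖ ≤ C) : SlowGrowth g :=
  slowGrowth_of_norm_le hm.aestronglyMeasurable (N := 0) ((norm_nonneg _).trans (hC 0))
    fun x => by simpa using hC x

/-- The binomial expansion of `w·α = w·x - w·(x - α)`, which brings in the periodized moments. -/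
lemma bsSum_ridge (w : Fin d → ℤ) (k : ℕ) (x : Fin d → ℝ) :
    bsSum V (fun α => ridge w k (toReal α)) x = ∑ j ∈ Finset.range (k + 1),
      ((-1) ^ j * (k.choose j : ℂ)) * (ridge w (k - j) x * perMoment V w j x) := by
  simp only [perMoment, bsSum_eq_sum _ (le_refl (near V x)), Finset.mul_sum]
  rw [Finset.sum_comm]
  refine Finset.sum_congr rfl fun α _ => ?_
  have h1 : ridge w k (toReal α) =
      (-((toReal w ⬝ᵥ (x - toReal α) : ℝ) : ℂ) + ((toReal w ⬝ᵥ x : ℝ) : ℂ)) ^ k := by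
    rw [ridge, dotProduct_sub]
    push_cast
    ring
  rw [h1, add_pow, Finset.sum_mul]
  refine Finset.sum_congr rfl fun j _ => ?_
  rw [neg_pow, ridge, ridge]
  ring

/-- The Bernoulli splines are orthogonal to the translates of the box spline. -/
lemma moment_bernoulliSpline (hV : Admissible V) (hU : Unimodular V) {U : Finset (Fin n)}
    (hUL : U ∈ Lam V) (β : Fin d → ℤ) : moment V (bernoulliSpline V U) β = 0 := by
  obtain ⟨C, hC⟩ := exists_norm_bernoulliPartial_le hV hU hUL
  have h1 : Tendsto (fun N => ∫ x, bernoulliPartial V U N x * ((bs V (x - toReal β) : ℝ) : ℂ))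
      atTop (𝓝 (moment V (bernoulliSpline V U) β)) := by
    refine tendsto_integral_of_dominated_convergence (fun x => C * bs V (x - toReal β))
      (fun N => ?_) ?_ (fun N => ae_of_all _ fun x => ?_) (ae_of_all _ fun x => ?_)
    · exact ((continuous_bernoulliPartial U N).measurable.mul (by fun_prop)).aestronglyMeasurable
    · exact (integrable_bs.comp_sub_right _).const_mul C
    · rw [norm_mul, Complex.norm_real, Real.norm_of_nonneg (bs_nonneg _)]
      exact mul_le_mul_of_nonneg_right (hC N x) (bs_nonneg _)
    · exact (tendsto_bernoulliPartial hV hU hUL x).mul_const _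
  have h2 : ∀ N, ∫ x, bernoulliPartial V U N x * ((bs V (x - toReal β) : ℝ) : ℂ) = 0 := by
    intro N
    simp_rw [bernoulliPartial_eq, Finset.sum_mul]
    rw [integral_finsetSum]
    · refine Finset.sum_eq_zero fun α hα => ?_
      obtain ⟨hα0, hact⟩ := activeSet_of_mem_bernSet hV hU hUL hα
      simp_rw [mul_assoc, integral_const_mul]
      rw [← integral_add_right_eq_self _ (toReal β)]
      have h3 : ∀ x : Fin d → ℝ, ee (toReal α ⬝ᵥ (x + toReal β)) *
          ((bs V (x + toReal β - toReal β) : ℝ) : ℂ) =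
          ee (toReal α ⬝ᵥ x) * ((bs V x : ℝ) : ℂ) := by
        intro x
        rw [add_sub_cancel_right, dotProduct_add, toReal_dotProduct, ee_add,
          ee_int, mul_one]
      simp_rw [h3]
      rw [integral_ee_mul_bs hV hU]
      -- A vector `v ∈ U` pairs with the frequency to a nonzero integer, so its factor in the
      -- transform of the box spline vanishes.
      have hne : U.Nonempty := by
        rw [← Finset.card_pos, (mem_Lam.1 hUL).1]; omega
      obtain ⟨i, hi⟩ := hne
      rw [← hact, mem_activeSet] at hi
      rw [Finset.prod_eq_zero (Finset.mem_univ i), mul_zero]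
      rw [toReal_dotProduct, dotProduct_comm, integral_ee_int, if_neg hi]
    · intro α _
      exact LocallyIntegrable.mul_bs (g := fun x => bernCoeff V U α * ee (toReal α ⬝ᵥ x))
        (Continuous.locallyIntegrable (by fun_prop)) β
  simp_rw [h2] at h1
  exact (tendsto_nhds_unique h1 tendsto_const_nhds)

lemma slowGrowth_bernoulliSpline (hV : Admissible V) (hU : Unimodular V) {U : Finset (Fin n)}
    (hUL : U ∈ Lam V) : SlowGrowth (bernoulliSpline V U) :=
  (exists_norm_bernoulliSpline_le hV hU hUL).elim fun _ hC =>
    slowGrowth_of_bounded (measurable_bernoulliSpline hV hU hUL) hC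

lemma projFun_bernoulliSpline (hV : Admissible V) (hU : Unimodular V) {U : Finset (Fin n)}
    (hUL : U ∈ Lam V) (x : Fin d → ℝ) : projFun V (bernoulliSpline V U) x = 0 := by
  simp [projFun, bsSum, coef, conv, moment_bernoulliSpline hV hU hUL]

lemma projFun_bernSum (hV : Admissible V) (hU : Unimodular V) (w : Fin d → ℤ) (x : Fin d → ℝ) :
    projFun V (bernSum V w) x = 0 := by
  unfold bernSum
  rw [projFun_finset_sum hV hU _ fun U hUL => (slowGrowth_bernoulliSpline hV hU hUL).const_mul _]
  refine Finset.sum_eq_zero fun U hUL => ?_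
  rw [projFun_const_mul, projFun_bernoulliSpline hV hU hUL, mul_zero]

lemma boxMoment_zero (w : Fin d → ℤ) : boxMoment V w 0 = 1 := by
  simp [boxMoment]

/-- The projection reproduces polynomials of degree at most `ϱ_V`, and in degree `ϱ_V + 1` the
error is a combination of Bernoulli splines. -/
lemma projFun_ridge (hV : Admissible V) (hU : Unimodular V) (w : Fin d → ℤ) (k : ℕ)
    (hk : k ≤ rho V + 1) : projFun V (ridge w k) =ᵐ[volume] fun x => ridge w k x +
      if k = rho V + 1 then k.factorial * bernSum V w x else 0 := by
  induction k using Nat.strong_induction_on with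
  | _ k ih =>
  set a : ℕ → ℂ := fun j => (-1) ^ j * (k.choose j : ℂ) * boxMoment V w j with ha
  set b : ℂ := if k = rho V + 1 then (k.factorial : ℂ) else 0 with hb
  have hm1 : ∀ᵐ x, ∀ j ≤ k, perMoment V w j x = boxMoment V w j +
      if j = rho V + 1 then (-1) ^ j * j.factorial * bernSum V w x else 0 := by
    rw [ae_all_iff]; intro j
    by_cases hj : j ≤ k
    · filter_upwards [perMoment_ae_eq hV hU w (hj.trans hk)] with x hx _ using hx
    · exact ae_of_all _ fun x h => absurd h hj
  -- By the computation of the moments, the spline with coefficients `(w·α)^k` is `(w·x)^k` plus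
  -- lower powers, plus a Bernoulli term when `k = ϱ + 1`. The two signs `(-1)^k`, from the binomial
  -- expansion and from the moment, cancel.
  have hS : bsSum V (fun α => ridge w k (toReal α)) =ᵐ[volume] fun x =>
      (∑ j ∈ Finset.range (k + 1), a j * ridge w (k - j) x) + b * bernSum V w x := by
    filter_upwards [hm1] with x hx
    rw [bsSum_ridge]
    have h1 : ∀ j ∈ Finset.range (k + 1), ((-1) ^ j * (k.choose j : ℂ)) *
        (ridge w (k - j) x * perMoment V w j x) = a j * ridge w (k - j) x +
          if j = k then b * bernSum V w x else 0 := by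
      intro j hj
      rw [Finset.mem_range] at hj
      rw [hx j (by omega)]
      by_cases hjk : j = k
      · subst hjk
        rw [if_pos rfl]
        simp only [ha, hb]
        have h2 : ((-1 : ℂ) ^ j) * (-1) ^ j = 1 := by rw [← mul_pow]; simp
        split_ifs
        · simp only [Nat.choose_self, Nat.cast_one, Nat.sub_self, ridge, pow_zero]
          linear_combination (j.factorial * bernSum V w x) * h2
        · simp only [Nat.choose_self, Nat.cast_one, Nat.sub_self, ridge, pow_zero]
          ring
      · rw [if_neg hjk, if_neg (by omega)]
        simp only [ha]; ring
    rw [Finset.sum_congr rfl h1, Finset.sum_add_distrib, Finset.sum_ite_eq',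
      if_pos (Finset.mem_range.2 (by omega))]
  have hpoly : PolyGrowth fun α : Fin d → ℤ => ridge w k (toReal α) := by
    refine ⟨(∑ j, ‖w j‖) ^ k, k, fun α => (norm_ridge_le w k _).trans ?_⟩
    rw [mul_pow, norm_toReal]
    gcongr
    linarith
  have hsg : ∀ j ∈ Finset.range (k + 1), SlowGrowth fun x => a j * ridge w (k - j) x :=
    fun j _ => (slowGrowth_ridge w _).const_mul _
  obtain ⟨C, hC⟩ := exists_norm_bernSum_le hV hU w
  -- Apply the projection to this identity: the spline on the left is reproduced and the Bernoulli
  -- term on the right is annihilated.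
  have hP : ∀ x, bsSum V (fun α => ridge w k (toReal α)) x =
      ∑ j ∈ Finset.range (k + 1), a j * projFun V (ridge w (k - j)) x := by
    intro x
    rw [← projFun_bsSum hV hU hpoly, projFun_congr hS, projFun_add hV hU
      (SlowGrowth.finset_sum _ hsg)
      ((slowGrowth_of_bounded (measurable_bernSum hV hU w) hC).const_mul b),
      projFun_const_mul, projFun_bernSum hV hU, mul_zero, add_zero, projFun_finset_sum hV hU _ hsg]
    exact Finset.sum_congr rfl fun j _ => projFun_const_mul _ _ _
  have hih : ∀ᵐ x, ∀ j < k, projFun V (ridge w j) x = ridge w j x := by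
    rw [ae_all_iff]; intro j
    by_cases hj : j < k
    · filter_upwards [ih j hj (by omega)] with x hx _
      rw [hx, if_neg (by omega), add_zero]
    · exact ae_of_all _ fun x h => absurd h hj
  filter_upwards [hS, hih] with x hx1 hx2
  rw [hP, Finset.sum_range_succ', Finset.sum_range_succ' _ k] at hx1
  -- By induction the powers below `k` are reproduced. Subtracting the two expressions for the
  -- spline leaves only the term with `j = 0`, which is the error on `(w·x)^k`.
  have h1 : ∑ j ∈ Finset.range k, a (j + 1) * projFun V (ridge w (k - (j + 1))) x =
      ∑ j ∈ Finset.range k, a (j + 1) * ridge w (k - (j + 1)) x := by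
    refine Finset.sum_congr rfl fun j hj => ?_
    rw [Finset.mem_range] at hj
    rw [hx2 _ (by omega)]
  have ha0 : a 0 = 1 := by simp [ha, boxMoment_zero]
  rw [h1, ha0, Nat.sub_zero, one_mul, one_mul] at hx1
  have h2 : (if k = rho V + 1 then (k.factorial : ℂ) * bernSum V w x else 0) =
      b * bernSum V w x := by rw [hb, ite_mul, zero_mul]
  rw [h2]
  linear_combination hx1

end

section

/-! ### Multi-indices and products of linear forms -/

variable {d n : ℕ} {V : Fin n → Fin d → ℤ}

/-- The multi-indices of order `k`. -/
abbrev multi (d k : ℕ) : Finset (Fin d → ℕ) := Finset.piAntidiag Finset.univ k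

/-- The factorial `β!` of a multi-index. -/
def mfact (β : Fin d → ℕ) : ℕ := ∏ j, (β j).factorial

lemma mem_multi {k : ℕ} {β : Fin d → ℕ} : β ∈ multi d k ↔ ∑ j, β j = k := by
  simp [multi]

lemma mfact_ne_zero (β : Fin d → ℕ) : (mfact β : ℂ) ≠ 0 := by
  rw [mfact]
  exact_mod_cast Finset.prod_ne_zero_iff.2 fun j _ => Nat.factorial_ne_zero _

@[fun_prop]
lemma continuous_mono (β : Fin d → ℕ) : Continuous (mono β) := by
  unfold mono; fun_prop

lemma norm_mono_le (β : Fin d → ℕ) (x : Fin d → ℝ) : ‖mono β x‖ ≤ ‖x‖ ^ (∑ j, β j) := by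
  rw [mono, norm_prod, ← Finset.prod_pow_eq_pow_sum]
  refine Finset.prod_le_prod (fun j _ => norm_nonneg _) fun j _ => ?_
  rw [norm_pow, Complex.norm_real]
  gcongr
  exact norm_le_pi_norm x j

lemma slowGrowth_mono_sub (β : Fin d → ℕ) (x : Fin d → ℝ) :
    SlowGrowth fun y => mono β (y - x) := by
  refine slowGrowth_of_norm_le (Continuous.aestronglyMeasurable (by fun_prop))
    (C := (1 + ‖x‖) ^ (∑ j, β j)) (N := ∑ j, β j) (by positivity) fun y => ?_
  refine (norm_mono_le _ _).trans ?_
  rw [← mul_pow]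
  gcongr
  have := norm_sub_le y x
  nlinarith [norm_nonneg x, norm_nonneg y]

lemma dotProduct_pow_eq_sum (w x : Fin d → ℝ) (k : ℕ) : ((w ⬝ᵥ x : ℝ) : ℂ) ^ k =
    ∑ β ∈ multi d k, (k.factorial / mfact β : ℂ) * mono β w * mono β x := by
  rw [dotProduct]
  push_cast
  rw [Finset.sum_pow_eq_sum_piAntidiag]
  refine Finset.sum_congr rfl fun β hβ => ?_
  rw [mem_multi] at hβ
  have h := Nat.multinomial_spec Finset.univ β
  rw [hβ] at h
  have h1 : (k.factorial / mfact β : ℂ) = (Nat.multinomial Finset.univ β : ℂ) := by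
    rw [div_eq_iff (mfact_ne_zero β), ← h, mfact]
    push_cast; ring
  rw [h1, mono, mono, mul_assoc, ← Finset.prod_mul_distrib]
  congr 1
  exact Finset.prod_congr rfl fun j _ => mul_pow _ _ _

/-- A polynomial that vanishes on `ℤ^d` is zero. This recovers statements about monomials from
statements about the powers `(w·x)^k` with integer `w`. -/
lemma eq_of_sum_mono_eq {k : ℕ} {a b : (Fin d → ℕ) → ℂ}
    (h : ∀ w : Fin d → ℤ, ∑ β ∈ multi d k, mono β (toReal w) * a β =
      ∑ β ∈ multi d k, mono β (toReal w) * b β) {β : Fin d → ℕ} (hβ : β ∈ multi d k) :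
    a β = b β := by
  set P : ((Fin d → ℕ) → ℂ) → MvPolynomial (Fin d) ℂ := fun c =>
    ∑ β ∈ multi d k, MvPolynomial.monomial (Finsupp.equivFunOnFinite.symm β) (c β) with hP
  have heval : ∀ (c : (Fin d → ℕ) → ℂ) (w : Fin d → ℤ),
      MvPolynomial.eval (fun j => (w j : ℂ)) (P c) =
      ∑ β ∈ multi d k, mono β (toReal w) * c β := by
    intro c w
    rw [hP, map_sum]
    refine Finset.sum_congr rfl fun β _ => ?_
    rw [MvPolynomial.eval_monomial, mul_comm, Finsupp.prod_fintype _ _ (fun _ => pow_zero _)]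
    simp [mono, toReal]
  have hPab : P a = P b := by
    refine MvPolynomial.funext_set (fun _ => Set.range (Int.cast : ℤ → ℂ))
      (fun _ => Set.infinite_range_of_injective Int.cast_injective) fun x hx => ?_
    choose w hw using fun j => hx j (Set.mem_univ j)
    have : x = fun j => (w j : ℂ) := by ext j; rw [hw]
    rw [this, heval, heval, h]
  have hcoeff : ∀ c, (P c).coeff (Finsupp.equivFunOnFinite.symm β) = c β := by
    intro c
    rw [hP, MvPolynomial.coeff_sum]
    simp_rw [MvPolynomial.coeff_monomial, Finsupp.equivFunOnFinite.symm.injective.eq_iff]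
    rw [Finset.sum_ite_eq', if_pos hβ]
  rw [← hcoeff a, ← hcoeff b, hPab]

/-! ### Symbols of directional derivatives -/

/-- The linear form `v·X`. -/
def linForm (v : Fin d → ℝ) : MvPolynomial (Fin d) ℝ := ∑ j, MvPolynomial.C (v j) * MvPolynomial.X j

/-- The product of the linear forms of a list of vectors. -/
def dirPoly (l : List (Fin d → ℝ)) : MvPolynomial (Fin d) ℝ := (l.map linForm).prod

/-- The coefficient of `X^β` in `dirPoly l`. -/
def dirCoeff (l : List (Fin d → ℝ)) (β : Fin d → ℕ) : ℝ :=
  (dirPoly l).coeff (Finsupp.equivFunOnFinite.symm β)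

lemma isHomogeneous_dirPoly (l : List (Fin d → ℝ)) : (dirPoly l).IsHomogeneous l.length := by
  induction l with
  | nil => exact MvPolynomial.isHomogeneous_one _ _
  | cons v l ih =>
    rw [dirPoly, List.map_cons, List.prod_cons, List.length_cons, add_comm]
    refine MvPolynomial.IsHomogeneous.mul ?_ ih
    refine MvPolynomial.IsHomogeneous.sum _ _ _ fun j _ => ?_
    simpa using (MvPolynomial.isHomogeneous_C (Fin d) (v j)).mul (MvPolynomial.isHomogeneous_X ℝ j)

lemma dirPoly_eq_sum (l : List (Fin d → ℝ)) : dirPoly l = ∑ β ∈ multi d l.length,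
    MvPolynomial.monomial (Finsupp.equivFunOnFinite.symm β) (dirCoeff l β) := by
  ext γ
  rw [MvPolynomial.coeff_sum]
  simp_rw [MvPolynomial.coeff_monomial, Equiv.symm_apply_eq]
  rw [Finset.sum_ite_eq']
  split_ifs with h
  · rw [dirCoeff, Equiv.symm_apply_apply]
  · refine (isHomogeneous_dirPoly l).coeff_eq_zero fun h' => h (mem_multi.2 ?_)
    rw [← h', Finsupp.degree_eq_sum]
    rfl

lemma prod_dotProduct_eq_sum (l : List (Fin d → ℝ)) (y : Fin d → ℝ) :
    (l.map fun v => ((v ⬝ᵥ y : ℝ) : ℂ)).prod =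
      ∑ β ∈ multi d l.length, (dirCoeff l β : ℂ) * mono β y := by
  have h1 : (l.map fun v => ((v ⬝ᵥ y : ℝ) : ℂ)).prod =
      ((MvPolynomial.eval y (dirPoly l) : ℝ) : ℂ) := by
    induction l with
    | nil => simp [dirPoly]
    | cons v l ih =>
      rw [List.map_cons, List.prod_cons, ih]
      simp [dirPoly, linForm, dotProduct]
  rw [h1, dirPoly_eq_sum, map_sum]
  push_cast
  refine Finset.sum_congr rfl fun β _ => ?_
  rw [MvPolynomial.eval_monomial, Finsupp.prod_fintype _ _ (fun _ => pow_zero _)]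
  simp [mono]

lemma length_setDirs (V : Fin n → Fin d → ℤ) (U : Finset (Fin n)) :
    (setDirs V U).length = U.card := by
  simp [setDirs]

lemma prod_int_dotProduct_eq_sum {U : Finset (Fin n)} (hUL : U ∈ Lam V) (w : Fin d → ℤ) :
    ∏ i ∈ U, ((w ⬝ᵥ V i : ℤ) : ℂ) =
      ∑ β ∈ multi d (rho V + 1), (dirCoeff (setDirs V U) β : ℂ) * mono β (toReal w) := by
  have h := prod_dotProduct_eq_sum (setDirs V U) (toReal w)
  rw [length_setDirs, (mem_Lam.1 hUL).1] at h
  rw [← h, setDirs, List.map_map]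
  have h2 : ((fun v : Fin d → ℝ => ((v ⬝ᵥ toReal w : ℝ) : ℂ)) ∘ fun i => toReal (V i)) =
      fun i => ((w ⬝ᵥ V i : ℤ) : ℂ) := by
    ext i
    simp only [Function.comp]
    rw [toReal_dotProduct, dotProduct_comm, Complex.ofReal_intCast]
  rw [h2, ← Multiset.prod_coe, ← Multiset.map_coe, Finset.sort_eq]
  rfl

/-- The value at `x` of the error of the projection on `(· - x)^β/β!`. -/
def bernCoeffSum (V : Fin n → Fin d → ℤ) (β : Fin d → ℕ) (x : Fin d → ℝ) : ℂ :=
  ∑ U ∈ Lam V, (dirCoeff (setDirs V U) β : ℂ) * bernoulliSpline V U x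

lemma bernSum_eq_sum (w : Fin d → ℤ) (x : Fin d → ℝ) : bernSum V w x =
    ∑ β ∈ multi d (rho V + 1), mono β (toReal w) * bernCoeffSum V β x := by
  simp_rw [bernSum, bernCoeffSum, Finset.mul_sum]
  rw [Finset.sum_comm]
  refine Finset.sum_congr rfl fun U hUL => ?_
  rw [prod_int_dotProduct_eq_sum hUL, Finset.sum_mul]
  exact Finset.sum_congr rfl fun β _ => by ring

/-- Only countably many `w` and `k` occur, so the exceptional sets may be united. Comparison of
coefficients in `w` then takes place at a fixed point `x`. -/
lemma projFun_ridge_all (hV : Admissible V) (hU : Unimodular V) :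
    ∀ᵐ x, ∀ (w : Fin d → ℤ) (k : ℕ), k ≤ rho V + 1 → projFun V (ridge w k) x = ridge w k x +
      if k = rho V + 1 then k.factorial * bernSum V w x else 0 := by
  rw [ae_all_iff]; intro w
  rw [ae_all_iff]; intro k
  by_cases hk : k ≤ rho V + 1
  · filter_upwards [projFun_ridge hV hU w k hk] with x hx _ using hx
  · exact ae_of_all _ fun x h => absurd h hk

lemma projFun_mono (hV : Admissible V) (hU : Unimodular V) :
    ∀ᵐ x, ∀ β ∈ multi d (rho V + 1),
      projFun V (mono β) x = mono β x + mfact β * bernCoeffSum V β x := by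
  filter_upwards [projFun_ridge_all hV hU] with x hx β hβ
  set m := rho V + 1 with hm
  have hs : ∀ β : Fin d → ℕ, SlowGrowth (mono β) := fun β => by
    simpa using slowGrowth_mono_sub β 0
  have hm0 : (m.factorial : ℂ) ≠ 0 := by exact_mod_cast m.factorial_ne_zero
  have key := eq_of_sum_mono_eq (k := m)
    (a := fun β => (m.factorial / mfact β : ℂ) * projFun V (mono β) x)
    (b := fun β => (m.factorial / mfact β : ℂ) * (mono β x + mfact β * bernCoeffSum V β x))
    (fun w => ?_) hβ
  · exact mul_left_cancel₀ (div_ne_zero hm0 (mfact_ne_zero β)) key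
  · have h1 := hx w m le_rfl
    have hr : ridge w m = fun y => ∑ β ∈ multi d m,
        ((m.factorial / mfact β : ℂ) * mono β (toReal w)) * mono β y := by
      ext y; exact dotProduct_pow_eq_sum _ _ _
    rw [hr, projFun_finset_sum hV hU _ fun β _ => (hs β).const_mul _, if_pos rfl,
      bernSum_eq_sum, Finset.mul_sum, ← Finset.sum_add_distrib] at h1
    refine Eq.trans (Finset.sum_congr rfl fun β _ => ?_) (h1.trans (Finset.sum_congr rfl
      fun β _ => ?_))
    · rw [projFun_const_mul]; ring
    · field_simp [mfact_ne_zero β]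

/-- Expand `(w·(y - x))^k` in powers of `w·y`, apply `projFun` and evaluate at `y = x`. The
reproduced parts add up to `(w·x - w·x)^k = 0^k`, and only the term of exact order `k = ϱ + 1`
leaves an error. Comparing coefficients in `w` gives the centred monomials. -/
lemma projFun_mono_sub (hV : Admissible V) (hU : Unimodular V) :
    ∀ᵐ x, ∀ k ≤ rho V + 1, ∀ β ∈ multi d k,
      projFun V (fun y => mono β (y - x)) x = mono β 0 +
        if k = rho V + 1 then mfact β * bernCoeffSum V β x else 0 := by
  filter_upwards [projFun_ridge_all hV hU] with x hx k hk β hβ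
  have hm0 : (k.factorial : ℂ) ≠ 0 := by exact_mod_cast k.factorial_ne_zero
  have key := eq_of_sum_mono_eq (k := k)
    (a := fun β => (k.factorial / mfact β : ℂ) * projFun V (fun y => mono β (y - x)) x)
    (b := fun β => (k.factorial / mfact β : ℂ) * (mono β 0 +
        if k = rho V + 1 then mfact β * bernCoeffSum V β x else 0))
    (fun w => ?_) hβ
  · exact mul_left_cancel₀ (div_ne_zero hm0 (mfact_ne_zero β)) key
  · set t : ℂ := ((toReal w ⬝ᵥ x : ℝ) : ℂ) with ht
    have hr1 : (fun y => ∑ β ∈ multi d k,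
        ((k.factorial / mfact β : ℂ) * mono β (toReal w)) * mono β (y - x)) =
        fun y => ∑ j ∈ Finset.range (k + 1), ((-t) ^ (k - j) * k.choose j) * ridge w j y := by
      ext y
      rw [← dotProduct_pow_eq_sum, dotProduct_sub]
      push_cast
      rw [sub_eq_add_neg, add_pow]
      exact Finset.sum_congr rfl fun j _ => by rw [ridge, ht]; ring
    have h1 : projFun V (fun y => ∑ β ∈ multi d k,
        ((k.factorial / mfact β : ℂ) * mono β (toReal w)) * mono β (y - x)) x =
        (0 : ℂ) ^ k + if k = rho V + 1 then k.factorial * bernSum V w x else 0 := by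
      rw [hr1, projFun_finset_sum hV hU _ fun j _ => (slowGrowth_ridge w j).const_mul _]
      have h2 : ∀ j ∈ Finset.range (k + 1),
          projFun V (fun y => ((-t) ^ (k - j) * k.choose j) * ridge w j y) x =
          t ^ j * (-t) ^ (k - j) * k.choose j + if j = k then (if k = rho V + 1 then
            k.factorial * bernSum V w x else 0) else 0 := by
        intro j hj
        rw [Finset.mem_range] at hj
        rw [projFun_const_mul, hx w j (by omega), ridge, ← ht]
        by_cases hjk : j = k
        · subst hjk; simp
        · rw [if_neg hjk, if_neg (by omega)]; ring
      rw [Finset.sum_congr rfl h2, Finset.sum_add_distrib, ← add_pow, add_neg_cancel,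
        Finset.sum_ite_eq', if_pos (Finset.mem_range.2 (by omega))]
    rw [projFun_finset_sum hV hU _ fun β _ => (slowGrowth_mono_sub β x).const_mul _] at h1
    have h3 := dotProduct_pow_eq_sum (toReal w) 0 k
    rw [dotProduct_zero, Complex.ofReal_zero] at h3
    rw [h3] at h1
    have h4 : (if k = rho V + 1 then (k.factorial : ℂ) * bernSum V w x else 0) =
        ∑ β ∈ multi d k, mono β (toReal w) * ((k.factorial / mfact β : ℂ) *
          if k = rho V + 1 then mfact β * bernCoeffSum V β x else 0) := by
      split_ifs with hkm
      · rw [bernSum_eq_sum, Finset.mul_sum, ← hkm]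
        refine Finset.sum_congr rfl fun β _ => ?_
        field_simp [mfact_ne_zero β]
      · simp
    rw [h4, ← Finset.sum_add_distrib] at h1
    refine Eq.trans (Finset.sum_congr rfl fun β _ => ?_) (h1.trans (Finset.sum_congr rfl
      fun β _ => ?_))
    · rw [projFun_const_mul]; ring
    · ring

lemma Lfun_ae_eq (hV : Admissible V) (hU : Unimodular V) :
    ∀ᵐ x, ∀ β ∈ multi d (rho V + 1), Lfun V β x = mfact β * bernCoeffSum V β x := by
  filter_upwards [projFun_mono hV hU, proj_ae_eq hV hU] with x hx hx' β hβ
  rw [Lfun, hx' _ (by simpa using slowGrowth_mono_sub β 0), hx β hβ, add_sub_cancel_left]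

end

section

/-! ### Iterated directional derivatives -/

variable {d n : ℕ} {V : Fin n → Fin d → ℤ}

lemma contDiff_iterDeriv {φ : (Fin d → ℝ) → ℝ} (hφ : ContDiff ℝ ∞ φ) (l : List (Fin d → ℝ)) :
    ContDiff ℝ ∞ (iterDeriv l φ) := by
  induction l with
  | nil => exact hφ
  | cons v l ih => exact (ih.fderiv_right (m := ∞) (by simp)).clm_apply contDiff_const

lemma hasCompactSupport_iterDeriv {φ : (Fin d → ℝ) → ℝ} (hφ : HasCompactSupport φ)
    (l : List (Fin d → ℝ)) : HasCompactSupport (iterDeriv l φ) := by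
  induction l with
  | nil => exact hφ
  | cons v l ih => exact ih.fderiv_apply (𝕜 := ℝ) v

lemma iterDeriv_perm {φ : (Fin d → ℝ) → ℝ} (hφ : ContDiff ℝ ∞ φ) {l l' : List (Fin d → ℝ)}
    (h : l.Perm l') : iterDeriv l φ = iterDeriv l' φ := by
  induction h with
  | nil => rfl
  | cons v _ ih => simp only [iterDeriv, ih]
  | swap v w l =>
    ext x
    set ψ := iterDeriv l φ with hψ
    have hψc : ContDiff ℝ ∞ ψ := contDiff_iterDeriv hφ l
    have hd : DifferentiableAt ℝ (fderiv ℝ ψ) x :=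
      (hψc.fderiv_right (m := ∞) (by simp)).differentiable (by simp) x
    have h1 : ∀ a b, fderiv ℝ (fun y => fderiv ℝ ψ y a) x b = fderiv ℝ (fderiv ℝ ψ) x b a := by
      intro a b
      rw [fderiv_clm_apply hd (differentiableAt_const a)]
      simp
    have hs : IsSymmSndFDerivAt ℝ ψ x :=
      hψc.contDiffAt.isSymmSndFDerivAt (by simpa using WithTop.coe_le_coe.2 (le_top : (2 : ℕ∞) ≤ ⊤))
    simp only [iterDeriv, ← hψ]
    rw [h1, h1]
    exact hs.eq _ _
  | trans _ _ ih1 ih2 => exact ih1.trans ih2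

lemma coe_multiDirs (β : Fin d → ℕ) :
    (multiDirs β : Multiset (Fin d → ℝ)) = ∑ j, β j • {Pi.single j 1} := by
  rw [multiDirs, ← Multiset.coe_bind]
  simp only [Multiset.bind, Multiset.join, Multiset.coe_replicate]
  rw [Finset.sum, Fin.univ_val_map]
  simp [Multiset.nsmul_singleton, List.ofFn_eq_map]

lemma length_multiDirs (β : Fin d → ℕ) : (multiDirs β).length = ∑ j, β j := by
  have h := congrArg Multiset.card (coe_multiDirs β)
  simpa using h

lemma multiDirs_perm (β : Fin d → ℕ) (j : Fin d) :
    (multiDirs (Pi.single j 1 + β)).Perm (Pi.single j 1 :: multiDirs β) := by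
  rw [← Multiset.coe_eq_coe, ← Multiset.cons_coe, coe_multiDirs, coe_multiDirs]
  simp_rw [Pi.add_apply, add_smul, Finset.sum_add_distrib]
  rw [Finset.sum_eq_single j (fun i _ hi => by simp [hi]) (by simp)]
  simp

/-- The value at `x` of the constant coefficient differential operator with a given symbol. -/
def diffOp (φ : (Fin d → ℝ) → ℝ) (x : Fin d → ℝ) : MvPolynomial (Fin d) ℝ →ₗ[ℝ] ℝ :=
  (MvPolynomial.basisMonomials (Fin d) ℝ).constr ℝ fun γ => iterDeriv (multiDirs γ) φ x

lemma diffOp_monomial (φ : (Fin d → ℝ) → ℝ) (x : Fin d → ℝ) (γ : Fin d →₀ ℕ) (a : ℝ) :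
    diffOp φ x (MvPolynomial.monomial γ a) = a * iterDeriv (multiDirs γ) φ x := by
  have h : MvPolynomial.monomial γ a = a • MvPolynomial.basisMonomials (Fin d) ℝ γ := by
    rw [MvPolynomial.coe_basisMonomials, MvPolynomial.smul_monomial, smul_eq_mul, mul_one]
  rw [h, map_smul, diffOp, Module.Basis.constr_basis, smul_eq_mul]

lemma linForm_mul_monomial (v : Fin d → ℝ) (γ : Fin d →₀ ℕ) (a : ℝ) :
    linForm v * MvPolynomial.monomial γ a =
      ∑ j, MvPolynomial.monomial (Finsupp.single j 1 + γ) (v j * a) := by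
  rw [linForm, Finset.sum_mul]
  refine Finset.sum_congr rfl fun j _ => ?_
  rw [MvPolynomial.X, MvPolynomial.C_mul_monomial, MvPolynomial.monomial_mul, mul_one]

lemma differentiable_diffOp {φ : (Fin d → ℝ) → ℝ} (hφ : ContDiff ℝ ∞ φ)
    (P : MvPolynomial (Fin d) ℝ) : Differentiable ℝ fun y => diffOp φ y P := by
  induction P using MvPolynomial.induction_on' with
  | monomial γ a =>
    simp_rw [diffOp_monomial]
    exact ((contDiff_iterDeriv hφ _).differentiable (by simp)).const_mul a
  | add p q hp hq =>
    simp_rw [map_add]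
    exact hp.add hq

/-- Differentiation along `v` corresponds to multiplication of the symbol by `v·X`; this rests on
the symmetry of second derivatives. Consequently iterated directional derivatives have the product
of the linear forms as symbol. -/
lemma fderiv_diffOp {φ : (Fin d → ℝ) → ℝ} (hφ : ContDiff ℝ ∞ φ) (P : MvPolynomial (Fin d) ℝ)
    (x v : Fin d → ℝ) : fderiv ℝ (fun y => diffOp φ y P) x v = diffOp φ x (linForm v * P) := by
  induction P using MvPolynomial.induction_on' with
  | monomial γ a =>
    have hd := (contDiff_iterDeriv hφ (multiDirs γ)).differentiable (by simp) x
    simp_rw [linForm_mul_monomial, map_sum, diffOp_monomial]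
    rw [fderiv_const_mul hd]
    have h1 : ∀ j : Fin d, iterDeriv (multiDirs ⇑(Finsupp.single j 1 + γ : Fin d →₀ ℕ)) φ x =
        fderiv ℝ (iterDeriv (multiDirs γ) φ) x (Pi.single j 1) := by
      intro j
      have h2 : ⇑(Finsupp.single j 1 + γ : Fin d →₀ ℕ) = (Pi.single j 1 + ⇑γ : Fin d → ℕ) := by
        rw [Finsupp.coe_add, Finsupp.single_eq_pi_single]
      rw [h2, iterDeriv_perm hφ (multiDirs_perm γ j)]
      rfl
    simp_rw [h1]
    have hv : v = ∑ j, v j • (Pi.single j 1 : Fin d → ℝ) := by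
      ext i; simp [Finset.sum_apply, Pi.single_apply]
    conv_lhs => rw [hv]
    rw [map_sum]
    refine Finset.sum_congr rfl fun j _ => ?_
    rw [map_smul]
    simp only [smul_eq_mul, smul_apply]
    ring
  | add p q hp hq =>
    simp_rw [mul_add, map_add]
    rw [fderiv_fun_add (differentiable_diffOp hφ p x) (differentiable_diffOp hφ q x),
      add_apply, hp, hq]

lemma iterDeriv_eq_diffOp {φ : (Fin d → ℝ) → ℝ} (hφ : ContDiff ℝ ∞ φ) (l : List (Fin d → ℝ))
    (x : Fin d → ℝ) : iterDeriv l φ x = diffOp φ x (dirPoly l) := by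
  induction l generalizing x with
  | nil =>
    have : dirPoly ([] : List (Fin d → ℝ)) = MvPolynomial.monomial 0 1 := by simp [dirPoly]
    rw [this, diffOp_monomial, one_mul]
    have h2 : multiDirs (fun _ : Fin d => 0) = [] := by
      rw [← List.length_eq_zero_iff, length_multiDirs]; simp
    change _ = iterDeriv (multiDirs (fun _ : Fin d => 0)) φ x
    rw [h2]
  | cons v l ih =>
    have h1 : iterDeriv l φ = fun y => diffOp φ y (dirPoly l) := funext fun y => ih y
    change fderiv ℝ (iterDeriv l φ) x v = _
    rw [h1, fderiv_diffOp hφ]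
    rfl

/-- A directional derivative as a combination of partial derivatives. -/
lemma iterDeriv_eq_sum {φ : (Fin d → ℝ) → ℝ} (hφ : ContDiff ℝ ∞ φ) (l : List (Fin d → ℝ))
    (x : Fin d → ℝ) : iterDeriv l φ x =
      ∑ β ∈ multi d l.length, dirCoeff l β * iterDeriv (multiDirs β) φ x := by
  rw [iterDeriv_eq_diffOp hφ, dirPoly_eq_sum, map_sum]
  exact Finset.sum_congr rfl fun β _ => diffOp_monomial _ _ _ _

/-! ### Weak derivatives -/

lemma integrable_test_mul {φ : (Fin d → ℝ) → ℝ} (hφ : Continuous φ) (hc : HasCompactSupport φ)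
    {f : (Fin d → ℝ) → ℂ} (hf : LocallyIntegrable f volume) :
    Integrable fun x => ((φ x : ℝ) : ℂ) * f x := by
  have h := hf.integrable_smul_left_of_hasCompactSupport hφ hc
  exact h.congr (ae_of_all _ fun x => by simp [Complex.real_smul])

lemma ae_eq_of_integral_test {f g : (Fin d → ℝ) → ℂ} (hf : LocallyIntegrable f volume)
    (hg : LocallyIntegrable g volume)
    (h : ∀ φ : (Fin d → ℝ) → ℝ, ContDiff ℝ ∞ φ → HasCompactSupport φ →
      ∫ x, ((φ x : ℝ) : ℂ) * f x = ∫ x, ((φ x : ℝ) : ℂ) * g x) : f =ᵐ[volume] g := by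
  refine ae_eq_of_integral_contDiff_smul_eq hf hg fun φ h1 h2 => ?_
  simp_rw [Complex.real_smul]
  exact h φ h1 h2

lemma IsWeakDeriv.ae_eq {l : List (Fin d → ℝ)} {f g g' : (Fin d → ℝ) → ℂ}
    (h : IsWeakDeriv l f g) (h' : IsWeakDeriv l f g') : g =ᵐ[volume] g' := by
  refine ae_eq_of_integral_test h.2.1 h'.2.1 fun φ h1 h2 => ?_
  have h3 := (h.2.2 φ h1 h2).symm.trans (h'.2.2 φ h1 h2)
  exact mul_left_cancel₀ (pow_ne_zero _ (neg_ne_zero.2 one_ne_zero)) h3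

lemma isWeakDeriv_weakDeriv {l : List (Fin d → ℝ)} {f g : (Fin d → ℝ) → ℂ}
    (h : IsWeakDeriv l f g) : IsWeakDeriv l f (weakDeriv l f) := by
  have h' : ∃ g, IsWeakDeriv l f g := ⟨g, h⟩
  rw [weakDeriv, dif_pos h']
  exact h'.choose_spec

lemma weakDeriv_ae_eq {l : List (Fin d → ℝ)} {f g : (Fin d → ℝ) → ℂ}
    (h : IsWeakDeriv l f g) : weakDeriv l f =ᵐ[volume] g :=
  (isWeakDeriv_weakDeriv h).ae_eq h

lemma IsWeakDeriv.congr {l : List (Fin d → ℝ)} {f f' g g' : (Fin d → ℝ) → ℂ}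
    (h : IsWeakDeriv l f g) (hf : f =ᵐ[volume] f') (hg : g =ᵐ[volume] g') :
    IsWeakDeriv l f' g' := by
  refine ⟨h.1.congr hf, h.2.1.congr hg, fun φ h1 h2 => ?_⟩
  have e1 : ∫ x, ((iterDeriv l φ x : ℝ) : ℂ) * f' x = ∫ x, ((iterDeriv l φ x : ℝ) : ℂ) * f x :=
    integral_congr_ae (by filter_upwards [hf] with x hx; rw [hx])
  have e2 : ∫ x, ((φ x : ℝ) : ℂ) * g' x = ∫ x, ((φ x : ℝ) : ℂ) * g x :=
    integral_congr_ae (by filter_upwards [hg] with x hx; rw [hx])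
  rw [e1, e2, h.2.2 φ h1 h2]

lemma IsWeakDeriv.add {l : List (Fin d → ℝ)} {f f' g g' : (Fin d → ℝ) → ℂ}
    (h : IsWeakDeriv l f g) (h' : IsWeakDeriv l f' g') : IsWeakDeriv l (f + f') (g + g') := by
  refine ⟨h.1.add h'.1, h.2.1.add h'.2.1, fun φ h1 h2 => ?_⟩
  have c1 := (contDiff_iterDeriv h1 l).continuous
  have c2 := hasCompactSupport_iterDeriv h2 l
  simp_rw [Pi.add_apply, mul_add]
  rw [integral_add (integrable_test_mul c1 c2 h.1) (integrable_test_mul c1 c2 h'.1),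
    integral_add (integrable_test_mul h1.continuous h2 h.2.1)
      (integrable_test_mul h1.continuous h2 h'.2.1), h.2.2 φ h1 h2, h'.2.2 φ h1 h2, mul_add]

lemma IsWeakDeriv.smul {l : List (Fin d → ℝ)} {f g : (Fin d → ℝ) → ℂ}
    (h : IsWeakDeriv l f g) (a : ℂ) : IsWeakDeriv l (a • f) (a • g) := by
  refine ⟨h.1.smul a, h.2.1.smul a, fun φ h1 h2 => ?_⟩
  simp_rw [Pi.smul_apply, smul_eq_mul, mul_left_comm _ a, integral_const_mul]
  rw [h.2.2 φ h1 h2]; ring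

/-- Directional weak derivatives as combinations of partial ones. -/
lemma isWeakDeriv_sum {l : List (Fin d → ℝ)} {f : (Fin d → ℝ) → ℂ}
    {F : (Fin d → ℕ) → (Fin d → ℝ) → ℂ} (hf : LocallyIntegrable f volume)
    (h : ∀ β ∈ multi d l.length, IsWeakDeriv (multiDirs β) f (F β)) :
    IsWeakDeriv l f fun x => ∑ β ∈ multi d l.length, (dirCoeff l β : ℂ) * F β x := by
  refine ⟨hf, ?_, fun φ h1 h2 => ?_⟩
  · exact locallyIntegrable_finsetSum _ fun β hβ => (h β hβ).2.1.smul (dirCoeff l β : ℂ)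
  · have e1 : ∀ x, ((iterDeriv l φ x : ℝ) : ℂ) * f x = ∑ β ∈ multi d l.length,
        (dirCoeff l β : ℂ) * (((iterDeriv (multiDirs β) φ x : ℝ) : ℂ) * f x) := by
      intro x
      rw [iterDeriv_eq_sum h1]
      push_cast
      rw [Finset.sum_mul]
      exact Finset.sum_congr rfl fun β _ => by ring
    have e2 : ∀ x, ((φ x : ℝ) : ℂ) * ∑ β ∈ multi d l.length, (dirCoeff l β : ℂ) * F β x =
        ∑ β ∈ multi d l.length, (dirCoeff l β : ℂ) * (((φ x : ℝ) : ℂ) * F β x) := by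
      intro x
      rw [Finset.mul_sum]
      exact Finset.sum_congr rfl fun β _ => by ring
    simp_rw [e1, e2]
    rw [integral_finsetSum _ fun β hβ => (integrable_test_mul
        (contDiff_iterDeriv h1 _).continuous (hasCompactSupport_iterDeriv h2 _) hf).const_mul _,
      integral_finsetSum _ fun β hβ => (integrable_test_mul h1.continuous h2
        (h β hβ).2.1).const_mul _, Finset.mul_sum]
    refine Finset.sum_congr rfl fun β hβ => ?_
    rw [integral_const_mul, integral_const_mul, (h β hβ).2.2 φ h1 h2, length_multiDirs,
      mem_multi.1 hβ]
    ring

end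

section

/-! ### Taylor's formula with integral remainder -/

variable {d n : ℕ} {V : Fin n → Fin d → ℤ}

/-- The weight `(1-s)^r/r!` of the integral remainder. -/
def taylorWeight (r : ℕ) (s : ℝ) : ℝ := (1 - s) ^ r / r.factorial

@[fun_prop]
lemma continuous_taylorWeight (r : ℕ) : Continuous (taylorWeight r) := by
  unfold taylorWeight; fun_prop

lemma hasDerivAt_taylorWeight (r : ℕ) (s : ℝ) :
    HasDerivAt (taylorWeight (r + 1)) (-taylorWeight r s) s := by
  have h := (((hasDerivAt_id s).const_sub 1).pow (r + 1)).div_const ((r + 1).factorial : ℝ)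
  refine h.congr_deriv ?_
  have h1 : (r.factorial : ℝ) ≠ 0 := by exact_mod_cast r.factorial_ne_zero
  have h2 : ((r : ℝ) + 1) ≠ 0 := by positivity
  rw [taylorWeight, Nat.factorial_succ]
  push_cast
  simp only [id]
  field_simp

lemma taylorWeight_nonneg (r : ℕ) {s : ℝ} (hs : s ≤ 1) : 0 ≤ taylorWeight r s := by
  unfold taylorWeight
  have : 0 ≤ 1 - s := by linarith
  positivity

lemma taylorWeight_le_one (r : ℕ) {s : ℝ} (h0 : 0 ≤ s) (h1 : s ≤ 1) : taylorWeight r s ≤ 1 := by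
  unfold taylorWeight
  rw [div_le_one (by positivity)]
  refine (pow_le_one₀ (by linarith) (by linarith)).trans ?_
  exact_mod_cast r.factorial_pos

lemma integral_taylorWeight (r : ℕ) :
    ∫ s in Set.Ioc (0 : ℝ) 1, taylorWeight r s = 1 / (r + 1).factorial := by
  rw [← intervalIntegral.integral_of_le zero_le_one]
  have h := intervalIntegral.integral_eq_sub_of_hasDerivAt (a := 0) (b := 1)
    (f := fun s => -taylorWeight (r + 1) s) (f' := taylorWeight r)
    (fun s _ => by simpa using (hasDerivAt_taylorWeight r s).fun_neg)
    ((continuous_taylorWeight r).intervalIntegrable _ _)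
  rw [h]
  simp [taylorWeight]

/-- The iterated derivative in one direction. -/
abbrev dirDeriv (k : ℕ) (z : Fin d → ℝ) (φ : (Fin d → ℝ) → ℝ) : (Fin d → ℝ) → ℝ :=
  iterDeriv (List.replicate k z) φ

lemma dirDeriv_succ (k : ℕ) (z : Fin d → ℝ) (φ : (Fin d → ℝ) → ℝ) (x : Fin d → ℝ) :
    dirDeriv (k + 1) z φ x = fderiv ℝ (dirDeriv k z φ) x z := rfl

lemma dirDeriv_comp_sub {φ : (Fin d → ℝ) → ℝ} (k : ℕ) (z a x : Fin d → ℝ) :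
    dirDeriv k z (fun y => φ (y - a)) x = dirDeriv k z φ (x - a) := by
  induction k generalizing x with
  | zero => rfl
  | succ k ih =>
    have h : dirDeriv k z (fun y => φ (y - a)) = fun y => dirDeriv k z φ (y - a) :=
      funext fun y => ih y
    rw [dirDeriv_succ, dirDeriv_succ, h, fderiv_comp_sub]

lemma hasDerivAt_dirDeriv {φ : (Fin d → ℝ) → ℝ} (hφ : ContDiff ℝ ∞ φ) (k : ℕ)
    (z x : Fin d → ℝ) (s : ℝ) :
    HasDerivAt (fun s : ℝ => dirDeriv k z φ (x - s • z)) (-dirDeriv (k + 1) z φ (x - s • z)) s := by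
  have h1 := ((contDiff_iterDeriv hφ (List.replicate k z)).differentiable (by simp)
    (x - s • z)).hasFDerivAt
  have h2 : HasDerivAt (fun s : ℝ => x - s • z) (-z) s := by
    simpa using ((hasDerivAt_id s).smul_const z).const_sub x
  have h3 := h1.comp_hasDerivAt s h2
  rw [map_neg] at h3
  exact h3

/-- With `A(s) = ∑ (-1)^k w_k(s) φ_k(x - sz)`, where `w_k` is the weight and `φ_k` the `k`-th
derivative along `z`, the derivative telescopes because `w_(k+1)' = -w_k`. The weights of positive
order vanish at `s = 1`, so `A(1) - A(0)` is the left side. The shift is by `-z` because the formula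
is applied to test functions. -/
lemma taylor_dirDeriv {φ : (Fin d → ℝ) → ℝ} (hφ : ContDiff ℝ ∞ φ) (r : ℕ) (z x : Fin d → ℝ) :
    φ (x - z) - ∑ k ∈ Finset.range (r + 1), (-1) ^ k / k.factorial * dirDeriv k z φ x =
      (-1) ^ (r + 1) * ∫ s in Set.Ioc (0 : ℝ) 1,
        taylorWeight r s * dirDeriv (r + 1) z φ (x - s • z) := by
  set A : ℝ → ℝ := fun s => ∑ k ∈ Finset.range (r + 1),
    (-1) ^ k * (taylorWeight k s * dirDeriv k z φ (x - s • z)) with hA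
  have hder : ∀ s, HasDerivAt A ((-1) ^ (r + 1) *
      (taylorWeight r s * dirDeriv (r + 1) z φ (x - s • z))) s := by
    intro s
    induction r with
    | zero =>
      have h := hasDerivAt_dirDeriv hφ 0 z x s
      simpa [hA, taylorWeight] using h
    | succ r ih =>
      simp only [hA]
      simp_rw [Finset.sum_range_succ _ (r + 1)]
      have h := (ih rfl).add (((hasDerivAt_taylorWeight r s).mul
        (hasDerivAt_dirDeriv hφ (r + 1) z x s)).const_mul ((-1) ^ (r + 1)))
      refine h.congr_deriv ?_
      ring
  have hcont : Continuous fun s : ℝ => (-1) ^ (r + 1) *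
      (taylorWeight r s * dirDeriv (r + 1) z φ (x - s • z)) := by
    have := (contDiff_iterDeriv hφ (List.replicate (r + 1) z)).continuous
    fun_prop
  have h := intervalIntegral.integral_eq_sub_of_hasDerivAt (a := 0) (b := 1)
    (fun s _ => hder s) (hcont.intervalIntegrable _ _)
  rw [intervalIntegral.integral_of_le zero_le_one, integral_const_mul] at h
  rw [h]
  have e1 : A 1 = φ (x - z) := by
    simp only [hA, one_smul]
    rw [Finset.sum_range_succ']
    simp [taylorWeight]
    rfl
  have e0 : A 0 = ∑ k ∈ Finset.range (r + 1), (-1) ^ k / k.factorial * dirDeriv k z φ x := by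
    simp only [hA, taylorWeight]
    refine Finset.sum_congr rfl fun k _ => ?_
    rw [zero_smul, sub_zero, sub_zero, one_pow]
    ring
  rw [e1, e0]

/-! ### Fubini along a segment -/

lemma measurePreserving_shear (z : Fin d → ℝ) (ν : Measure ℝ) [SFinite ν] :
    MeasurePreserving (fun q : ℝ × (Fin d → ℝ) => (q.1, q.2 + q.1 • z)) (ν.prod volume)
      (ν.prod volume) := by
  refine (MeasurePreserving.id ν).skew_product (g := fun s x => x + s • z) ?_ ?_
  · fun_prop
  · exact ae_of_all _ fun s => (measurePreserving_add_right volume (s • z)).map_eq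

/-- The shear `(s, x) ↦ (s, x + sz)` preserves the product measure and carries `[0,1] × K` into a
bounded region, so local integrability of `G` suffices. -/
lemma integrable_shift {G : (Fin d → ℝ) → ℂ} (hG : LocallyIntegrable G volume) (z : Fin d → ℝ)
    {K : Set (Fin d → ℝ)} (hK : IsCompact K) :
    Integrable (fun q : ℝ × (Fin d → ℝ) => G (q.2 + q.1 • z))
      ((volume.restrict (Set.Ioc (0 : ℝ) 1)).prod (volume.restrict K)) := by
  set ν := volume.restrict (Set.Ioc (0 : ℝ) 1) with hν
  obtain ⟨R, hR⟩ := hK.isBounded.exists_norm_le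
  set K' := Metric.closedBall (0 : Fin d → ℝ) (R + ‖z‖) with hK'
  have hm : MeasurableSet K' := Metric.isClosed_closedBall.measurableSet
  have h1 : Integrable (K'.indicator G) volume :=
    (integrable_indicator_iff hm).2 (hG.integrableOn_isCompact (isCompact_closedBall _ _))
  have h2 : Integrable (fun q : ℝ × (Fin d → ℝ) => K'.indicator G q.2) (ν.prod volume) :=
    h1.comp_snd ν
  have h3 := (measurePreserving_shear z ν).integrable_comp_of_integrable h2
  have h4 : Integrable (fun q : ℝ × (Fin d → ℝ) => K'.indicator G (q.2 + q.1 • z))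
      (ν.prod (volume.restrict K)) :=
    h3.mono_measure (Measure.prod_mono le_rfl Measure.restrict_le_self)
  refine h4.congr ?_
  have h5 : ∀ᵐ q ∂(ν.prod (volume.restrict K)), q ∈ Set.Ioc (0 : ℝ) 1 ×ˢ K := by
    rw [hν, Measure.prod_restrict]
    exact ae_restrict_mem (measurableSet_Ioc.prod hK.measurableSet)
  filter_upwards [h5] with q hq
  refine Set.indicator_of_mem ?_ _
  rw [hK', mem_closedBall_zero_iff]
  refine (norm_add_le _ _).trans (add_le_add (hR _ hq.2) ?_)
  rw [norm_smul, Real.norm_of_nonneg hq.1.1.le]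
  exact mul_le_of_le_one_left (norm_nonneg _) hq.1.2

end

section

/-! ### Taylor's formula for weak derivatives -/

variable {d n : ℕ} {V : Fin n → Fin d → ℤ}

lemma norm_taylorWeight_le (r : ℕ) :
    ∀ᵐ s ∂(volume.restrict (Set.Ioc (0 : ℝ) 1)), ‖((taylorWeight r s : ℝ) : ℂ)‖ ≤ 1 := by
  filter_upwards [ae_restrict_mem measurableSet_Ioc] with s hs
  rw [Complex.norm_real, Real.norm_of_nonneg (taylorWeight_nonneg r hs.2)]
  exact taylorWeight_le_one r hs.1.le hs.2

lemma locallyIntegrable_comp_add {f : (Fin d → ℝ) → ℂ} (hf : LocallyIntegrable f volume)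
    (z : Fin d → ℝ) : LocallyIntegrable (fun x => f (x + z)) volume := by
  have h := locallyIntegrable_map_homeomorph (Homeomorph.addRight z) (f := f)
    (μ := (volume : Measure (Fin d → ℝ)))
  have h2 : Measure.map (Homeomorph.addRight z) (volume : Measure (Fin d → ℝ)) = volume :=
    (measurePreserving_add_right volume z).map_eq
  rw [h2] at h
  exact h.1 hf

lemma integrable_taylor_diff {G : (Fin d → ℝ) → ℂ} (hG : LocallyIntegrable G volume) (r : ℕ)
    (z : Fin d → ℝ) {K : Set (Fin d → ℝ)} (hK : IsCompact K) :
    Integrable (fun q : ℝ × (Fin d → ℝ) =>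
      ((taylorWeight r q.1 : ℝ) : ℂ) * (G (q.2 + q.1 • z) - G q.2))
      ((volume.restrict (Set.Ioc (0 : ℝ) 1)).prod (volume.restrict K)) := by
  have h0 := integrable_shift hG 0 hK
  simp only [smul_zero, add_zero] at h0
  refine ((integrable_shift hG z hK).sub h0).bdd_mul (c := 1)
    (Continuous.aestronglyMeasurable (by fun_prop)) ?_
  exact Measure.quasiMeasurePreserving_fst.ae (norm_taylorWeight_le r)

/-- By duality: tested against `φ`, all derivatives move to `φ`, where the classical formula
applies, and then the top derivative moves back. The term of order `r + 1` belongs to the Taylor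
polynomial; since the weight has integral `1/(r+1)!`, the remainder involves only differences of the
top derivative, whence its smallness in `L^p` without further smoothness. -/
lemma ae_taylor {f : (Fin d → ℝ) → ℂ} {G : ℕ → (Fin d → ℝ) → ℂ} {r : ℕ} {z : Fin d → ℝ}
    (hf : LocallyIntegrable f volume)
    (h : ∀ k ≤ r + 1, IsWeakDeriv (List.replicate k z) f (G k)) :
    (fun x => f (x + z) - ∑ k ∈ Finset.range (r + 2), (1 / k.factorial : ℂ) * G k x) =ᵐ[volume]
      fun x => ∫ s in Set.Ioc (0 : ℝ) 1,
        ((taylorWeight r s : ℝ) : ℂ) * (G (r + 1) (x + s • z) - G (r + 1) x) := by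
  set ν := volume.restrict (Set.Ioc (0 : ℝ) 1) with hν
  have hGi : ∀ k ∈ Finset.range (r + 2), LocallyIntegrable (G k) volume := fun k hk =>
    (h k (by rw [Finset.mem_range] at hk; omega)).2.1
  have hG := (h (r + 1) le_rfl).2.1
  have hfz := locallyIntegrable_comp_add hf z
  have hsum : LocallyIntegrable
      (fun x => ∑ k ∈ Finset.range (r + 2), (1 / k.factorial : ℂ) * G k x) volume :=
    locallyIntegrable_finsetSum _ fun k hk => (hGi k hk).smul (1 / k.factorial : ℂ)
  refine ae_eq_of_integral_test (hfz.sub hsum) ?_ fun φ hφ hφc => ?_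
  · rw [locallyIntegrable_iff]
    intro K hK
    exact (integrable_taylor_diff hG r z hK).integral_prod_right
  set ψ := dirDeriv (r + 1) z φ with hψ
  have hψs : ContDiff ℝ ∞ ψ := contDiff_iterDeriv hφ _
  have hψ0 : Continuous ψ := hψs.continuous
  have hψc : HasCompactSupport ψ := hasCompactSupport_iterDeriv hφc _
  -- the left side, with the derivatives moved to the test function
  have e1 : ∫ x, ((φ x : ℝ) : ℂ) * (f (x + z) - ∑ k ∈ Finset.range (r + 2),
      (1 / k.factorial : ℂ) * G k x) =
      ∫ x, f x * ∫ s, (((-1) ^ (r + 1) * (taylorWeight r s * (ψ (x - s • z) - ψ x)) : ℝ) : ℂ) ∂ν := by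
    have hφz : Continuous fun x => φ (x - z) := hφ.continuous.comp (by fun_prop)
    have hφzc : HasCompactSupport fun x => φ (x - z) :=
      hφc.comp_homeomorph (Homeomorph.subRight z)
    have i1 := integrable_test_mul hφ.continuous hφc hfz
    have i2 : ∀ k ∈ Finset.range (r + 2), Integrable fun x =>
        (1 / k.factorial : ℂ) * (((φ x : ℝ) : ℂ) * G k x) := fun k hk =>
      (integrable_test_mul hφ.continuous hφc (hGi k hk)).const_mul _
    have i3 : ∀ k ∈ Finset.range (r + 2), Integrable fun x =>
        (1 / k.factorial : ℂ) * ((-1) ^ k * (((dirDeriv k z φ x : ℝ) : ℂ) * f x)) := fun k _ =>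
      ((integrable_test_mul (contDiff_iterDeriv hφ _).continuous
        (hasCompactSupport_iterDeriv hφc _) hf).const_mul _).const_mul _
    have hL : ∀ x, ((φ x : ℝ) : ℂ) * (f (x + z) - ∑ k ∈ Finset.range (r + 2),
        (1 / k.factorial : ℂ) * G k x) = ((φ x : ℝ) : ℂ) * f (x + z) -
          ∑ k ∈ Finset.range (r + 2), (1 / k.factorial : ℂ) * (((φ x : ℝ) : ℂ) * G k x) := by
      intro x
      rw [mul_sub, Finset.mul_sum]
      congr 1
      exact Finset.sum_congr rfl fun k _ => mul_left_comm _ _ _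
    simp_rw [hL]
    rw [integral_sub i1 (integrable_finsetSum _ i2), integral_finsetSum _ i2]
    have e2 : ∫ x, ((φ x : ℝ) : ℂ) * f (x + z) = ∫ x, ((φ (x - z) : ℝ) : ℂ) * f x := by
      rw [← integral_add_right_eq_self (fun x => ((φ (x - z) : ℝ) : ℂ) * f x) z]
      simp
    have e3 : ∀ k ∈ Finset.range (r + 2), ∫ x, (1 / k.factorial : ℂ) * (((φ x : ℝ) : ℂ) * G k x) =
        ∫ x, (1 / k.factorial : ℂ) * ((-1) ^ k * (((dirDeriv k z φ x : ℝ) : ℂ) * f x)) := by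
      intro k hk
      have := (h k (by rw [Finset.mem_range] at hk; omega)).2.2 φ hφ hφc
      rw [List.length_replicate] at this
      rw [integral_const_mul, integral_const_mul, integral_const_mul, this, ← mul_assoc ((-1) ^ k),
        ← mul_pow]
      simp
    rw [e2, Finset.sum_congr rfl e3, ← integral_finsetSum _ i3,
      ← integral_sub (integrable_test_mul hφz hφzc hf) (integrable_finsetSum _ i3)]
    refine integral_congr_ae (ae_of_all _ fun x => ?_)
    simp only
    rw [integral_complex_ofReal, integral_const_mul]
    simp_rw [mul_sub]
    have c1 : Integrable (fun s => taylorWeight r s * ψ (x - s • z)) ν :=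
      (Continuous.integrableOn_Ioc (by fun_prop))
    have c2 : Integrable (fun s => taylorWeight r s * ψ x) ν :=
      (Continuous.integrableOn_Ioc (by fun_prop))
    rw [integral_sub c1 c2, integral_mul_const, hν, integral_taylorWeight, mul_sub,
      ← taylor_dirDeriv hφ r z x, Finset.sum_range_succ _ (r + 1)]
    push_cast
    rw [mul_sub, mul_sub, Finset.mul_sum, mul_comm (f x), sub_sub]
    congr 2
    · exact Finset.sum_congr rfl fun k _ => by ring
    · rw [← hψ]; ring
  -- exchanging the integrals
  have e4 : ∫ x, f x * ∫ s, (((-1) ^ (r + 1) * (taylorWeight r s * (ψ (x - s • z) - ψ x)) : ℝ) : ℂ) ∂ν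
      = ∫ s, (∫ x, f x *
        (((-1) ^ (r + 1) * (taylorWeight r s * (ψ (x - s • z) - ψ x)) : ℝ) : ℂ)) ∂ν := by
    simp_rw [← integral_const_mul]
    obtain ⟨R, hR⟩ := hψc.isCompact.isBounded.exists_norm_le
    obtain ⟨M, hM⟩ := hψc.exists_bound_of_continuous hψ0
    set K := Metric.closedBall (0 : Fin d → ℝ) (R + ‖z‖) with hK
    have hKm : MeasurableSet K := Metric.isClosed_closedBall.measurableSet
    have h1 : Integrable (K.indicator f) volume :=
      (integrable_indicator_iff hKm).2 (hf.integrableOn_isCompact (isCompact_closedBall _ _))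
    have h2 : Integrable (fun q : ℝ × (Fin d → ℝ) => K.indicator f q.2) (ν.prod volume) :=
      h1.comp_snd ν
    have hs : ∀ᵐ q ∂(ν.prod (volume : Measure (Fin d → ℝ))), q.1 ∈ Set.Ioc (0 : ℝ) 1 :=
      Measure.quasiMeasurePreserving_fst.ae (ae_restrict_mem measurableSet_Ioc)
    have h3 := h2.mul_bdd (c := 2 * M) (g := fun q : ℝ × (Fin d → ℝ) =>
      (((-1) ^ (r + 1) * (taylorWeight r q.1 * (ψ (q.2 - q.1 • z) - ψ q.2)) : ℝ) : ℂ))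
      (Continuous.aestronglyMeasurable (by fun_prop)) ?_
    · rw [integral_integral_swap]
      refine (Integrable.swap h3).congr (?_ : _ =ᵐ[volume.prod ν] _)
      have hs' : ∀ᵐ q ∂((volume : Measure (Fin d → ℝ)).prod ν), q.2 ∈ Set.Ioc (0 : ℝ) 1 :=
        Measure.quasiMeasurePreserving_snd.ae (ae_restrict_mem measurableSet_Ioc)
      filter_upwards [hs'] with q hq
      simp only [Function.comp, Prod.swap, Function.uncurry]
      by_cases hqK : q.1 ∈ K
      · rw [Set.indicator_of_mem hqK]
      · rw [Set.indicator_of_notMem hqK, zero_mul]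
        have hn : R + ‖z‖ < ‖q.1‖ := by
          rw [hK, mem_closedBall_zero_iff] at hqK
          linarith
        have hz : ‖q.2 • z‖ ≤ ‖z‖ := by
          rw [norm_smul, Real.norm_of_nonneg hq.1.le]
          exact mul_le_of_le_one_left (norm_nonneg _) hq.2
        have hψ1 : ψ q.1 = 0 := by
          refine image_eq_zero_of_notMem_tsupport fun hmem => ?_
          linarith [hR _ hmem, norm_nonneg z]
        have hψ2 : ψ (q.1 - q.2 • z) = 0 := by
          refine image_eq_zero_of_notMem_tsupport fun hmem => ?_
          have := norm_sub_norm_le q.1 (q.2 • z)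
          linarith [hR _ hmem]
        rw [hψ1, hψ2]; simp
    · filter_upwards [hs] with q hq
      rw [Complex.norm_real, norm_mul, norm_pow, norm_neg, norm_one, one_pow, one_mul, norm_mul,
        Real.norm_of_nonneg (taylorWeight_nonneg r hq.2)]
      refine (mul_le_of_le_one_left (norm_nonneg _)
        (taylorWeight_le_one r hq.1.le hq.2)).trans ?_
      refine (norm_sub_le _ _).trans ?_
      linarith [hM (q.2 - q.1 • z), hM q.2]
  -- moving the derivative back
  have e5 : ∀ s : ℝ, ∫ x, f x * (((-1) ^ (r + 1) * (taylorWeight r s * (ψ (x - s • z) - ψ x)) : ℝ) : ℂ) =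
      ∫ x, ((φ x : ℝ) : ℂ) *
        (((taylorWeight r s : ℝ) : ℂ) * (G (r + 1) (x + s • z) - G (r + 1) x)) := by
    intro s
    have key : ∀ a : Fin d → ℝ, ∫ x, f x * ((ψ (x - a) : ℝ) : ℂ) =
        (-1) ^ (r + 1) * ∫ x, ((φ x : ℝ) : ℂ) * G (r + 1) (x + a) := by
      intro a
      have hφa : ContDiff ℝ ∞ fun x => φ (x - a) := hφ.comp (contDiff_id.sub contDiff_const)
      have hφac : HasCompactSupport fun x => φ (x - a) :=
        hφc.comp_homeomorph (Homeomorph.subRight a)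
      have h1 := (h (r + 1) le_rfl).2.2 _ hφa hφac
      rw [List.length_replicate] at h1
      rw [← integral_add_right_eq_self (fun x => ((φ (x - a) : ℝ) : ℂ) * G (r + 1) x) a] at h1
      simp only [add_sub_cancel_right] at h1
      rw [← h1]
      refine integral_congr_ae (ae_of_all _ fun x => ?_)
      change _ = ((dirDeriv (r + 1) z (fun y => φ (y - a)) x : ℝ) : ℂ) * f x
      rw [dirDeriv_comp_sub, mul_comm]
    have hint : ∀ a : Fin d → ℝ, Integrable fun x => f x * ((ψ (x - a) : ℝ) : ℂ) := by
      intro a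
      have h1 := integrable_test_mul (φ := fun x => ψ (x - a)) (hψ0.comp (by fun_prop))
        (hψc.comp_homeomorph (Homeomorph.subRight a)) hf
      exact h1.congr (ae_of_all _ fun x => mul_comm _ _)
    have k0 := key 0
    have kz := key (s • z)
    have i0 := hint 0
    simp only [sub_zero, add_zero] at k0 i0
    have t1 : ∀ x, f x * (((-1) ^ (r + 1) * (taylorWeight r s * (ψ (x - s • z) - ψ x)) : ℝ) : ℂ) =
        ((-1) ^ (r + 1) * ((taylorWeight r s : ℝ) : ℂ)) *
          (f x * ((ψ (x - s • z) : ℝ) : ℂ) - f x * ((ψ x : ℝ) : ℂ)) := by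
      intro x; push_cast; ring
    have t2 : ∀ x, ((φ x : ℝ) : ℂ) *
        (((taylorWeight r s : ℝ) : ℂ) * (G (r + 1) (x + s • z) - G (r + 1) x)) =
        ((taylorWeight r s : ℝ) : ℂ) * (((φ x : ℝ) : ℂ) * G (r + 1) (x + s • z) -
          ((φ x : ℝ) : ℂ) * G (r + 1) x) := by
      intro x; ring
    simp_rw [t1, t2]
    rw [integral_const_mul, integral_const_mul, integral_sub (hint _) i0, kz, k0,
      integral_sub (integrable_test_mul hφ.continuous hφc (locallyIntegrable_comp_add hG _))
        (integrable_test_mul hφ.continuous hφc hG)]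
    have hsq : ((-1 : ℂ) ^ (r + 1)) * (-1) ^ (r + 1) = 1 := by rw [← mul_pow]; simp
    linear_combination (((taylorWeight r s : ℝ) : ℂ) * (∫ x, ((φ x : ℝ) : ℂ) * G (r + 1) (x + s • z)) -
      ((taylorWeight r s : ℝ) : ℂ) * ∫ x, ((φ x : ℝ) : ℂ) * G (r + 1) x) * hsq
  rw [e1, e4]
  simp_rw [e5, ← integral_const_mul]
  rw [integral_integral_swap]
  set K := tsupport φ with hK
  have h1 := (integrable_taylor_diff hG r z hφc.isCompact)
  obtain ⟨M, hM⟩ := hφc.exists_bound_of_continuous hφ.continuous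
  have h2 := h1.bdd_mul (c := M) (f := fun q : ℝ × (Fin d → ℝ) => ((φ q.2 : ℝ) : ℂ))
    (Continuous.aestronglyMeasurable (by have := hφ.continuous; fun_prop))
    (ae_of_all _ fun q => by rw [Complex.norm_real]; exact hM q.2)
  have hKm : MeasurableSet K := (isClosed_tsupport φ).measurableSet
  have h3 : (ν.prod (volume.restrict K)) =
      (ν.prod (volume : Measure (Fin d → ℝ))).restrict (Set.univ ×ˢ K) := by
    rw [← Measure.prod_restrict, Measure.restrict_univ]
  rw [h3] at h2
  refine (integrableOn_iff_integrable_of_support_subset fun q hq => ?_).1 h2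
  refine ⟨Set.mem_univ _, subset_tsupport _ fun h0 => hq ?_⟩
  simp only [Function.uncurry]
  rw [h0]; simp

end

section

/-! ### The Taylor remainder in `L^p` -/

variable {d n : ℕ} {V : Fin n → Fin d → ℤ}

/-- Borel representatives of the weak derivatives of an element of the Sobolev space. -/
structure SobolevFamily (m : ℕ) (p : ℝ) (F : (Fin d → ℕ) → (Fin d → ℝ) → ℂ) : Prop where
  measurable : ∀ β, Measurable (F β)
  memLp : ∀ β, MemLp (F β) (ENNReal.ofReal p) volume
  isWeakDeriv : ∀ β, ∑ j, β j ≤ m → IsWeakDeriv (multiDirs β) (F 0) (F β)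

lemma multiDirs_zero : multiDirs (0 : Fin d → ℕ) = [] := by
  rw [← List.length_eq_zero_iff, length_multiDirs]; simp

/-- Borel representatives are chosen for all orders at once, with zero beyond order `m`, because the
later uses of Tonelli's theorem need joint measurability. The entry at `0` agrees with `f` by
uniqueness of the derivative of order zero. -/
lemma exists_sobolevFamily {m : ℕ} {p : ℝ} (hp : 1 ≤ p) {f : (Fin d → ℝ) → ℂ}
    (hf : MemSobolev m p f) : ∃ F, SobolevFamily m p F ∧ F 0 =ᵐ[volume] f ∧
      ∀ β : Fin d → ℕ, ∑ j, β j ≤ m → weakDeriv (multiDirs β) f =ᵐ[volume] F β := by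
  have h : ∀ β : Fin d → ℕ, ∃ g : (Fin d → ℝ) → ℂ, Measurable g ∧
      MemLp g (ENNReal.ofReal p) volume ∧ (∑ j, β j ≤ m → IsWeakDeriv (multiDirs β) f g) := by
    intro β
    by_cases hβ : ∑ j, β j ≤ m
    · obtain ⟨g, hg, hgp⟩ := hf.2 β hβ
      exact ⟨_, hgp.1.stronglyMeasurable_mk.measurable, (memLp_congr_ae hgp.1.ae_eq_mk).1 hgp,
        fun _ => hg.congr ae_eq_rfl hgp.1.ae_eq_mk⟩
    · exact ⟨0, measurable_zero, MemLp.zero, fun h => absurd h hβ⟩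
  choose F h1 h2 h3 using h
  have hp' : (1 : ℝ≥0∞) ≤ ENNReal.ofReal p := by simpa using hp
  have hfl := hf.1.locallyIntegrable hp'
  have hF0 : F 0 =ᵐ[volume] f := by
    have e1 := h3 0 (by simp)
    rw [multiDirs_zero] at e1
    exact e1.ae_eq ⟨hfl, hfl, fun φ _ _ => by simp [iterDeriv]⟩
  exact ⟨F, ⟨h1, h2, fun β hβ => (h3 β hβ).congr hF0.symm ae_eq_rfl⟩, hF0,
    fun β hβ => weakDeriv_ae_eq (h3 β hβ)⟩

lemma dirCoeff_replicate (z : Fin d → ℝ) {k : ℕ} {β : Fin d → ℕ} (hβ : β ∈ multi d k) :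
    (dirCoeff (List.replicate k z) β : ℂ) = k.factorial / mfact β * mono β z := by
  refine eq_of_sum_mono_eq (k := k) (a := fun β => (dirCoeff (List.replicate k z) β : ℂ))
    (b := fun β => k.factorial / mfact β * mono β z) (fun w => ?_) hβ
  have h1 := prod_dotProduct_eq_sum (List.replicate k z) (toReal w)
  rw [List.map_replicate, List.prod_replicate, List.length_replicate,
    dotProduct_pow_eq_sum] at h1
  refine Eq.trans (Finset.sum_congr rfl fun β _ => mul_comm _ _) (h1.symm.trans
    (Finset.sum_congr rfl fun β _ => mul_comm _ _))

/-- The part of order `k` of the Taylor polynomial. -/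
def taylorPart (F : (Fin d → ℕ) → (Fin d → ℝ) → ℂ) (k : ℕ) (x z : Fin d → ℝ) : ℂ :=
  ∑ β ∈ multi d k, (mono β z / mfact β) * F β x

/-- The error of the Taylor polynomial of order `m`. -/
def taylorRem (F : (Fin d → ℕ) → (Fin d → ℝ) → ℂ) (m : ℕ) (x z : Fin d → ℝ) : ℂ :=
  F 0 (x + z) - ∑ k ∈ Finset.range (m + 1), taylorPart F k x z

lemma isWeakDeriv_taylorPart {m : ℕ} {p : ℝ} {F : (Fin d → ℕ) → (Fin d → ℝ) → ℂ}
    (hF : SobolevFamily m p F) (z : Fin d → ℝ) {k : ℕ} (hk : k ≤ m) :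
    IsWeakDeriv (List.replicate k z) (F 0) fun x => k.factorial * taylorPart F k x z := by
  have hloc : LocallyIntegrable (F 0) volume := (hF.isWeakDeriv 0 (by simp)).1
  have h := isWeakDeriv_sum (l := List.replicate k z) (F := F) hloc fun β hβ => by
    rw [List.length_replicate, mem_multi] at hβ
    exact hF.isWeakDeriv β (by omega)
  rw [List.length_replicate] at h
  refine h.congr ae_eq_rfl (ae_of_all _ fun x => ?_)
  simp only [taylorPart, Finset.mul_sum]
  refine Finset.sum_congr rfl fun β hβ => ?_
  rw [dirCoeff_replicate z hβ]
  ring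

/-- The integral form of the error of the Taylor polynomial. -/
lemma taylorRem_ae_eq {r : ℕ} {p : ℝ} {F : (Fin d → ℕ) → (Fin d → ℝ) → ℂ}
    (hF : SobolevFamily (r + 1) p F) (z : Fin d → ℝ) :
    ∀ᵐ x, taylorRem F (r + 1) x z = ∫ s in Set.Ioc (0 : ℝ) 1, ((taylorWeight r s : ℝ) : ℂ) *
      ((r + 1).factorial * ∑ β ∈ multi d (r + 1), (mono β z / mfact β) *
        (F β (x + s • z) - F β x)) := by
  have hloc : LocallyIntegrable (F 0) volume := (hF.isWeakDeriv 0 (by simp)).1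
  filter_upwards [ae_taylor (z := z) (r := r) hloc
    fun k hk => isWeakDeriv_taylorPart hF z hk] with x hx
  have h1 : taylorRem F (r + 1) x z = F 0 (x + z) - ∑ k ∈ Finset.range (r + 2),
      (1 / k.factorial : ℂ) * (k.factorial * taylorPart F k x z) := by
    rw [taylorRem]
    congr 1
    refine Finset.sum_congr rfl fun k _ => ?_
    have : (k.factorial : ℂ) ≠ 0 := by exact_mod_cast k.factorial_ne_zero
    field_simp
  rw [h1, hx]
  congr 1
  ext s
  simp only [taylorPart]
  rw [← mul_sub, ← Finset.sum_sub_distrib]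
  simp_rw [mul_sub]

/-! ### The modulus of continuity of the top derivatives -/

/-- The `L^p` modulus of continuity, as a power, of the derivatives of order `m`. -/
def transMod (m : ℕ) (p : ℝ) (F : (Fin d → ℕ) → (Fin d → ℝ) → ℂ) (δ : ℝ) : ℝ≥0∞ :=
  ⨆ (z : Fin d → ℝ) (_ : ‖z‖ ≤ δ), ∑ β ∈ multi d m, ∫⁻ x, ‖F β (x + z) - F β x‖ₑ ^ p

lemma le_transMod {m : ℕ} {p : ℝ} (F : (Fin d → ℕ) → (Fin d → ℝ) → ℂ) {δ : ℝ} {z : Fin d → ℝ}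
    (hz : ‖z‖ ≤ δ) :
    ∑ β ∈ multi d m, ∫⁻ x, ‖F β (x + z) - F β x‖ₑ ^ p ≤ transMod m p F δ :=
  le_iSup₂ (f := fun (z : Fin d → ℝ) (_ : ‖z‖ ≤ δ) =>
    ∑ β ∈ multi d m, ∫⁻ x, ‖F β (x + z) - F β x‖ₑ ^ p) z hz

lemma monotone_transMod (m : ℕ) (p : ℝ) (F : (Fin d → ℕ) → (Fin d → ℝ) → ℂ) :
    Monotone (transMod m p F) := by
  intro δ δ' h
  exact iSup₂_le fun z hz => le_transMod F (hz.trans h)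

lemma tendsto_lintegral_translate {p : ℝ} (hp : 1 ≤ p) {f : (Fin d → ℝ) → ℂ}
    (hf : MemLp f (ENNReal.ofReal p) volume) :
    Tendsto (fun z : Fin d → ℝ => ∫⁻ x, ‖f (x + z) - f x‖ₑ ^ p) (𝓝 0) (𝓝 0) := by
  have : Fact (1 ≤ ENNReal.ofReal p) := ⟨by simpa using hp⟩
  have : Fact (ENNReal.ofReal p ≠ ⊤) := ⟨ENNReal.ofReal_ne_top⟩
  set f' := hf.toLp f
  have hc : Continuous fun z : Fin d → ℝ => DomAddAct.mk z +ᵥ f' := by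
    have : Continuous fun z : Fin d → ℝ => DomAddAct.mk z := DomAddAct.continuous_mk
    exact this.vadd continuous_const
  have h1 : Tendsto (fun z : Fin d → ℝ => edist (DomAddAct.mk z +ᵥ f') f') (𝓝 0) (𝓝 0) := by
    have := (hc.edist (continuous_const (y := f'))).tendsto 0
    simpa using this
  have h2 : ∀ z : Fin d → ℝ, edist (DomAddAct.mk z +ᵥ f') f' ^ p =
      ∫⁻ x, ‖f (x + z) - f x‖ₑ ^ p := by
    intro z
    rw [Lp.edist_def, eLpNorm_rpow _ hp]
    refine lintegral_congr_ae ?_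
    have e1 := hf.coeFn_toLp
    have e2 := DomAddAct.vadd_Lp_ae_eq (DomAddAct.mk z) f'
    have e3 := (measurePreserving_add_right (volume : Measure (Fin d → ℝ)) z).quasiMeasurePreserving.ae e1
    filter_upwards [e1, e2, e3] with x h1 h2 h3
    rw [Pi.sub_apply, h2, h1]
    simp only [DomAddAct.mk, vadd_eq_add]
    rw [add_comm x z] at h3
    rw [add_comm x z]
    congr 2
    congr 1
  simp_rw [← h2]
  have h3 := h1.ennrpow_const p
  rwa [ENNReal.zero_rpow_of_pos (by linarith)] at h3

lemma tendsto_transMod {m : ℕ} {p : ℝ} (hp : 1 ≤ p) {F : (Fin d → ℕ) → (Fin d → ℝ) → ℂ}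
    (hF : ∀ β, MemLp (F β) (ENNReal.ofReal p) volume) :
    Tendsto (transMod m p F) (𝓝[≥] 0) (𝓝 0) := by
  have h1 : Tendsto (fun z : Fin d → ℝ => ∑ β ∈ multi d m, ∫⁻ x, ‖F β (x + z) - F β x‖ₑ ^ p)
      (𝓝 0) (𝓝 0) := by
    have := tendsto_finsetSum (multi d m) fun β _ => tendsto_lintegral_translate hp (hF β)
    simpa using this
  rw [ENNReal.tendsto_nhds_zero] at h1 ⊢
  intro ε hε
  obtain ⟨η, hη, hball⟩ := Metric.eventually_nhds_iff.1 (h1 ε hε)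
  have : ∀ᶠ δ : ℝ in 𝓝[≥] 0, δ < η := nhdsWithin_le_nhds (Iio_mem_nhds hη)
  filter_upwards [this] with δ hδ
  exact iSup₂_le fun z hz => hball (by rw [dist_zero_right]; linarith)

lemma exists_transMod_le {m : ℕ} {p : ℝ} (hp : 1 ≤ p) {F : (Fin d → ℕ) → (Fin d → ℝ) → ℂ}
    (hF : ∀ β, MemLp (F β) (ENNReal.ofReal p) volume) :
    ∃ M : ℝ≥0, ∀ δ, transMod m p F δ ≤ M := by
  have hp0 : 0 ≤ p := by linarith
  set M : ℝ≥0∞ := ∑ β ∈ multi d m, (2 * eLpNorm (F β) (ENNReal.ofReal p) volume) ^ p with hM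
  have hM1 : M ≠ ⊤ := by
    refine ENNReal.sum_ne_top.2 fun β _ => ENNReal.rpow_ne_top_of_nonneg hp0 ?_
    exact ENNReal.mul_ne_top (by simp) (hF β).2.ne
  refine ⟨M.toNNReal, fun δ => ?_⟩
  rw [ENNReal.coe_toNNReal hM1]
  refine iSup₂_le fun z _ => Finset.sum_le_sum fun β _ => ?_
  have hmp := measurePreserving_add_right (volume : Measure (Fin d → ℝ)) z
  rw [← eLpNorm_rpow _ hp]
  refine ENNReal.rpow_le_rpow ?_ hp0
  refine (eLpNorm_sub_le ((hF β).1.comp_measurePreserving hmp) (hF β).1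
    (by simpa using hp)).trans ?_
  have : eLpNorm (fun x => F β (x + z)) (ENNReal.ofReal p) volume =
      eLpNorm (F β) (ENNReal.ofReal p) volume :=
    eLpNorm_comp_measurePreserving (hF β).1 hmp
  rw [two_mul]
  exact add_le_add this.le le_rfl

lemma enorm_taylor_le (r : ℕ) {w : ℂ} (hw : ‖w‖ ≤ 1) (a : (Fin d → ℕ) → ℂ) (z : Fin d → ℝ) :
    ‖w * ((r + 1).factorial * ∑ β ∈ multi d (r + 1), (mono β z / mfact β) * a β)‖ₑ ≤
      (r + 1).factorial * ENNReal.ofReal (‖z‖ ^ (r + 1)) * ∑ β ∈ multi d (r + 1), ‖a β‖ₑ := by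
  have hw' : ‖w‖ₑ ≤ 1 := by
    rw [← ofReal_norm]; exact ENNReal.ofReal_le_one.2 hw
  have hA : ‖((r + 1).factorial : ℂ)‖ₑ = (r + 1).factorial := by
    rw [← ofReal_norm, Complex.norm_natCast, ENNReal.ofReal_natCast]
  rw [enorm_mul, enorm_mul, hA, mul_assoc _ (ENNReal.ofReal _)]
  refine (mul_le_of_le_one_left zero_le hw').trans ?_
  refine mul_le_mul' le_rfl ((enorm_sum_le _ _).trans ?_)
  rw [Finset.mul_sum]
  refine Finset.sum_le_sum fun β hβ => ?_
  rw [enorm_mul]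
  refine mul_le_mul' ?_ le_rfl
  rw [← ofReal_norm]
  refine ENNReal.ofReal_le_ofReal ?_
  rw [norm_div, Complex.norm_natCast]
  have h1 : (1 : ℝ) ≤ mfact β := by
    exact_mod_cast Nat.one_le_iff_ne_zero.2 (by exact_mod_cast mfact_ne_zero β)
  have h2 := norm_mono_le β z
  rw [mem_multi.1 hβ] at h2
  exact (div_le_self (norm_nonneg _) h1).trans h2

/-- Jensen's inequality in `s` and the power mean inequality over the multi-indices reduce the claim
to differences of the top derivatives under the shift `sz`, and `‖sz‖ ≤ ‖z‖`. The constant does not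
depend on `F`. -/
lemma lintegral_taylorRem_le (d : ℕ) (r : ℕ) {p : ℝ} (hp : 1 ≤ p) : ∃ K : ℝ≥0,
    ∀ F : (Fin d → ℕ) → (Fin d → ℝ) → ℂ, SobolevFamily (r + 1) p F → ∀ z : Fin d → ℝ,
      ∫⁻ x, ‖taylorRem F (r + 1) x z‖ₑ ^ p ≤
        K * ENNReal.ofReal (‖z‖ ^ (r + 1)) ^ p * transMod (r + 1) p F ‖z‖ := by
  have hp0 : 0 ≤ p := by linarith
  refine ⟨((r + 1).factorial : ℝ≥0) ^ p * ((multi d (r + 1)).card : ℝ≥0) ^ (p - 1),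
    fun F hF z => ?_⟩
  rw [ENNReal.coe_mul, ENNReal.coe_rpow_of_nonneg _ hp0,
    ENNReal.coe_rpow_of_nonneg _ (by linarith), ENNReal.coe_natCast, ENNReal.coe_natCast]
  obtain ⟨ν, hν⟩ : ∃ ν : Measure ℝ, ν = volume.restrict (Set.Ioc (0 : ℝ) 1) := ⟨_, rfl⟩
  have : IsProbabilityMeasure ν := ⟨by simp [hν]⟩
  obtain ⟨c, hc⟩ : ∃ c : ℝ≥0∞, c = (r + 1).factorial * ENNReal.ofReal (‖z‖ ^ (r + 1)) := ⟨_, rfl⟩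
  obtain ⟨H, hH⟩ : ∃ H : (Fin d → ℝ) → ℝ → ℝ≥0∞, H = fun x s =>
    ∑ β ∈ multi d (r + 1), ‖F β (x + s • z) - F β x‖ₑ := ⟨_, rfl⟩
  have hHm : Measurable (Function.uncurry H) := by
    simp only [Function.uncurry_def, hH]
    refine Finset.measurable_fun_sum _ fun β _ => ?_
    have := hF.measurable β
    fun_prop
  have hHx : ∀ x, Measurable (H x) := fun x => hHm.comp measurable_prodMk_left
  have h1 : ∀ᵐ x, ‖taylorRem F (r + 1) x z‖ₑ ≤ c * ∫⁻ s, H x s ∂ν := by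
    filter_upwards [taylorRem_ae_eq hF z] with x hx
    rw [hx, ← lintegral_const_mul _ (hHx x), hν]
    refine (enorm_integral_le_lintegral_enorm _).trans (lintegral_mono_ae ?_)
    filter_upwards [norm_taylorWeight_le r] with s hs
    rw [hc, hH]
    exact enorm_taylor_le r hs _ z
  have h2 : ∫⁻ x, (∫⁻ s, H x s ∂ν) ^ p ≤ ∫⁻ s, (∫⁻ x, H x s ^ p) ∂ν := by
    have := lintegral_lintegral_rpow_le (μ := (volume : Measure (Fin d → ℝ))) (ν := ν)
      (κ := fun _ => 1) measurable_const hHm.aemeasurable hp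
    simpa using this
  have h3 : ∀ s ∈ Set.Ioc (0 : ℝ) 1, ∫⁻ x, H x s ^ p ≤
      (multi d (r + 1)).card ^ (p - 1) * transMod (r + 1) p F ‖z‖ := by
    intro s hs
    have e1 : ∀ x, H x s ^ p ≤ (multi d (r + 1)).card ^ (p - 1) *
        ∑ β ∈ multi d (r + 1), ‖F β (x + s • z) - F β x‖ₑ ^ p := by
      intro x
      rw [hH]
      exact ENNReal.rpow_sum_le_const_mul_sum_rpow _ _ hp
    refine (lintegral_mono e1).trans ?_
    have hm : ∀ β, Measurable fun x => ‖F β (x + s • z) - F β x‖ₑ ^ p := by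
      intro β
      have := hF.measurable β
      fun_prop
    rw [lintegral_const_mul _ (Finset.measurable_fun_sum _ fun β _ => hm β),
      lintegral_finsetSum _ fun β _ => hm β]
    refine mul_le_mul' le_rfl (le_transMod F ?_)
    rw [norm_smul, Real.norm_of_nonneg hs.1.le]
    exact mul_le_of_le_one_left (norm_nonneg _) hs.2
  calc ∫⁻ x, ‖taylorRem F (r + 1) x z‖ₑ ^ p
      ≤ ∫⁻ x, c ^ p * (∫⁻ s, H x s ∂ν) ^ p := by
        refine lintegral_mono_ae ?_
        filter_upwards [h1] with x hx
        rw [← ENNReal.mul_rpow_of_nonneg _ _ hp0]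
        exact ENNReal.rpow_le_rpow hx hp0
    _ = c ^ p * ∫⁻ x, (∫⁻ s, H x s ∂ν) ^ p :=
        lintegral_const_mul _ (hHm.lintegral_prod_right.pow_const p)
    _ ≤ c ^ p * ((multi d (r + 1)).card ^ (p - 1) * transMod (r + 1) p F ‖z‖) := by
        refine mul_le_mul' le_rfl (h2.trans ?_)
        have h4 : ∫⁻ s, (∫⁻ x, H x s ^ p) ∂ν ≤
            ∫⁻ _s, (multi d (r + 1)).card ^ (p - 1) * transMod (r + 1) p F ‖z‖ ∂ν := by
          refine lintegral_mono_ae ?_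
          rw [hν]
          filter_upwards [ae_restrict_mem measurableSet_Ioc] with s hs using h3 s hs
        simpa using h4
    _ = _ := by
        rw [hc, ENNReal.mul_rpow_of_nonneg _ _ hp0]
        ring

end

section

/-! ### The asymptotic expansion of the error -/

variable {d n : ℕ} {V : Fin n → Fin d → ℤ}

lemma mono_smul (h : ℝ) (β : Fin d → ℕ) (x : Fin d → ℝ) :
    mono β (h • x) = (h : ℂ) ^ (∑ j, β j) * mono β x := by
  simp only [mono, Pi.smul_apply, smul_eq_mul, Complex.ofReal_mul, mul_pow, Finset.prod_mul_distrib,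
    Finset.prod_pow_eq_pow_sum]

lemma taylorPart_zero_left (F : (Fin d → ℕ) → (Fin d → ℝ) → ℂ) (x z : Fin d → ℝ) :
    taylorPart F 0 x z = F 0 x := by
  have h : multi d 0 = {0} := by
    ext β
    rw [mem_multi, Finset.mem_singleton]
    constructor
    · intro h; ext j; simpa using (Finset.sum_eq_zero_iff.1 h) j (Finset.mem_univ j)
    · rintro rfl; simp
  simp [taylorPart, h, mono, mfact]

lemma mono_zero_right {k : ℕ} {β : Fin d → ℕ} (hβ : β ∈ multi d (k + 1)) : mono β 0 = 0 := by
  have h := norm_mono_le β 0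
  rw [mem_multi.1 hβ, norm_zero, zero_pow (by omega)] at h
  exact norm_le_zero_iff.1 h

/-- The leading term of the error of the projection at scale `h`. -/
def leading (V : Fin n → Fin d → ℤ) (F : (Fin d → ℕ) → (Fin d → ℝ) → ℂ) (t x : Fin d → ℝ) : ℂ :=
  ∑ β ∈ multi d (rho V + 1), F β t * bernCoeffSum V β x

/-- Replace `F 0 (h y)` by its Taylor polynomial at `x` plus the remainder and project at `y₀ =
x/h`. In the variable `y` the monomials centred at `x` become `h^k (y - y₀)^β`. Order zero returns
`F 0 x`, the orders `1, …, ϱ` vanish at the centre, and order `ϱ + 1` gives the leading term. -/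
lemma projFun_sub_ae_eq (hV : Admissible V) (hU : Unimodular V) {p : ℝ} (hp : 1 ≤ p)
    {F : (Fin d → ℕ) → (Fin d → ℝ) → ℂ} (hF : SobolevFamily (rho V + 1) p F) {h : ℝ} (hh : h ≠ 0) :
    ∀ᵐ x, projFun V (fun y => F 0 (h • y)) (h⁻¹ • x) - F 0 x =
      (h : ℂ) ^ (rho V + 1) * leading V F x (h⁻¹ • x) +
        projFun V (fun y => taylorRem F (rho V + 1) x (h • y - x)) (h⁻¹ • x) := by
  filter_upwards [(quasiMeasurePreserving_smul (d := d) (inv_ne_zero hh)).ae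
    (projFun_mono_sub hV hU)] with x hx
  set m := rho V + 1 with hm
  set y₀ := h⁻¹ • x with hy₀
  have hg : SlowGrowth fun y => F 0 (h • y) :=
    slowGrowth_of_memLp (by simpa using hp) (memLp_comp_smul hp (hF.memLp 0) hh)
  have hmono : ∀ k, ∀ β ∈ multi d k, ∀ y : Fin d → ℝ, mono β (h • y - x) =
      (h : ℂ) ^ k * mono β (y - y₀) := by
    intro k β hβ y
    rw [← mem_multi.1 hβ, ← mono_smul, smul_sub, hy₀, smul_inv_smul₀ hh]
  have hrem : (fun y => taylorRem F m x (h • y - x)) = fun y => F 0 (h • y) +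
      ∑ k ∈ Finset.range (m + 1), ∑ β ∈ multi d k,
        (-((h : ℂ) ^ k / mfact β * F β x)) * mono β (y - y₀) := by
    ext y
    rw [taylorRem, add_sub_cancel, sub_eq_add_neg, ← Finset.sum_neg_distrib]
    congr 1
    refine Finset.sum_congr rfl fun k _ => ?_
    rw [taylorPart, ← Finset.sum_neg_distrib]
    refine Finset.sum_congr rfl fun β hβ => ?_
    rw [hmono k β hβ]; ring
  have hs : ∀ k, ∀ β ∈ multi d k, SlowGrowth fun y =>
      (-((h : ℂ) ^ k / mfact β * F β x)) * mono β (y - y₀) := fun k β _ =>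
    (slowGrowth_mono_sub β y₀).const_mul _
  rw [hrem, projFun_add hV hU hg (SlowGrowth.finset_sum _ fun k _ => SlowGrowth.finset_sum _ (hs k)),
    projFun_finset_sum hV hU _ fun k _ => SlowGrowth.finset_sum _ (hs k)]
  have h1 : ∀ k ∈ Finset.range m, projFun V (fun y => ∑ β ∈ multi d k,
      (-((h : ℂ) ^ k / mfact β * F β x)) * mono β (y - y₀)) y₀ = if k = 0 then -F 0 x else 0 := by
    intro k hk
    rw [Finset.mem_range] at hk
    rw [projFun_finset_sum hV hU _ (hs k)]
    have h2 : ∀ β ∈ multi d k, projFun V (fun y =>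
        (-((h : ℂ) ^ k / mfact β * F β x)) * mono β (y - y₀)) y₀ =
        -((h : ℂ) ^ k / mfact β * F β x) * mono β 0 := by
      intro β hβ
      rw [projFun_const_mul, hx k hk.le β hβ, if_neg (by omega), add_zero]
    rw [Finset.sum_congr rfl h2]
    rcases k with _ | k
    · rw [if_pos rfl, ← taylorPart_zero_left F x 0, taylorPart, ← Finset.sum_neg_distrib]
      exact Finset.sum_congr rfl fun β _ => by ring
    · rw [if_neg (by omega)]
      exact Finset.sum_eq_zero fun β hβ => by rw [mono_zero_right hβ, mul_zero]
  have h3 : projFun V (fun y => ∑ β ∈ multi d m,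
      (-((h : ℂ) ^ m / mfact β * F β x)) * mono β (y - y₀)) y₀ =
      -((h : ℂ) ^ m * leading V F x y₀) := by
    rw [projFun_finset_sum hV hU _ (hs m), leading, Finset.mul_sum, ← Finset.sum_neg_distrib]
    refine Finset.sum_congr rfl fun β hβ => ?_
    rw [projFun_const_mul, hx m le_rfl β hβ, if_pos rfl, mono_zero_right hβ, zero_add]
    field_simp [mfact_ne_zero β]
  rw [Finset.sum_range_succ, h3, Finset.sum_congr rfl h1, Finset.sum_ite_eq',
    if_pos (Finset.mem_range.2 (by omega))]
  ring

/-! ### The remainder is negligible -/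

/-- The additional `m ⌈p⌉` powers of decay pay for the factor `‖z‖^(mp)` from the Taylor remainder
and leave an integrable weight. The kernel bound can afford them because its order of decay is
arbitrary. -/
lemma decay_mul_le (m : ℕ) {p : ℝ} (hp : 1 ≤ p) (z : Fin d → ℝ) :
    decay d (d + 1 + m * ⌈p⌉₊) z * ENNReal.ofReal (‖z‖ ^ m) ^ p ≤ decay d (d + 1) z := by
  have h0 : 1 ≤ 1 + ‖z‖ := by linarith [norm_nonneg z]
  have h1 : ENNReal.ofReal (‖z‖ ^ m) ^ p ≤ ENNReal.ofReal ((1 + ‖z‖) ^ (m * ⌈p⌉₊)) := by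
    have e1 : ENNReal.ofReal (‖z‖ ^ m) ≤ ENNReal.ofReal ((1 + ‖z‖) ^ m) :=
      ENNReal.ofReal_le_ofReal (pow_le_pow_left₀ (norm_nonneg z) (by linarith) m)
    have e2 : 1 ≤ ENNReal.ofReal ((1 + ‖z‖) ^ m) := by
      rw [ENNReal.one_le_ofReal]; exact one_le_pow₀ h0
    refine (ENNReal.rpow_le_rpow e1 (by linarith)).trans
      ((ENNReal.rpow_le_rpow_of_exponent_le e2 (Nat.le_ceil p)).trans ?_)
    rw [ENNReal.rpow_natCast, ← ENNReal.ofReal_pow (by positivity), ← pow_mul]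
  refine (mul_le_mul' le_rfl h1).trans ?_
  rw [decay, decay, ← ENNReal.ofReal_mul (by positivity)]
  refine ENNReal.ofReal_le_ofReal (le_of_eq ?_)
  rw [pow_add]
  field_simp

lemma measurable_taylorRem {m : ℕ} {p : ℝ} {F : (Fin d → ℕ) → (Fin d → ℝ) → ℂ}
    (hF : SobolevFamily m p F) : Measurable (Function.uncurry (taylorRem F m)) := by
  simp only [Function.uncurry_def, taylorRem, taylorPart]
  refine Measurable.sub ?_ (Finset.measurable_fun_sum _ fun k _ =>
    Finset.measurable_fun_sum _ fun β _ => ?_)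
  · have := hF.measurable 0
    fun_prop
  · have h1 := hF.measurable β
    have h2 := (continuous_mono β).measurable
    fun_prop

lemma tendsto_lintegral_decay_transMod {m : ℕ} {p : ℝ} (hp : 1 ≤ p)
    {F : (Fin d → ℕ) → (Fin d → ℝ) → ℂ} (hF : ∀ β, MemLp (F β) (ENNReal.ofReal p) volume) :
    Tendsto (fun h : ℝ => ∫⁻ z : Fin d → ℝ, decay d (d + 1) z * transMod m p F (h * ‖z‖))
      (𝓝[>] 0) (𝓝 0) := by
  obtain ⟨M, hM⟩ := exists_transMod_le (m := m) hp hF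
  have hfin : ∫⁻ z : Fin d → ℝ, decay d (d + 1) z * M ≠ ⊤ := by
    rw [lintegral_mul_const _ (measurable_decay _)]
    exact ENNReal.mul_ne_top (lintegral_decay_lt_top le_rfl).ne ENNReal.coe_ne_top
  have h := tendsto_lintegral_filter_of_dominated_convergence (l := 𝓝[>] (0 : ℝ))
    (F := fun (h : ℝ) (z : Fin d → ℝ) => decay d (d + 1) z * transMod m p F (h * ‖z‖))
    (f := fun _ => 0) (μ := volume) (fun z => decay d (d + 1) z * M)
    (Eventually.of_forall fun h => ?_) (Eventually.of_forall fun h => ae_of_all _ fun z =>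
      mul_le_mul' le_rfl (hM _)) hfin (ae_of_all _ fun z => ?_)
  · simpa using h
  · refine (measurable_decay _).mul ?_
    exact (monotone_transMod m p F).measurable.comp (by fun_prop)
  · have h1 : Tendsto (fun h : ℝ => h * ‖z‖) (𝓝[>] 0) (𝓝[≥] 0) := by
      refine tendsto_nhdsWithin_iff.2 ⟨?_, ?_⟩
      · have : Tendsto (fun h : ℝ => h * ‖z‖) (𝓝 0) (𝓝 (0 * ‖z‖)) :=
          (continuous_id.mul continuous_const).tendsto 0
        rw [zero_mul] at this
        exact this.mono_left nhdsWithin_le_nhds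
      · filter_upwards [self_mem_nhdsWithin] with h hh
        exact mul_nonneg (le_of_lt hh) (norm_nonneg z)
    have h2 := ENNReal.Tendsto.const_mul (a := decay d (d + 1) z) ((tendsto_transMod (m := m) hp hF).comp h1)
      (Or.inr ENNReal.ofReal_ne_top)
    rwa [mul_zero] at h2

/-- The contribution of the Taylor remainder is of smaller order. -/
lemma exists_remainder_bound (hV : Admissible V) (hU : Unimodular V) {p : ℝ} (hp : 1 ≤ p)
    {F : (Fin d → ℕ) → (Fin d → ℝ) → ℂ} (hF : SobolevFamily (rho V + 1) p F) :
    ∃ e : ℝ → ℝ≥0∞, Tendsto e (𝓝[>] 0) (𝓝 0) ∧ ∀ h : ℝ, 0 < h →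
      ∫⁻ x, ‖projFun V (fun y => taylorRem F (rho V + 1) x (h • y - x)) (h⁻¹ • x)‖ₑ ^ p ≤
        ENNReal.ofReal (h ^ (rho V + 1)) ^ p * e h := by
  have hp0 : 0 ≤ p := by linarith
  obtain ⟨m, hm⟩ : ∃ m, m = rho V + 1 := ⟨_, rfl⟩
  obtain ⟨N, hN⟩ : ∃ N, N = d + 1 + m * ⌈p⌉₊ := ⟨_, rfl⟩
  obtain ⟨C, hC⟩ := exists_kernel_bound hV hU N
  obtain ⟨K, hK⟩ := lintegral_taylorRem_le d (rho V) hp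
  have hrm := measurable_taylorRem hF
  rw [← hm] at hF hK hrm ⊢
  obtain ⟨A, hA⟩ : ∃ A : ℝ≥0∞, A = C ^ p * ((∫⁻ z, decay d N z) ^ (p - 1) * K) := ⟨_, rfl⟩
  have hAt : A ≠ ⊤ := by
    rw [hA]
    refine ENNReal.mul_ne_top (ENNReal.rpow_ne_top_of_nonneg hp0 ENNReal.coe_ne_top)
      (ENNReal.mul_ne_top (ENNReal.rpow_ne_top_of_nonneg (by linarith) ?_) ENNReal.coe_ne_top)
    exact (lintegral_decay_lt_top (by omega)).ne
  refine ⟨fun h => A * ∫⁻ z : Fin d → ℝ, decay d (d + 1) z * transMod m p F (h * ‖z‖), ?_,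
    fun h hh => ?_⟩
  · have := ENNReal.Tendsto.const_mul (a := A) (tendsto_lintegral_decay_transMod (m := m) hp hF.memLp)
      (Or.inr hAt)
    rwa [mul_zero] at this
  have hm1 : Measurable (Function.uncurry fun x z : Fin d → ℝ => ‖taylorRem F m x (h • z)‖ₑ) := by
    have : Measurable fun q : (Fin d → ℝ) × (Fin d → ℝ) => (q.1, h • q.2) := by fun_prop
    exact (hrm.comp this).enorm
  have h1 : ∀ x, ‖projFun V (fun y => taylorRem F m x (h • y - x)) (h⁻¹ • x)‖ₑ ^ p ≤
      C ^ p * (∫⁻ z, decay d N z * ‖taylorRem F m x (h • z)‖ₑ) ^ p := by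
    intro x
    rw [← ENNReal.mul_rpow_of_nonneg _ _ hp0]
    refine ENNReal.rpow_le_rpow ((enorm_projFun_le _ _).trans ?_) hp0
    have hmx : Measurable fun y : Fin d → ℝ => taylorRem F m x (h • y - x) := by
      have : Measurable fun y : Fin d → ℝ => (x, h • y - x) := by fun_prop
      exact hrm.comp this
    refine (hC _ hmx.aemeasurable _).trans (le_of_eq ?_)
    congr 2
    ext z
    rw [smul_add, smul_inv_smul₀ hh.ne', add_sub_cancel_left]
  calc ∫⁻ x, ‖projFun V (fun y => taylorRem F m x (h • y - x)) (h⁻¹ • x)‖ₑ ^ p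
      ≤ ∫⁻ x, C ^ p * (∫⁻ z, decay d N z * ‖taylorRem F m x (h • z)‖ₑ) ^ p := lintegral_mono h1
    _ = C ^ p * ∫⁻ x, (∫⁻ z, decay d N z * ‖taylorRem F m x (h • z)‖ₑ) ^ p :=
        lintegral_const_mul' _ _ (ENNReal.rpow_ne_top_of_nonneg hp0 ENNReal.coe_ne_top)
    _ ≤ C ^ p * ((∫⁻ z, decay d N z) ^ (p - 1) *
          ∫⁻ z, decay d N z * ∫⁻ x, ‖taylorRem F m x (h • z)‖ₑ ^ p) :=
        mul_le_mul' le_rfl (lintegral_lintegral_rpow_le (measurable_decay N) hm1.aemeasurable hp)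
    _ ≤ C ^ p * ((∫⁻ z, decay d N z) ^ (p - 1) *
          ∫⁻ z : Fin d → ℝ, K * ENNReal.ofReal (h ^ m) ^ p *
            (decay d (d + 1) z * transMod m p F (h * ‖z‖))) := by
        refine mul_le_mul' le_rfl (mul_le_mul' le_rfl (lintegral_mono fun z => ?_))
        refine (mul_le_mul' le_rfl (hK F hF (h • z))).trans ?_
        have e1 : ENNReal.ofReal (‖h • z‖ ^ m) ^ p =
            ENNReal.ofReal (h ^ m) ^ p * ENNReal.ofReal (‖z‖ ^ m) ^ p := by
          rw [norm_smul, Real.norm_of_nonneg hh.le, mul_pow, ENNReal.ofReal_mul (by positivity),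
            ENNReal.mul_rpow_of_nonneg _ _ hp0]
        have e2 : ‖h • z‖ = h * ‖z‖ := by rw [norm_smul, Real.norm_of_nonneg hh.le]
        rw [e1, e2]
        calc decay d N z * (K * (ENNReal.ofReal (h ^ m) ^ p * ENNReal.ofReal (‖z‖ ^ m) ^ p) *
              transMod m p F (h * ‖z‖)) = K * ENNReal.ofReal (h ^ m) ^ p *
              ((decay d N z * ENNReal.ofReal (‖z‖ ^ m) ^ p) * transMod m p F (h * ‖z‖)) := by ring
          _ ≤ _ := by
            refine mul_le_mul' le_rfl (mul_le_mul' ?_ le_rfl)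
            rw [hN]
            exact decay_mul_le m hp z
    _ = _ := by
        rw [lintegral_const_mul' _ _ (ENNReal.mul_ne_top ENNReal.coe_ne_top
          (ENNReal.rpow_ne_top_of_nonneg hp0 ENNReal.ofReal_ne_top)), hA]
        ring

end

section

/-! ### The limit of the error -/

variable {d n : ℕ} {V : Fin n → Fin d → ℤ}

/-- The integral over the unit cube of a periodic function is invariant under translations. -/
lemma lintegral_cube_shift {Φ : (Fin d → ℝ) → ℝ≥0∞} (hΦ : Measurable Φ)
    (hper : ∀ (x : Fin d → ℝ) (γ : Fin d → ℤ), Φ (x + toReal γ) = Φ x) (a : Fin d → ℝ) :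
    ∫⁻ τ in cube d, Φ (a + τ) = ∫⁻ τ in cube d, Φ τ := by
  have hm := measurableSet_cell (d := d) 0
  have h1 : ∫⁻ τ in cube d, Φ (a + τ) =
      ∫⁻ x, (cell 0).indicator 1 (x - a) * Φ x := by
    rw [← setLIntegral_congr cell_zero_ae_eq, ← lintegral_indicator hm,
      ← lintegral_add_right_eq_self (fun x => (cell 0).indicator 1 (x - a) * Φ x) a]
    refine lintegral_congr fun x => ?_
    rw [add_sub_cancel_right, add_comm x a]
    by_cases hx : x ∈ cell (0 : Fin d → ℤ) <;> simp [hx]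
  rw [h1, lintegral_eq_tsum_cube, ← lintegral_tsum]
  · refine lintegral_congr fun x => ?_
    simp_rw [hper]
    rw [ENNReal.tsum_mul_right]
    -- The integer translates of the half-open cell tile space: exactly one of them contains a given
    -- point.
    have h2 : ∑' γ : Fin d → ℤ, (cell (0 : Fin d → ℤ)).indicator (1 : (Fin d → ℝ) → ℝ≥0∞)
        (x + toReal γ - a) = 1 := by
      rw [tsum_eq_single (fun j => -⌊x j - a j⌋) fun γ hγ => ?_]
      · refine Set.indicator_of_mem (fun j => ?_) _
        have : (x + toReal (fun j => -⌊x j - a j⌋) - a) j = x j - a j - ⌊x j - a j⌋ := by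
          simp only [toReal, Pi.sub_apply, Pi.add_apply]
          push_cast
          ring
        rw [this]; simp
      · refine Set.indicator_of_notMem (fun hx => hγ ?_) _
        ext j
        have h3 := hx j
        have : (x + toReal γ - a) j = x j - a j + γ j := by simp [toReal]; ring
        rw [this, Int.floor_add_intCast, Pi.zero_apply] at h3
        omega
    rw [h2, one_mul]
  · intro γ
    refine (Measurable.mul ?_ ?_).aemeasurable
    · exact (measurable_one.indicator hm).comp (by fun_prop)
    · exact hΦ.comp (by fun_prop)

lemma tendsto_of_le_add {ι : Type*} {l : Filter ι} {a e : ι → ℝ≥0∞} {b : ℝ≥0∞} (hb : b ≠ ⊤)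
    (he : Tendsto e l (𝓝 0)) (h1 : ∀ᶠ i in l, a i ≤ b + e i) (h2 : ∀ᶠ i in l, b ≤ a i + e i) :
    Tendsto a l (𝓝 b) := by
  have t1 : Tendsto (fun i => b + e i) l (𝓝 b) := by
    simpa using tendsto_const_nhds.add he
  have t2 : Tendsto (fun i => b - e i) l (𝓝 b) := by
    simpa using ENNReal.Tendsto.sub (tendsto_const_nhds (x := b)) he (Or.inl hb)
  refine tendsto_of_tendsto_of_tendsto_of_le_of_le' t2 t1 ?_ h1
  filter_upwards [h2] with i hi
  exact tsub_le_iff_right.2 hi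

lemma enorm_sum_mul_rpow_le {ι : Type*} (s : Finset ι) {p : ℝ} (hp : 1 ≤ p) {M : ℝ≥0∞}
    (u Φ : ι → ℂ) (hΦ : ∀ i ∈ s, ‖Φ i‖ₑ ≤ M) :
    ‖∑ i ∈ s, u i * Φ i‖ₑ ^ p ≤ s.card ^ (p - 1) * M ^ p * ∑ i ∈ s, ‖u i‖ₑ ^ p := by
  have hp0 : 0 ≤ p := by linarith
  have h1 : ‖∑ i ∈ s, u i * Φ i‖ₑ ≤ M * ∑ i ∈ s, ‖u i‖ₑ := by
    refine (enorm_sum_le _ _).trans ?_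
    rw [Finset.mul_sum]
    refine Finset.sum_le_sum fun i hi => ?_
    rw [enorm_mul, mul_comm]
    exact mul_le_mul' (hΦ i hi) le_rfl
  refine (ENNReal.rpow_le_rpow h1 hp0).trans ?_
  rw [ENNReal.mul_rpow_of_nonneg _ _ hp0, mul_comm (_ ^ (p - 1)), mul_assoc]
  exact mul_le_mul' le_rfl (ENNReal.rpow_sum_le_const_mul_sum_rpow _ _ hp)

lemma measurable_bernCoeffSum (hV : Admissible V) (hU : Unimodular V) (β : Fin d → ℕ) :
    Measurable (bernCoeffSum V β) := by
  unfold bernCoeffSum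
  exact Finset.measurable_fun_sum _ fun U hUL => (measurable_bernoulliSpline hV hU hUL).const_mul _

lemma exists_enorm_bernoulliSpline_le (hV : Admissible V) (hU : Unimodular V) :
    ∃ M : ℝ≥0, ∀ U ∈ Lam V, ∀ x, ‖bernoulliSpline V U x‖ₑ ≤ M := by
  have h : ∀ U : Finset (Fin n), ∃ C : ℝ≥0, U ∈ Lam V → ∀ x, ‖bernoulliSpline V U x‖ₑ ≤ C := by
    intro U
    by_cases hUL : U ∈ Lam V
    · obtain ⟨C, hC⟩ := exists_norm_bernoulliSpline_le hV hU hUL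
      refine ⟨C.toNNReal, fun _ x => ?_⟩
      rw [← ofReal_norm]
      exact ENNReal.ofReal_le_ofReal (hC x)
    · exact ⟨0, fun h => absurd h hUL⟩
  choose C hC using h
  refine ⟨∑ U ∈ Lam V, C U, fun U hUL x => (hC U hUL x).trans ?_⟩
  exact_mod_cast Finset.single_le_sum (f := C) (fun _ _ => zero_le) hUL

lemma exists_enorm_bernCoeffSum_le (hV : Admissible V) (hU : Unimodular V) :
    ∃ M : ℝ≥0, ∀ β ∈ multi d (rho V + 1), ∀ x, ‖bernCoeffSum V β x‖ₑ ≤ M := by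
  obtain ⟨M, hM⟩ := exists_enorm_bernoulliSpline_le hV hU
  set C : (Fin d → ℕ) → ℝ≥0 := fun β => ∑ U ∈ Lam V, ‖(dirCoeff (setDirs V U) β : ℂ)‖₊ * M
  refine ⟨∑ β ∈ multi d (rho V + 1), C β, fun β hβ x => ?_⟩
  have h1 : ‖bernCoeffSum V β x‖ₑ ≤ C β := by
    refine (enorm_sum_le _ _).trans ?_
    push_cast [C]
    refine Finset.sum_le_sum fun U hUL => ?_
    rw [enorm_mul]
    exact mul_le_mul' le_rfl (hM U hUL x)
  refine h1.trans ?_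
  exact_mod_cast Finset.single_le_sum (f := C) (fun _ _ => zero_le) hβ

lemma bernCoeffSum_add_int (β : Fin d → ℕ) (x : Fin d → ℝ) (γ : Fin d → ℤ) :
    bernCoeffSum V β (x + toReal γ) = bernCoeffSum V β x := by
  simp only [bernCoeffSum, bernoulliSpline_add_int]

lemma measurable_leading (hV : Admissible V) (hU : Unimodular V) {m : ℕ} {p : ℝ}
    {F : (Fin d → ℕ) → (Fin d → ℝ) → ℂ} (hF : SobolevFamily m p F) :
    Measurable (Function.uncurry (leading V F)) := by
  simp only [Function.uncurry_def, leading]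
  refine Finset.measurable_fun_sum _ fun β _ => ?_
  have h1 := hF.measurable β
  have h2 := measurable_bernCoeffSum hV hU β
  fun_prop

/-- The asymptotic error in terms of the leading term. -/
def leadingIntegral (V : Fin n → Fin d → ℤ) (p : ℝ) (F : (Fin d → ℕ) → (Fin d → ℝ) → ℂ) : ℝ≥0∞ :=
  ∫⁻ t, ∫⁻ x in cube d, ‖leading V F t x‖ₑ ^ p

lemma leadingIntegral_lt_top (hV : Admissible V) (hU : Unimodular V) {p : ℝ} (hp : 1 ≤ p)
    {m : ℕ} {F : (Fin d → ℕ) → (Fin d → ℝ) → ℂ} (hF : SobolevFamily m p F) :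
    leadingIntegral V p F < ⊤ := by
  have hp0 : 0 ≤ p := by linarith
  obtain ⟨M, hM⟩ := exists_enorm_bernCoeffSum_le hV hU
  have h1 : leadingIntegral V p F ≤ ∫⁻ t, ∫⁻ _x in cube d, (multi d (rho V + 1)).card ^ (p - 1) *
      M ^ p * ∑ β ∈ multi d (rho V + 1), ‖F β t‖ₑ ^ p :=
    lintegral_mono fun t => lintegral_mono fun x =>
      enorm_sum_mul_rpow_le _ hp _ _ fun β hβ => hM β hβ x
  refine h1.trans_lt ?_
  simp only [lintegral_const, Measure.restrict_apply_univ, volume_cube, mul_one]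
  have hc : (((multi d (rho V + 1)).card : ℝ≥0∞) ^ (p - 1) * (M : ℝ≥0∞) ^ p) ≠ ⊤ :=
    ENNReal.mul_ne_top (ENNReal.rpow_ne_top_of_nonneg (by linarith) (ENNReal.natCast_ne_top _))
      (ENNReal.rpow_ne_top_of_nonneg hp0 ENNReal.coe_ne_top)
  rw [lintegral_const_mul' _ _ hc, lintegral_finsetSum _ fun β _ => by
    have := hF.measurable β
    fun_prop]
  exact ENNReal.mul_lt_top hc.lt_top (ENNReal.sum_lt_top.2 fun β _ =>
    lintegral_lt_top_of_memLp hp (hF.memLp β))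

lemma eLpNorm_eq_of_lintegral_eq {X Y : Type*} [MeasurableSpace X] [MeasurableSpace Y]
    {μ : Measure X} {ν : Measure Y} {f : X → ℂ} {g : Y → ℂ} {p : ℝ} (hp : 1 ≤ p)
    (h : ∫⁻ x, ‖f x‖ₑ ^ p ∂μ = ∫⁻ y, ‖g y‖ₑ ^ p ∂ν) :
    eLpNorm f (ENNReal.ofReal p) μ = eLpNorm g (ENNReal.ofReal p) ν := by
  rw [← eLpNorm_rpow f hp, ← eLpNorm_rpow g hp] at h
  exact ENNReal.rpow_left_injective (by linarith) h

lemma measurable_leading_comp (hV : Admissible V) (hU : Unimodular V) {m : ℕ} {p : ℝ}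
    {F : (Fin d → ℕ) → (Fin d → ℝ) → ℂ} (hF : SobolevFamily m p F) {X : Type*} [MeasurableSpace X]
    {a b : X → Fin d → ℝ} (ha : Measurable a) (hb : Measurable b) :
    Measurable fun q => leading V F (a q) (b q) :=
  (measurable_leading hV hU hF).comp (ha.prodMk hb)

/-- The product of Lebesgue measure with Lebesgue measure on the unit cube. -/
abbrev prodCube (d : ℕ) : Measure ((Fin d → ℝ) × (Fin d → ℝ)) :=
  (volume : Measure (Fin d → ℝ)).prod (volume.restrict (cube d))

/-- Translating `x` by `hτ` changes no integral over `ℝ^d`, and averaging over `τ` in a cube of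
volume one changes nothing either. The fast variable now moves by a full period while the slow one
moves only by `hτ`. -/
lemma eLpNorm_leading_shift (hV : Admissible V) (hU : Unimodular V) {p : ℝ} (hp : 1 ≤ p)
    {F : (Fin d → ℕ) → (Fin d → ℝ) → ℂ} (hF : SobolevFamily (rho V + 1) p F) {h : ℝ} (hh : 0 < h) :
    eLpNorm (fun x => leading V F x (h⁻¹ • x)) (ENNReal.ofReal p) volume =
      eLpNorm (fun q => leading V F (q.1 + h • q.2) (h⁻¹ • q.1 + q.2)) (ENNReal.ofReal p)
        (prodCube d) := by
  refine eLpNorm_eq_of_lintegral_eq hp ?_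
  have hm := (measurable_leading_comp hV hU hF
    (a := fun q : (Fin d → ℝ) × (Fin d → ℝ) => q.1 + h • q.2)
    (b := fun q => h⁻¹ • q.1 + q.2) (by fun_prop) (by fun_prop)).enorm.pow_const p
  rw [lintegral_prod_symm _ hm.aemeasurable]
  have h1 : ∀ τ : Fin d → ℝ, ∫⁻ x, ‖leading V F (x + h • τ) (h⁻¹ • x + τ)‖ₑ ^ p =
      ∫⁻ x, ‖leading V F x (h⁻¹ • x)‖ₑ ^ p := by
    intro τ
    rw [← lintegral_add_right_eq_self (fun x => ‖leading V F x (h⁻¹ • x)‖ₑ ^ p) (h • τ)]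
    simp_rw [smul_add, inv_smul_smul₀ hh.ne']
  simp_rw [h1]
  simp

/-- By periodicity in the second variable the offset `h⁻¹ x` is immaterial, so the limit is an
integral over the same product space as the averaged norm, for every `h`. -/
lemma leadingIntegral_eq_shift (hV : Admissible V) (hU : Unimodular V) {p : ℝ}
    {F : (Fin d → ℕ) → (Fin d → ℝ) → ℂ} (hF : SobolevFamily (rho V + 1) p F) (h : ℝ) :
    leadingIntegral V p F = ∫⁻ x, ∫⁻ τ in cube d, ‖leading V F x (h⁻¹ • x + τ)‖ₑ ^ p := by
  refine lintegral_congr fun x => ?_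
  have hm : Measurable fun y => ‖leading V F x y‖ₑ ^ p :=
    (measurable_leading_comp hV hU hF (a := fun _ => x) (b := fun y => y)
      measurable_const measurable_id).enorm.pow_const p
  refine (lintegral_cube_shift hm (fun y γ => ?_) _).symm
  simp only [leading, bernCoeffSum_add_int]

lemma rpow_leadingIntegral (hV : Admissible V) (hU : Unimodular V) {p : ℝ} (hp : 1 ≤ p)
    {F : (Fin d → ℕ) → (Fin d → ℝ) → ℂ} (hF : SobolevFamily (rho V + 1) p F) (h : ℝ) :
    leadingIntegral V p F ^ (1 / p) =
      eLpNorm (fun q => leading V F q.1 (h⁻¹ • q.1 + q.2)) (ENNReal.ofReal p) (prodCube d) := by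
  have hp0 : 0 < p := by linarith
  have hm := (measurable_leading_comp hV hU hF
    (a := fun q : (Fin d → ℝ) × (Fin d → ℝ) => q.1)
    (b := fun q => h⁻¹ • q.1 + q.2) (by fun_prop) (by fun_prop)).enorm.pow_const p
  have h1 : leadingIntegral V p F =
      eLpNorm (fun q => leading V F q.1 (h⁻¹ • q.1 + q.2)) (ENNReal.ofReal p) (prodCube d) ^ p := by
    rw [eLpNorm_rpow _ hp, leadingIntegral_eq_shift hV hU hF h]
    exact (lintegral_prod _ hm.aemeasurable).symm
  rw [h1, ← ENNReal.rpow_mul, mul_one_div_cancel hp0.ne', ENNReal.rpow_one]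

lemma norm_le_one_of_mem_cube {τ : Fin d → ℝ} (hτ : τ ∈ cube d) : ‖τ‖ ≤ 1 :=
  (pi_norm_le_iff_of_nonneg zero_le_one).2 fun j => by
    rw [Real.norm_of_nonneg (hτ.1 j)]
    exact hτ.2 j

/-- The two integrands contain the same bounded periodic factors and differ only by the shift `hτ`
of the derivatives, with `‖hτ‖ ≤ h`. -/
lemma exists_eLpNorm_leading_sub_le (hV : Admissible V) (hU : Unimodular V) {p : ℝ} (hp : 1 ≤ p)
    {F : (Fin d → ℕ) → (Fin d → ℝ) → ℂ} (hF : SobolevFamily (rho V + 1) p F) :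
    ∃ A : ℝ≥0∞, A ≠ ⊤ ∧ ∀ h : ℝ, 0 < h →
      eLpNorm (fun q => leading V F (q.1 + h • q.2) (h⁻¹ • q.1 + q.2) -
        leading V F q.1 (h⁻¹ • q.1 + q.2)) (ENNReal.ofReal p) (prodCube d) ≤
      (A * transMod (rho V + 1) p F h) ^ (1 / p) := by
  have hp0 : 0 < p := by linarith
  obtain ⟨M, hM⟩ := exists_enorm_bernCoeffSum_le hV hU
  obtain ⟨A, hA⟩ : ∃ A : ℝ≥0∞, A = (multi d (rho V + 1)).card ^ (p - 1) * (M : ℝ≥0∞) ^ p := ⟨_, rfl⟩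
  have hAt : A ≠ ⊤ := by
    rw [hA]
    exact ENNReal.mul_ne_top (ENNReal.rpow_ne_top_of_nonneg (by linarith)
      (ENNReal.natCast_ne_top _)) (ENNReal.rpow_ne_top_of_nonneg hp0.le ENNReal.coe_ne_top)
  refine ⟨A, hAt, fun h hh => ?_⟩
  rw [one_div, ENNReal.le_rpow_inv_iff hp0, eLpNorm_rpow _ hp]
  have hm3 : ∀ β, Measurable fun q : (Fin d → ℝ) × (Fin d → ℝ) =>
      ‖F β (q.1 + h • q.2) - F β q.1‖ₑ ^ p := by
    intro β
    have := hF.measurable β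
    fun_prop
  calc ∫⁻ q, ‖leading V F (q.1 + h • q.2) (h⁻¹ • q.1 + q.2) -
        leading V F q.1 (h⁻¹ • q.1 + q.2)‖ₑ ^ p ∂(prodCube d)
      ≤ ∫⁻ q, A * ∑ β ∈ multi d (rho V + 1), ‖F β (q.1 + h • q.2) - F β q.1‖ₑ ^ p
          ∂(prodCube d) := by
        refine lintegral_mono fun q => ?_
        simp only [leading]
        rw [← Finset.sum_sub_distrib, hA]
        simp_rw [← sub_mul]
        exact enorm_sum_mul_rpow_le _ hp _ _ fun β hβ => hM β hβ _
    _ = A * ∫⁻ τ in cube d, ∑ β ∈ multi d (rho V + 1), ∫⁻ x, ‖F β (x + h • τ) - F β x‖ₑ ^ p := by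
        rw [lintegral_const_mul' _ _ hAt, lintegral_prod_symm _
          (Finset.measurable_fun_sum _ fun β _ => hm3 β).aemeasurable]
        congr 1
        refine lintegral_congr fun τ => ?_
        exact lintegral_finsetSum _ fun β _ => (hm3 β).comp measurable_prodMk_right
    _ ≤ A * ∫⁻ _τ in cube d, transMod (rho V + 1) p F h := by
        refine mul_le_mul' le_rfl (lintegral_mono_ae ?_)
        filter_upwards [ae_restrict_mem measurableSet_cube] with τ hτ
        refine le_transMod F ?_
        rw [norm_smul, Real.norm_of_nonneg hh.le]
        exact mul_le_of_le_one_right hh.le (norm_le_one_of_mem_cube hτ)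
    _ = _ := by simp

lemma tendsto_leading (hV : Admissible V) (hU : Unimodular V) {p : ℝ} (hp : 1 ≤ p)
    {F : (Fin d → ℕ) → (Fin d → ℝ) → ℂ} (hF : SobolevFamily (rho V + 1) p F) :
    Tendsto (fun h : ℝ => eLpNorm (fun x => leading V F x (h⁻¹ • x)) (ENNReal.ofReal p) volume)
      (𝓝[>] 0) (𝓝 (leadingIntegral V p F ^ (1 / p))) := by
  have hp0 : 0 < p := by linarith
  have hp1 : 1 ≤ ENNReal.ofReal p := by simpa using hp
  obtain ⟨A, hAt, hd⟩ := exists_eLpNorm_leading_sub_le hV hU hp hF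
  have hm1 : ∀ h : ℝ, AEStronglyMeasurable (fun q => leading V F (q.1 + h • q.2) (h⁻¹ • q.1 + q.2))
      (prodCube d) := fun h =>
    (measurable_leading_comp hV hU hF (by fun_prop) (by fun_prop)).aestronglyMeasurable
  have hm2 : ∀ h : ℝ, AEStronglyMeasurable (fun q => leading V F q.1 (h⁻¹ • q.1 + q.2))
      (prodCube d) := fun h =>
    (measurable_leading_comp hV hU hF (by fun_prop) (by fun_prop)).aestronglyMeasurable
  refine tendsto_of_le_add (e := fun h => (A * transMod (rho V + 1) p F h) ^ (1 / p)) ?_ ?_ ?_ ?_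
  · exact ENNReal.rpow_ne_top_of_nonneg (by positivity) (leadingIntegral_lt_top hV hU hp hF).ne
  · have h1 : Tendsto (transMod (rho V + 1) p F) (𝓝[>] 0) (𝓝 0) :=
      (tendsto_transMod hp hF.memLp).mono_left (nhdsWithin_mono _ Set.Ioi_subset_Ici_self)
    have h2 := (ENNReal.Tendsto.const_mul (a := A) h1 (Or.inr hAt)).ennrpow_const (1 / p)
    rwa [mul_zero, ENNReal.zero_rpow_of_pos (by positivity)] at h2
  · filter_upwards [self_mem_nhdsWithin] with h hh
    rw [eLpNorm_leading_shift hV hU hp hF hh, rpow_leadingIntegral hV hU hp hF h]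
    refine le_trans ?_ (add_le_add le_rfl (hd h hh))
    refine le_trans (le_of_eq ?_) (eLpNorm_add_le (hm2 h) ((hm1 h).sub (hm2 h)) hp1)
    congr 1
    ext q
    simp
  · filter_upwards [self_mem_nhdsWithin] with h hh
    rw [eLpNorm_leading_shift hV hU hp hF hh, rpow_leadingIntegral hV hU hp hF h]
    refine le_trans ?_ (add_le_add le_rfl (hd h hh))
    refine le_trans (le_of_eq ?_) (eLpNorm_sub_le (hm1 h) ((hm1 h).sub (hm2 h)) hp1)
    congr 1
    ext q
    simp

/-- The limit of the error of the projection. -/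
lemma tendsto_error (hV : Admissible V) (hU : Unimodular V) {p : ℝ} (hp : 1 ≤ p)
    {f : (Fin d → ℝ) → ℂ} {F : (Fin d → ℕ) → (Fin d → ℝ) → ℂ}
    (hF : SobolevFamily (rho V + 1) p F) (hf : F 0 =ᵐ[volume] f) :
    Tendsto (fun h : ℝ => eLpNorm (fun x => (f x - projScaled V h f x) / (h : ℂ) ^ (rho V + 1))
      (ENNReal.ofReal p) volume ^ p) (𝓝[>] 0) (𝓝 (leadingIntegral V p F)) := by
  have hp0 : 0 < p := by linarith
  have hp1 : 1 ≤ ENNReal.ofReal p := by simpa using hp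
  obtain ⟨e, he, hR⟩ := exists_remainder_bound hV hU hp hF
  have hmL : ∀ h : ℝ, AEStronglyMeasurable (fun x => leading V F x (h⁻¹ • x)) volume := fun h =>
    ((measurable_leading hV hU hF).comp (g := Function.uncurry (leading V F))
      (f := fun x : Fin d → ℝ => (x, h⁻¹ • x)) (by fun_prop)).aestronglyMeasurable
  have hmT : ∀ h : ℝ, AEStronglyMeasurable (fun x =>
      (projFun V (fun y => F 0 (h • y)) (h⁻¹ • x) - F 0 x) / (h : ℂ) ^ (rho V + 1)) volume := by
    intro h
    have h1 : Measurable (projFun V fun y => F 0 (h • y)) := measurable_bsSum _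
    have h2 := hF.measurable 0
    exact Measurable.aestronglyMeasurable (by fun_prop)
  have hT : ∀ h : ℝ, 0 < h →
      eLpNorm (fun x => (f x - projScaled V h f x) / (h : ℂ) ^ (rho V + 1)) (ENNReal.ofReal p) volume =
      eLpNorm (fun x => (projFun V (fun y => F 0 (h • y)) (h⁻¹ • x) - F 0 x) /
        (h : ℂ) ^ (rho V + 1)) (ENNReal.ofReal p) volume := by
    intro h hh
    rw [← eLpNorm_neg]
    refine eLpNorm_congr_ae ?_
    have h1 := projScaled_ae_eq hV hU hh.ne' hp ((memLp_congr_ae hf).1 (hF.memLp 0))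
    have h2 : projFun V (fun y => f (h • y)) = projFun V fun y => F 0 (h • y) :=
      projFun_congr ((quasiMeasurePreserving_smul hh.ne').ae hf.symm)
    filter_upwards [h1, hf] with x hx1 hx2
    rw [Pi.neg_apply, hx1, h2, hx2]
    ring
  have hRn : ∀ h : ℝ, 0 < h → eLpNorm (fun x =>
      (projFun V (fun y => F 0 (h • y)) (h⁻¹ • x) - F 0 x) / (h : ℂ) ^ (rho V + 1) -
        leading V F x (h⁻¹ • x)) (ENNReal.ofReal p) volume ≤ e h ^ (1 / p) := by
    intro h hh
    rw [one_div, ENNReal.le_rpow_inv_iff hp0, eLpNorm_rpow _ hp]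
    have hc : ENNReal.ofReal (h ^ (rho V + 1)) ^ p ≠ 0 :=
      (ENNReal.rpow_pos (ENNReal.ofReal_pos.2 (by positivity)) ENNReal.ofReal_ne_top).ne'
    have hc' : ENNReal.ofReal (h ^ (rho V + 1)) ^ p ≠ ⊤ :=
      ENNReal.rpow_ne_top_of_nonneg hp0.le ENNReal.ofReal_ne_top
    refine (ENNReal.mul_le_mul_iff_right hc hc').1 (le_trans (le_of_eq ?_) (hR h hh))
    rw [← lintegral_const_mul' _ _ hc']
    refine lintegral_congr_ae ?_
    filter_upwards [projFun_sub_ae_eq hV hU hp hF hh.ne'] with x hx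
    have hh0 : (h : ℂ) ^ (rho V + 1) ≠ 0 := pow_ne_zero _ (by exact_mod_cast hh.ne')
    have h3 : ENNReal.ofReal (h ^ (rho V + 1)) = ‖(h : ℂ) ^ (rho V + 1)‖ₑ := by
      rw [← ofReal_norm, norm_pow, Complex.norm_real, Real.norm_of_nonneg hh.le]
    rw [h3, ← ENNReal.mul_rpow_of_nonneg _ _ hp0.le, ← enorm_mul, hx]
    congr 2
    field_simp
    ring
  have key : Tendsto (fun h : ℝ => eLpNorm (fun x => (f x - projScaled V h f x) /
      (h : ℂ) ^ (rho V + 1)) (ENNReal.ofReal p) volume) (𝓝[>] 0)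
      (𝓝 (leadingIntegral V p F ^ (1 / p))) := by
    have hL := tendsto_leading hV hU hp hF
    have he' : Tendsto (fun h => e h ^ (1 / p)) (𝓝[>] 0) (𝓝 0) := by
      have := he.ennrpow_const (1 / p)
      rwa [ENNReal.zero_rpow_of_pos (by positivity)] at this
    have hfin := ENNReal.rpow_ne_top_of_nonneg (y := 1 / p) (by positivity)
      (leadingIntegral_lt_top hV hU hp hF).ne
    have u1 : Tendsto (fun h => eLpNorm (fun x => leading V F x (h⁻¹ • x)) (ENNReal.ofReal p) volume +
        e h ^ (1 / p)) (𝓝[>] 0) (𝓝 (leadingIntegral V p F ^ (1 / p))) := by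
      simpa using hL.add he'
    have u2 : Tendsto (fun h => eLpNorm (fun x => leading V F x (h⁻¹ • x)) (ENNReal.ofReal p) volume -
        e h ^ (1 / p)) (𝓝[>] 0) (𝓝 (leadingIntegral V p F ^ (1 / p))) := by
      simpa using ENNReal.Tendsto.sub hL he' (Or.inl hfin)
    refine tendsto_of_tendsto_of_tendsto_of_le_of_le' u2 u1 ?_ ?_
    · filter_upwards [self_mem_nhdsWithin] with h hh
      rw [hT h hh]
      refine tsub_le_iff_right.2 (le_trans ?_ (add_le_add le_rfl (hRn h hh)))
      refine le_trans (le_of_eq ?_) (eLpNorm_sub_le (hmT h) ((hmT h).sub (hmL h)) hp1)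
      congr 1
      ext x
      simp
    · filter_upwards [self_mem_nhdsWithin] with h hh
      rw [hT h hh]
      refine le_trans ?_ (add_le_add le_rfl (hRn h hh))
      refine le_trans (le_of_eq ?_) (eLpNorm_add_le (hmL h) ((hmT h).sub (hmL h)) hp1)
      congr 1
      ext x
      simp
  have h1 := key.ennrpow_const p
  rwa [← ENNReal.rpow_mul, one_div_mul_cancel hp0.ne', ENNReal.rpow_one] at h1

end

section

/-! ### The asymptotic error integral -/

variable {d n : ℕ} {V : Fin n → Fin d → ℤ}

lemma SobolevFamily.isWeakDeriv_of_ae_eq {m : ℕ} {p : ℝ} {F : (Fin d → ℕ) → (Fin d → ℝ) → ℂ}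
    (hF : SobolevFamily m p F) {f : (Fin d → ℝ) → ℂ} (hf : F 0 =ᵐ[volume] f) {β : Fin d → ℕ}
    (hβ : β ∈ multi d m) : IsWeakDeriv (multiDirs β) f (F β) :=
  (hF.isWeakDeriv β (mem_multi.1 hβ).le).congr hf ae_eq_rfl

/-- The derivative `D_U` in terms of the partial derivatives. -/
def dirSum (V : Fin n → Fin d → ℤ) (F : (Fin d → ℕ) → (Fin d → ℝ) → ℂ) (U : Finset (Fin n))
    (t : Fin d → ℝ) : ℂ :=
  ∑ β ∈ multi d (rho V + 1), (dirCoeff (setDirs V U) β : ℂ) * F β t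

lemma isWeakDeriv_dirSum {p : ℝ} {F : (Fin d → ℕ) → (Fin d → ℝ) → ℂ}
    (hF : SobolevFamily (rho V + 1) p F) {f : (Fin d → ℝ) → ℂ} (hf : F 0 =ᵐ[volume] f)
    {U : Finset (Fin n)} (hUL : U ∈ Lam V) : IsWeakDeriv (setDirs V U) f (dirSum V F U) := by
  have hl : (setDirs V U).length = rho V + 1 := by rw [length_setDirs, (mem_Lam.1 hUL).1]
  have hloc : LocallyIntegrable f volume := (hF.isWeakDeriv 0 (by simp)).1.congr hf
  have h := isWeakDeriv_sum (l := setDirs V U) (F := F) hloc fun β hβ =>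
    hF.isWeakDeriv_of_ae_eq hf (hl ▸ hβ)
  rw [hl] at h
  exact h

lemma memLp_dirSum {p : ℝ} {m : ℕ} {F : (Fin d → ℕ) → (Fin d → ℝ) → ℂ}
    (hF : SobolevFamily m p F) (U : Finset (Fin n)) :
    MemLp (dirSum V F U) (ENNReal.ofReal p) volume :=
  memLp_finsetSum _ fun β _ => (hF.memLp β).const_mul _

/-- The coefficients of `∏_{v∈U} v·X` occur twice: in the error on monomials and in the expansion of
`D_U` into partial derivatives. Exchanging the sums identifies the two integrands. -/
lemma leading_eq_sum (F : (Fin d → ℕ) → (Fin d → ℝ) → ℂ) (t x : Fin d → ℝ) :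
    leading V F t x = ∑ U ∈ Lam V, dirSum V F U t * bernoulliSpline V U x := by
  simp_rw [leading, bernCoeffSum, dirSum, Finset.mul_sum, Finset.sum_mul]
  rw [Finset.sum_comm]
  exact Finset.sum_congr rfl fun U _ => Finset.sum_congr rfl fun β _ => by ring

lemma errorIntegral_eq (hV : Admissible V) (hU : Unimodular V) {p : ℝ}
    {F : (Fin d → ℕ) → (Fin d → ℝ) → ℂ} (hF : SobolevFamily (rho V + 1) p F)
    {f : (Fin d → ℝ) → ℂ} (hf : F 0 =ᵐ[volume] f) :
    errorIntegral V p f = leadingIntegral V p F := by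
  have h1 : ∀ᵐ t, ∀ β ∈ multi d (rho V + 1), weakDeriv (multiDirs β) f t = F β t :=
    (Filter.eventually_all_finset _).2 fun β hβ =>
      weakDeriv_ae_eq (hF.isWeakDeriv_of_ae_eq hf hβ)
  refine lintegral_congr_ae ?_
  filter_upwards [h1] with t ht
  refine lintegral_congr_ae ?_
  filter_upwards [ae_restrict_of_ae (Lfun_ae_eq hV hU)] with x hx
  congr 2
  refine Finset.sum_congr rfl fun β hβ => ?_
  rw [ht β hβ, hx β hβ]
  have h2 := mfact_ne_zero β
  change 1 / (mfact β : ℂ) * _ * _ = _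
  field_simp

lemma ae_weakDeriv_eq_dirSum {p : ℝ} {F : (Fin d → ℕ) → (Fin d → ℝ) → ℂ}
    (hF : SobolevFamily (rho V + 1) p F) {f : (Fin d → ℝ) → ℂ} (hf : F 0 =ᵐ[volume] f) :
    ∀ᵐ t, ∀ U ∈ Lam V, weakDeriv (setDirs V U) f t = dirSum V F U t :=
  (Filter.eventually_all_finset _).2 fun _ hUL => weakDeriv_ae_eq (isWeakDeriv_dirSum hF hf hUL)

lemma bernoulliIntegral_eq {p : ℝ} {F : (Fin d → ℕ) → (Fin d → ℝ) → ℂ}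
    (hF : SobolevFamily (rho V + 1) p F) {f : (Fin d → ℝ) → ℂ} (hf : F 0 =ᵐ[volume] f) :
    bernoulliIntegral V p f = leadingIntegral V p F := by
  refine lintegral_congr_ae ?_
  filter_upwards [ae_weakDeriv_eq_dirSum hF hf] with t ht
  refine lintegral_congr fun x => ?_
  rw [leading_eq_sum]
  congr 2
  exact Finset.sum_congr rfl fun U hUL => by rw [ht U hUL]

lemma sobolevSum_eq {p : ℝ} {F : (Fin d → ℕ) → (Fin d → ℝ) → ℂ}
    (hF : SobolevFamily (rho V + 1) p F) {f : (Fin d → ℝ) → ℂ} (hf : F 0 =ᵐ[volume] f) :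
    sobolevSum V p f = ∫⁻ t, ∑ U ∈ Lam V, ‖dirSum V F U t‖ₑ ^ p *
      ∫⁻ x in cube d, ‖bernoulliSpline V U x‖ₑ ^ p := by
  have hm : ∀ U, AEMeasurable (fun t => ‖dirSum V F U t‖ₑ ^ p) volume := fun U =>
    (memLp_dirSum hF U).1.enorm.pow_const p
  rw [lintegral_finsetSum' _ fun U _ => (hm U).mul_const _, sobolevSum]
  refine Finset.sum_congr rfl fun U hUL => ?_
  rw [lintegral_mul_const'' _ (hm U)]
  congr 1
  refine lintegral_congr_ae ?_
  filter_upwards [ae_weakDeriv_eq_dirSum hF hf] with t ht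
  rw [ht U hUL]

/-! ### Combinations of Bernoulli splines -/

/-- The combination `∑_U u_U B(V,U)`. -/
def bernComb (V : Fin n → Fin d → ℤ) (u : Finset (Fin n) → ℂ) (x : Fin d → ℝ) : ℂ :=
  ∑ U ∈ Lam V, u U * bernoulliSpline V U x

lemma measurable_bernComb (hV : Admissible V) (hU : Unimodular V) (u : Finset (Fin n) → ℂ) :
    Measurable (bernComb V u) := by
  unfold bernComb
  exact Finset.measurable_fun_sum _ fun U hUL => (measurable_bernoulliSpline hV hU hUL).const_mul _

lemma integral_bernComb_mul_conj (hV : Admissible V) (hU : Unimodular V) (u : Finset (Fin n) → ℂ)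
    {U : Finset (Fin n)} (hUL : U ∈ Lam V) :
    ∫ x in cube d, bernComb V u x * (starRingEnd ℂ) (bernoulliSpline V U x) =
      u U * ((∫ x in cube d, ‖bernoulliSpline V U x‖ ^ 2 : ℝ) : ℂ) := by
  simp_rw [bernComb, Finset.sum_mul, mul_assoc]
  rw [integral_finsetSum]
  · simp_rw [integral_const_mul]
    rw [Finset.sum_eq_single U]
    · congr 1
      rw [← integral_complex_ofReal]
      congr 1
      ext x
      rw [Complex.mul_conj, Complex.normSq_eq_norm_sq]
    · intro U' hU' hne
      rw [integral_bernoulliSpline_mul_conj hV hU hU' hUL hne, mul_zero]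
    · exact fun h => absurd hUL h
  · intro U' hU'
    have h1 : Integrable (bernoulliSpline V U') (volume.restrict (cube d)) :=
      memLp_one_iff_integrable.1 (memLp_bernoulliSpline hV hU hU' 1)
    obtain ⟨C, hC⟩ := exists_norm_bernoulliSpline_le hV hU hUL
    refine (h1.mul_bdd (c := C) ?_ (ae_of_all _ fun x => ?_)).const_mul _
    · exact (Complex.continuous_conj.measurable.comp
        (measurable_bernoulliSpline hV hU hUL)).aestronglyMeasurable
    · rw [RCLike.norm_conj]; exact hC x

lemma lintegral_bernComb_rpow_le (hV : Admissible V) (hU : Unimodular V) {p : ℝ} (hp : 1 ≤ p)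
    (u : Finset (Fin n) → ℂ) :
    ∫⁻ x in cube d, ‖bernComb V u x‖ₑ ^ p ≤ (Lam V).card ^ (p - 1) *
      ∑ U ∈ Lam V, ‖u U‖ₑ ^ p * ∫⁻ x in cube d, ‖bernoulliSpline V U x‖ₑ ^ p := by
  have hp0 : 0 ≤ p := by linarith
  have h1 : ∀ x, ‖bernComb V u x‖ₑ ^ p ≤ (Lam V).card ^ (p - 1) *
      ∑ U ∈ Lam V, ‖u U‖ₑ ^ p * ‖bernoulliSpline V U x‖ₑ ^ p := by
    intro x
    refine (ENNReal.rpow_le_rpow (enorm_sum_le _ _) hp0).trans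
      ((ENNReal.rpow_sum_le_const_mul_sum_rpow _ _ hp).trans (le_of_eq ?_))
    congr 1
    refine Finset.sum_congr rfl fun U _ => ?_
    rw [enorm_mul, ENNReal.mul_rpow_of_nonneg _ _ hp0]
  refine (lintegral_mono h1).trans (le_of_eq ?_)
  rw [lintegral_const_mul' _ _ (ENNReal.rpow_ne_top_of_nonneg (by linarith)
    (ENNReal.natCast_ne_top _)), lintegral_finsetSum _ fun U hUL =>
      ((measurable_bernoulliSpline hV hU hUL).enorm.pow_const p).const_mul _]
  congr 1
  refine Finset.sum_congr rfl fun U _ => ?_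
  rw [lintegral_const_mul' _ _ (ENNReal.rpow_ne_top_of_nonneg hp0 enorm_ne_top)]

/-- Testing the combination against the conjugate of `B(V,U)` isolates `u U ∫|B(V,U)|²` by
orthogonality. Since `B(V,U)` is bounded, this is controlled by the `L¹` norm of the combination,
which Jensen's inequality on the unit cube bounds by the `L^p` norm. No condition on `p` beyond `p ≥
1` is needed. -/
lemma exists_le_lintegral_bernComb (hV : Admissible V) (hU : Unimodular V) {p : ℝ} (hp : 1 ≤ p) :
    ∃ K : ℝ≥0, ∀ u : Finset (Fin n) → ℂ,
      ∑ U ∈ Lam V, ‖u U‖ₑ ^ p * ∫⁻ x in cube d, ‖bernoulliSpline V U x‖ₑ ^ p ≤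
        K * ∫⁻ x in cube d, ‖bernComb V u x‖ₑ ^ p := by
  have hp0 : 0 ≤ p := by linarith
  obtain ⟨M, hM⟩ := exists_enorm_bernoulliSpline_le hV hU
  set s : Finset (Fin n) → ℝ≥0∞ := fun U =>
    ENNReal.ofReal (∫ x in cube d, ‖bernoulliSpline V U x‖ ^ 2) with hs
  have hs0 : ∀ U ∈ Lam V, s U ≠ 0 := fun U hUL =>
    (ENNReal.ofReal_pos.2 (integral_normSq_bernoulliSpline_pos hV hU hUL)).ne'
  set K : ℝ≥0∞ := ∑ U ∈ Lam V, (M / s U) ^ p * M ^ p with hK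
  have hKt : K ≠ ⊤ := by
    refine ENNReal.sum_ne_top.2 fun U hUL => ENNReal.mul_ne_top
      (ENNReal.rpow_ne_top_of_nonneg hp0 (ENNReal.div_ne_top ENNReal.coe_ne_top (hs0 U hUL)))
      (ENNReal.rpow_ne_top_of_nonneg hp0 ENNReal.coe_ne_top)
  refine ⟨K.toNNReal, fun u => ?_⟩
  rw [ENNReal.coe_toNNReal hKt, hK, Finset.sum_mul]
  refine Finset.sum_le_sum fun U hUL => ?_
  have hm := measurable_bernComb hV hU u
  have h1 : ‖u U‖ₑ * s U ≤ M * ∫⁻ x in cube d, ‖bernComb V u x‖ₑ := by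
    have e1 : ‖u U‖ₑ * s U =
        ‖∫ x in cube d, bernComb V u x * (starRingEnd ℂ) (bernoulliSpline V U x)‖ₑ := by
      rw [integral_bernComb_mul_conj hV hU u hUL, enorm_mul, hs]
      congr 1
      rw [← ofReal_norm, Complex.norm_real,
        Real.norm_of_nonneg (integral_normSq_bernoulliSpline_pos hV hU hUL).le]
    rw [e1, ← lintegral_const_mul' _ _ ENNReal.coe_ne_top]
    refine (enorm_integral_le_lintegral_enorm _).trans (lintegral_mono fun x => ?_)
    simp only
    rw [enorm_mul, mul_comm]
    refine mul_le_mul' ?_ le_rfl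
    rw [← ofReal_norm, RCLike.norm_conj, ofReal_norm]
    exact hM U hUL x
  have h2 : ‖u U‖ₑ ≤ M / s U * ∫⁻ x in cube d, ‖bernComb V u x‖ₑ := by
    rw [ENNReal.div_eq_inv_mul, mul_assoc, ← ENNReal.div_eq_inv_mul]
    rwa [ENNReal.le_div_iff_mul_le (Or.inl (hs0 U hUL)) (Or.inl ENNReal.ofReal_ne_top)]
  have h3 : (∫⁻ x in cube d, ‖bernComb V u x‖ₑ) ^ p ≤ ∫⁻ x in cube d, ‖bernComb V u x‖ₑ ^ p := by
    have := lintegral_rpow_le (μ := volume.restrict (cube d)) (κ := fun _ => 1) (F := fun x =>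
      ‖bernComb V u x‖ₑ) aemeasurable_const hm.enorm.aemeasurable hp
    simpa using this
  have h4 : ∫⁻ x in cube d, ‖bernoulliSpline V U x‖ₑ ^ p ≤ M ^ p := by
    refine (lintegral_mono fun x => ENNReal.rpow_le_rpow (hM U hUL x) hp0).trans ?_
    simp
  calc ‖u U‖ₑ ^ p * ∫⁻ x in cube d, ‖bernoulliSpline V U x‖ₑ ^ p
      ≤ (M / s U * ∫⁻ x in cube d, ‖bernComb V u x‖ₑ) ^ p * M ^ p :=
        mul_le_mul' (ENNReal.rpow_le_rpow h2 hp0) h4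
    _ = (M / s U) ^ p * M ^ p * (∫⁻ x in cube d, ‖bernComb V u x‖ₑ) ^ p := by
        rw [ENNReal.mul_rpow_of_nonneg _ _ hp0]; ring
    _ ≤ _ := mul_le_mul' le_rfl h3

lemma lintegral_enorm_rpow_two {X : Type*} [MeasurableSpace X] {μ : Measure X} {g : X → ℂ}
    (hg : Integrable (fun x => ‖g x‖ ^ 2) μ) :
    ∫⁻ x, ‖g x‖ₑ ^ (2 : ℝ) ∂μ = ENNReal.ofReal (∫ x, ‖g x‖ ^ 2 ∂μ) := by
  rw [ofReal_integral_eq_lintegral_ofReal hg (ae_of_all _ fun x => by positivity)]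
  refine lintegral_congr fun x => ?_
  rw [ENNReal.ofReal_pow (norm_nonneg _), ofReal_norm, ← ENNReal.rpow_natCast]
  norm_num

lemma lintegral_bernComb_rpow_two (hV : Admissible V) (hU : Unimodular V)
    (u : Finset (Fin n) → ℂ) :
    ∫⁻ x in cube d, ‖bernComb V u x‖ₑ ^ (2 : ℝ) =
      ∑ U ∈ Lam V, ‖u U‖ₑ ^ (2 : ℝ) * ∫⁻ x in cube d, ‖bernoulliSpline V U x‖ₑ ^ (2 : ℝ) := by
  have hB : ∀ U ∈ Lam V, Integrable (fun x => ‖bernoulliSpline V U x‖ ^ 2)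
      (volume.restrict (cube d)) := fun U hUL =>
    (memLp_bernoulliSpline hV hU hUL 2).integrable_norm_pow (by norm_num)
  have hmem : MemLp (bernComb V u) 2 (volume.restrict (cube d)) :=
    memLp_finsetSum _ fun U hUL => (memLp_bernoulliSpline hV hU hUL 2).const_mul _
  have key : ∫ x in cube d, ‖bernComb V u x‖ ^ 2 =
      ∑ U ∈ Lam V, ‖u U‖ ^ 2 * ∫ x in cube d, ‖bernoulliSpline V U x‖ ^ 2 := by
    have h1 : ((∫ x in cube d, ‖bernComb V u x‖ ^ 2 : ℝ) : ℂ) =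
        ∫ x in cube d, ∑ U ∈ Lam V, (starRingEnd ℂ) (u U) *
          (bernComb V u x * (starRingEnd ℂ) (bernoulliSpline V U x)) := by
      rw [← integral_complex_ofReal]
      congr 1
      ext x
      rw [← Complex.normSq_eq_norm_sq, ← Complex.mul_conj]
      conv_lhs => rw [bernComb.eq_1 V u x, map_sum, ← bernComb.eq_1 V u x, Finset.mul_sum]
      refine Finset.sum_congr rfl fun U _ => ?_
      rw [map_mul]; ring
    have h2 : ∀ U ∈ Lam V, Integrable (fun x => (starRingEnd ℂ) (u U) *
        (bernComb V u x * (starRingEnd ℂ) (bernoulliSpline V U x)))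
        (volume.restrict (cube d)) := by
      intro U hUL
      obtain ⟨C, hC⟩ := exists_norm_bernoulliSpline_le hV hU hUL
      refine ((hmem.integrable one_le_two).mul_bdd (c := C) ?_ (ae_of_all _ fun x => ?_)).const_mul _
      · exact (Complex.continuous_conj.measurable.comp
          (measurable_bernoulliSpline hV hU hUL)).aestronglyMeasurable
      · rw [RCLike.norm_conj]; exact hC x
    rw [integral_finsetSum _ h2] at h1
    rw [← Complex.ofReal_inj, h1]
    push_cast
    refine Finset.sum_congr rfl fun U hUL => ?_
    rw [integral_const_mul, integral_bernComb_mul_conj hV hU u hUL, ← mul_assoc, mul_comm _ (u U),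
      Complex.mul_conj, Complex.normSq_eq_norm_sq]
    push_cast
    rfl
  rw [lintegral_enorm_rpow_two (hmem.integrable_norm_pow (by norm_num)), key,
    ENNReal.ofReal_sum_of_nonneg fun U _ => by positivity]
  refine Finset.sum_congr rfl fun U hUL => ?_
  rw [lintegral_enorm_rpow_two (hB U hUL), ENNReal.ofReal_mul (by positivity),
    ENNReal.ofReal_pow (norm_nonneg _), ofReal_norm, ← ENNReal.rpow_natCast]
  norm_num

end

section

/-! ### Equivalent expressions and the seminorm property -/

variable {d n : ℕ} {V : Fin n → Fin d → ℤ}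

lemma leadingIntegral_eq_bernComb (p : ℝ) (F : (Fin d → ℕ) → (Fin d → ℝ) → ℂ) :
    leadingIntegral V p F =
      ∫⁻ t, ∫⁻ x in cube d, ‖bernComb V (fun U => dirSum V F U t) x‖ₑ ^ p := by
  simp_rw [leadingIntegral, leading_eq_sum]
  rfl

lemma exists_equivalence (hV : Admissible V) (hU : Unimodular V) {p : ℝ} (hp : 1 ≤ p) :
    ∃ c C : ℝ≥0, 0 < c ∧ ∀ f : (Fin d → ℝ) → ℂ, MemSobolev (rho V + 1) p f →
      c * sobolevSum V p f ≤ errorIntegral V p f ∧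
      errorIntegral V p f ≤ C * sobolevSum V p f := by
  obtain ⟨K, hK⟩ := exists_le_lintegral_bernComb hV hU hp
  -- Passing from `K` to `K + 1` keeps the lower constant finite when `K = 0`. Both bounds are
  -- applied for fixed `t` to the coefficients `D_U f(t)` and then integrated.
  refine ⟨(K + 1)⁻¹, ((Lam V).card : ℝ≥0) ^ (p - 1), by positivity, fun f hf => ?_⟩
  obtain ⟨F, hF, hf0, -⟩ := exists_sobolevFamily hp hf
  rw [errorIntegral_eq hV hU hF hf0, sobolevSum_eq hF hf0, leadingIntegral_eq_bernComb]
  constructor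
  · rw [ENNReal.coe_inv (by positivity), ← ENNReal.div_eq_inv_mul]
    refine ENNReal.div_le_of_le_mul' ?_
    rw [← lintegral_const_mul' _ _ ENNReal.coe_ne_top]
    refine lintegral_mono fun t => (hK _).trans (mul_le_mul' ?_ le_rfl)
    exact_mod_cast le_add_of_nonneg_right zero_le_one
  · rw [← lintegral_const_mul' _ _ ENNReal.coe_ne_top,
      ENNReal.coe_rpow_of_nonneg _ (by linarith), ENNReal.coe_natCast]
    exact lintegral_mono fun t => lintegral_bernComb_rpow_le hV hU hp _

lemma errorIntegral_two (hV : Admissible V) (hU : Unimodular V) {f : (Fin d → ℝ) → ℂ}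
    (hf : MemSobolev (rho V + 1) 2 f) : errorIntegral V 2 f = sobolevSum V 2 f := by
  obtain ⟨F, hF, hf0, -⟩ := exists_sobolevFamily one_le_two hf
  rw [errorIntegral_eq hV hU hF hf0, sobolevSum_eq hF hf0, leadingIntegral_eq_bernComb]
  exact lintegral_congr fun t => lintegral_bernComb_rpow_two hV hU _

lemma SobolevFamily.add {m : ℕ} {p : ℝ} {F G : (Fin d → ℕ) → (Fin d → ℝ) → ℂ}
    (hF : SobolevFamily m p F) (hG : SobolevFamily m p G) :
    SobolevFamily m p fun β => F β + G β :=
  ⟨fun β => (hF.measurable β).add (hG.measurable β), fun β => (hF.memLp β).add (hG.memLp β),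
    fun β hβ => (hF.isWeakDeriv β hβ).add (hG.isWeakDeriv β hβ)⟩

lemma SobolevFamily.smul {m : ℕ} {p : ℝ} {F : (Fin d → ℕ) → (Fin d → ℝ) → ℂ}
    (hF : SobolevFamily m p F) (a : ℂ) : SobolevFamily m p fun β => a • F β :=
  ⟨fun β => (hF.measurable β).const_smul a, fun β => (hF.memLp β).const_smul a,
    fun β hβ => (hF.isWeakDeriv β hβ).smul a⟩

/-- Minkowski's inequality, since the leading term is linear in the derivatives of `f`. The scale is
set to `h = 0` in `rpow_leadingIntegral`: there `h⁻¹ = 0`, so the offset in the periodic variable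
disappears. -/
lemma errorIntegral_add_le (hV : Admissible V) (hU : Unimodular V) {p : ℝ} (hp : 1 ≤ p)
    {f g : (Fin d → ℝ) → ℂ} (hf : MemSobolev (rho V + 1) p f)
    (hg : MemSobolev (rho V + 1) p g) : errorIntegral V p (f + g) ^ (1 / p) ≤
      errorIntegral V p f ^ (1 / p) + errorIntegral V p g ^ (1 / p) := by
  obtain ⟨F, hF, hf0, -⟩ := exists_sobolevFamily hp hf
  obtain ⟨G, hG, hg0, -⟩ := exists_sobolevFamily hp hg
  rw [errorIntegral_eq hV hU hF hf0, errorIntegral_eq hV hU hG hg0,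
    errorIntegral_eq hV hU (hF.add hG) (hf0.add hg0), rpow_leadingIntegral hV hU hp hF 0,
    rpow_leadingIntegral hV hU hp hG 0, rpow_leadingIntegral hV hU hp (hF.add hG) 0]
  have hm : ∀ {F}, SobolevFamily (rho V + 1) p F → AEStronglyMeasurable
      (fun q => leading V F q.1 ((0 : ℝ)⁻¹ • q.1 + q.2)) (prodCube d) := fun hF =>
    (measurable_leading_comp hV hU hF (by fun_prop) (by fun_prop)).aestronglyMeasurable
  refine le_trans (le_of_eq ?_) (eLpNorm_add_le (hm hF) (hm hG) (by simpa using hp))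
  congr 1
  ext q
  simp only [leading, Pi.add_apply, add_mul, Finset.sum_add_distrib]

lemma errorIntegral_smul (hV : Admissible V) (hU : Unimodular V) {p : ℝ} (hp : 1 ≤ p) (a : ℂ)
    {f : (Fin d → ℝ) → ℂ} (hf : MemSobolev (rho V + 1) p f) :
    errorIntegral V p (a • f) ^ (1 / p) = ‖a‖ₑ * errorIntegral V p f ^ (1 / p) := by
  obtain ⟨F, hF, hf0, -⟩ := exists_sobolevFamily hp hf
  have hfa : a • F 0 =ᵐ[volume] a • f := hf0.const_smul a
  rw [errorIntegral_eq hV hU hF hf0, errorIntegral_eq hV hU (hF.smul a) hfa,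
    rpow_leadingIntegral hV hU hp hF 0, rpow_leadingIntegral hV hU hp (hF.smul a) 0,
    ← eLpNorm_const_smul]
  congr 1
  ext q
  simp only [leading, Pi.smul_apply, smul_eq_mul, Finset.mul_sum, mul_assoc]

end

end BoxSpline

end

theorem mainTheorem3 (d n : ℕ) (hd : 0 < d) (V : Fin n → Fin d → ℤ)
    (hV : Admissible V) (hU : Unimodular V) :
    -- the projection extends, in exactly one way, to functions of slow growth
    (∀ g : (Fin d → ℝ) → ℂ, SlowGrowth g → ∃! c, IsProjCoeff V g c) ∧
    (∀ h : ℝ, 0 < h → ∀ f : Lp ℂ 2 (volume : Measure (Fin d → ℝ)),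
      projL2 V h f =ᵐ[volume] projScaled V h f) ∧
    -- the Bernoulli splines are well defined, bounded and mutually orthogonal
    (∀ U ∈ Lam V, ∀ x : Fin d → ℝ,
      Tendsto (fun N : ℕ => bernoulliPartial V U N x) atTop (𝓝 (bernoulliSpline V U x))) ∧
    (∀ U ∈ Lam V, MemLp (bernoulliSpline V U) ⊤ (volume.restrict (cube d))) ∧
    (∀ U ∈ Lam V, ∀ U' ∈ Lam V, U ≠ U' →
      ∫ x in cube d, bernoulliSpline V U x * (starRingEnd ℂ) (bernoulliSpline V U' x) = 0) ∧
    ∀ p : ℝ, 1 ≤ p →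
      -- the asymptotic error of the orthogonal projection
      (∀ f : (Fin d → ℝ) → ℂ, MemSobolev (rho V + 1) p f →
        (∀ U ∈ Lam V, IsWeakDeriv (setDirs V U) f (weakDeriv (setDirs V U) f) ∧
          MemLp (weakDeriv (setDirs V U) f) (ENNReal.ofReal p) volume) ∧
        Tendsto (fun h : ℝ =>
            eLpNorm (fun x => (f x - projScaled V h f x) / (h : ℂ) ^ (rho V + 1))
              (ENNReal.ofReal p) volume ^ p)
          (𝓝[>] 0) (𝓝 (errorIntegral V p f)) ∧
        errorIntegral V p f < ⊤ ∧
        errorIntegral V p f = bernoulliIntegral V p f) ∧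
      -- equivalence, with equality for p = 2
      (∃ c C : ℝ≥0, 0 < c ∧ ∀ f : (Fin d → ℝ) → ℂ, MemSobolev (rho V + 1) p f →
        c * sobolevSum V p f ≤ errorIntegral V p f ∧
        errorIntegral V p f ≤ C * sobolevSum V p f) ∧
      (p = 2 → ∀ f : (Fin d → ℝ) → ℂ, MemSobolev (rho V + 1) p f →
        errorIntegral V p f = sobolevSum V p f) ∧
      -- the p-th root of the asymptotic error is a seminorm
      (∀ f g : (Fin d → ℝ) → ℂ, MemSobolev (rho V + 1) p f → MemSobolev (rho V + 1) p g →
        errorIntegral V p (f + g) ^ (1 / p) ≤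
          errorIntegral V p f ^ (1 / p) + errorIntegral V p g ^ (1 / p)) ∧
      (∀ (a : ℂ) (f : (Fin d → ℝ) → ℂ), MemSobolev (rho V + 1) p f →
        errorIntegral V p (a • f) ^ (1 / p) = ‖a‖ₑ * errorIntegral V p f ^ (1 / p)) := by
  refine ⟨fun g hg => existsUnique_isProjCoeff hV hU hg, fun h hh f => projL2_ae_eq hV hU hh f,
    fun U hUL x => tendsto_bernoulliPartial hV hU hUL x,
    fun U hUL => memLp_bernoulliSpline hV hU hUL ⊤,
    fun U hUL U' hUL' hne => integral_bernoulliSpline_mul_conj hV hU hUL hUL' hne,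
    fun p hp => ⟨fun f hf => ?_, exists_equivalence hV hU hp, ?_,
      fun f g hf hg => errorIntegral_add_le hV hU hp hf hg,
      fun a f hf => errorIntegral_smul hV hU hp a hf⟩⟩
  · obtain ⟨F, hF, hf0, -⟩ := exists_sobolevFamily hp hf
    rw [errorIntegral_eq hV hU hF hf0, bernoulliIntegral_eq hF hf0]
    refine ⟨fun U hUL => ?_, tendsto_error hV hU hp hF hf0, leadingIntegral_lt_top hV hU hp hF, rfl⟩
    have h := isWeakDeriv_dirSum hF hf0 hUL
    exact ⟨isWeakDeriv_weakDeriv h,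
      (memLp_congr_ae (weakDeriv_ae_eq h)).2 (memLp_dirSum hF U)⟩
  · rintro rfl f hf
    exact errorIntegral_two hV hU hf
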